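/- \textbf{Proposition (strands).} Let $S$ be a compact oriented hyperbolic surface of negative Euler characteristic with non-empty geodesic boundary $\gamma$, and let $\hat S = S\cup_\gamma \mathcal{C}$ be a crowned hyperbolic surface obtained by gluing to every component of $\gamma$, by an isometry, a hyperbolic crown with at least one boundary cusp; $\mathcal{C}$ denotes the union of the crowns. Fix a basepoint on every component of $\gamma$ (one $p$ for each component). On $\mathcal{C}$, let a measured lamination be given: a finite set $\mathcal{G}$ of disjoint geodesic arcs with positive weights, each running from a point of $\gamma$ that is not a basepoint to a boundary cusp, and no two of them properly homotopic, together with finitely many weighted geodesic arcs joining non-adjacent cusps of a crown, disjoint from each other and from $\mathcal{G}$. On $S$, let a measured lamination $\lambda\cup\mathcal{L}$ be given, where $\mathcal{L}$ is a finite set of disjoint geodesic arcs with positive weights, with end-points on $\gamma$ that are not basepoints and joining $\gamma$ to $\gamma$ essentially, no two of them homotopic in $S$ with end-points sliding along $\gamma$, and where $\lambda$ is a measured geodesic lamination on $S$ disjoint from $\mathcal{L}$. Assume that on each component of $\gamma$ the total transverse measures induced by $\mathcal{G}$ and by $\mathcal{L}$ are equal. Here two arcs on a crown from $\gamma$ to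 a cusp are \emph{properly homotopic} if they end at the same cusp and make the same number of integer twists around $\gamma$, that is, if they are homotopic with their end-point sliding along $\gamma$ without passing through the basepoint; and two arcs of $\hat S$ from cusp to cusp, crossing $\gamma$ twice, are \emph{properly homotopic} if their restrictions to the crowns are properly homotopic and their restrictions to $S$ are homotopic with end-points sliding along $\gamma$. A \emph{splitting} replaces an arc by finitely many disjoint properly homotopic geodesic copies with positive weights; for the arcs of $\mathcal{L}$ the end-points of the copies are obtained by sliding along $\gamma$ without passing through a basepoint. Then there is a way to split the weighted arcs of $\mathcal{G}$ and $\mathcal{L}$, to redistribute the weights, and to match the resulting arcs at common end-points on $\gamma$ so that \begin{itemize} \item[(a)] arcs that are matched have the same weight; \item[(b)] every arc $\alpha$ is replaced by properly homotopic copies (from boundary to the same boundary cusp if $\alpha\in\mathcal{G}$, from boundary to boundary if $\alpha\in\mathcal{L}$); \item[(c)] the total weight of the arcs arising from an arc $\alpha$ equals the original weight of $\alpha$; \end{itemize} and so that the resulting collection $\hat{\mathcal{L}}$ of weighted arcs on $\hat S$ consists of simple, pairwise disjoint arcs, no two of which are properly homotopic. Moreover the geodesic representatives of the arcs of $\hat{\mathcal{L}}$,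 together with $\lambda$, the arcs of the given lamination on $\mathcal{C}$ between cusps, and the geodesic sides of the crowns with infinite weight, form a measured geodesic lamination on $\hat S$. The splitting and matching is unique: for any two that satisfy (a), (b), (c) and whose resulting arcs on $\hat S$ are simple, pairwise disjoint and pairwise not properly homotopic, there is a bijection between the resulting arcs under which corresponding arcs come from the same arcs of $\mathcal{G}$ and $\mathcal{L}$, have the same weights, and are homotopic relative to their cusps with their crossings of $\gamma$ never passing through a basepoint. -/

import Mathlib

open Set Topology MeasureTheory
open scoped Matrix ENNReal

noncomputable section

/-! ### The hyperbolic plane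

The hyperbolic plane is the open unit disc of `ℂ` in the Beltrami–Klein model: geodesics are open
straight chords, the geodesic segment (ray, line) joining two points of the closed disc is the
straight segment joining them, hyperbolic convexity is Euclidean convexity, and the ideal boundary
is the unit circle. Its orientation preserving isometries are the projective maps induced by the
identity component of the orthogonal group of the quadratic form `x² + y² - z²`. -/

/-- The quadratic form `x² + y² - z²`. -/
def lorentzForm : Matrix (Fin 3) (Fin 3) ℝ := Matrix.diagonal ![1, 1, -1]

/-- `A` induces an orientation preserving isometry of the Klein disc. -/
def IsKleinIsometry (A : GL (Fin 3) ℝ) : Prop :=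
  (A : Matrix (Fin 3) (Fin 3) ℝ)ᵀ * lorentzForm * (A : Matrix (Fin 3) (Fin 3) ℝ) = lorentzForm ∧
    (A : Matrix (Fin 3) (Fin 3) ℝ).det = 1 ∧ 0 < (A : Matrix (Fin 3) (Fin 3) ℝ) 2 2

/-- The projective action of a matrix on the Klein disc and on its ideal boundary. -/
def act (A : GL (Fin 3) ℝ) (z : ℂ) : ℂ :=
  let v : Fin 3 → ℝ := (A : Matrix (Fin 3) (Fin 3) ℝ) *ᵥ ![z.re, z.im, 1]
  ⟨v 0 / v 2, v 1 / v 2⟩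

/-- The action on (ordered) pairs of points. -/
def actPair (A : GL (Fin 3) ℝ) (p : ℂ × ℂ) : ℂ × ℂ := (act A p.1, act A p.2)

/-- The limit set on the ideal boundary of a discrete group of isometries. -/
def limitSet (Γ : Subgroup (GL (Fin 3) ℝ)) : Set ℂ :=
  closure {z | ∃ A ∈ Γ, z = act A 0} ∩ Metric.sphere 0 1

/-- The convex hull of the limit set. Inside the open disc this is the universal cover of the
convex core. -/
def limitHull (Γ : Subgroup (GL (Fin 3) ℝ)) : Set ℂ := convexHull ℝ (limitSet Γ)

/-- The boundary geodesics of the universal cover of the convex core: the complete geodesics with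
end-points in the limit set that lie in the frontier of the hull. -/
def boundaryLines (Γ : Subgroup (GL (Fin 3) ℝ)) : Set (Set ℂ) :=
  {β | ∃ a ∈ limitSet Γ, ∃ b ∈ limitSet Γ, a ≠ b ∧
    openSegment ℝ a b ⊆ frontier (limitHull Γ) ∧ β = openSegment ℝ a b}

/-! ### Crowned hyperbolic surfaces -/

/-- A crowned hyperbolic surface `Ŝ`, given by its universal cover in the Klein disc, with a
basepoint on each crown boundary.

The deck group `grp` acts freely and properly discontinuously on the disc, and the quotient of the
hull of its limit set is a compact hyperbolic surface `S` with non-empty geodesic boundary `γ`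
(and, as the hull has interior, of negative Euler characteristic).
`cusps` is the set of the lifts of the boundary cusps: finitely many orbits of ideal points
outside the limit set, at least one of them behind every boundary geodesic.
`Ŝ` is the quotient of the convex hull of the limit set and the cusps. The part of this hull
behind a boundary geodesic `β` of the hull of the limit set is the universal cover of a hyperbolic
crown, glued to `S` along the component of `γ` covered by `β`.
`base` is the set of the lifts of the basepoints: one basepoint on each component of `γ`. -/
structure CrownedSurface where
  grp : Subgroup (GL (Fin 3) ℝ)
  isom : ∀ A ∈ grp, IsKleinIsometry A
  free : ∀ A ∈ grp, ∀ z ∈ Metric.ball (0 : ℂ) 1, act A z = z → A = 1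
  properlyDiscontinuous : ∀ K ⊆ Metric.ball (0 : ℂ) 1, IsCompact K →
    {A | A ∈ grp ∧ (act A '' K ∩ K).Nonempty}.Finite
  cocompact : ∃ K ⊆ Metric.ball (0 : ℂ) 1, IsCompact K ∧
    ∀ z ∈ limitHull grp ∩ Metric.ball (0 : ℂ) 1, ∃ A ∈ grp, act A z ∈ K
  nonelementary : (interior (limitHull grp)).Nonempty
  boundary_nonempty : limitSet grp ≠ Metric.sphere 0 1
  cusps : Set ℂ
  cusps_subset : cusps ⊆ Metric.sphere 0 1 \ limitSet grp
  cusps_invariant : ∀ A ∈ grp, ∀ c ∈ cusps, act A c ∈ cusps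
  cusps_finite : ∃ F : Set ℂ, F.Finite ∧ F ⊆ cusps ∧ ∀ c ∈ cusps, ∃ A ∈ grp, ∃ f ∈ F, c = act A f
  cusps_behind : ∀ β ∈ boundaryLines grp, ∃ c ∈ cusps, ∀ x ∈ β,
    Disjoint (openSegment ℝ x c) (limitHull grp)
  base : Set ℂ
  base_subset : base ⊆ ⋃₀ boundaryLines grp
  base_invariant : ∀ A ∈ grp, ∀ b ∈ base, act A b ∈ base
  base_nonempty : ∀ β ∈ boundaryLines grp, (β ∩ base).Nonempty
  base_unique : ∀ β ∈ boundaryLines grp, ∀ b ∈ β ∩ base, ∀ b' ∈ β ∩ base,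
    ∃ A ∈ grp, act A b = b'

namespace CrownedSurface

variable (X : CrownedSurface)

/-- `x` and `y` lie on the same lift of a component of `γ`. -/
def SameLine (x y : ℂ) : Prop := ∃ β ∈ boundaryLines X.grp, x ∈ β ∧ y ∈ β

/-- `x` and `y` lie on the same lift of a component of `γ` cut open at its basepoint. -/
def SameInterval (x y : ℂ) : Prop :=
  ∃ β ∈ boundaryLines X.grp, x ∈ β ∧ y ∈ β ∧ Disjoint (segment ℝ x y) X.base

/-- The geodesic sides of the crown ends (lifted, with both orientations). -/
def sides : Set (ℂ × ℂ) :=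
  {p | p.1 ∈ X.cusps ∧ p.2 ∈ X.cusps ∧ p.1 ≠ p.2 ∧
    openSegment ℝ p.1 p.2 ⊆ frontier (convexHull ℝ (limitSet X.grp ∪ X.cusps))}

/-! ### Arcs

An arc on a crown, from the crown boundary to a boundary cusp, is given by a lift: the geodesic ray
from a point `x` of a boundary geodesic to a cusp `c` behind that geodesic. An arc on `S` from `γ`
to `γ` is given by a lift: a geodesic segment between points `x false` and `x true` of two
different boundary geodesics. -/

/-- The ray from `x` to `c` is a lift of an arc on a crown from the crown boundary to a cusp. -/
def IsCrownArc (x c : ℂ) : Prop :=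
  (∃ β ∈ boundaryLines X.grp, x ∈ β) ∧ c ∈ X.cusps ∧
    Disjoint (openSegment ℝ x c) (limitHull X.grp)

/-- The segment from `x false` to `x true` is a lift of an (essential) arc on `S` from `γ` to `γ`. -/
def IsSurfaceArc (x : Bool → ℂ) : Prop :=
  (∀ s, ∃ β ∈ boundaryLines X.grp, x s ∈ β) ∧ ¬ X.SameLine (x false) (x true)

/-- The geodesic ray from `x` to the ideal point `c`. -/
def ray (x c : ℂ) : Set ℂ := segment ℝ x c \ {c}

/-- Proper homotopy of arcs on a crown: the arcs end at the same crown-tip and complete the same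
number of integer twists around `γ`, the twists being counted by the passages through the
basepoint. That is, they have lifts ending at the same ideal point and starting from the same lift
of `γ` cut open at the basepoint. -/
def CrownHomotopic (x c x' c' : ℂ) : Prop :=
  ∃ A ∈ X.grp, act A c = c' ∧ X.SameInterval (act A x) x'

/-- Homotopy of (unoriented) arcs on `S`, where the homotopy is allowed to move the end-points
along `γ`. The flag `f` tells whether orientations are reversed. -/
def SurfaceHomotopic (f : Bool) (x x' : Bool → ℂ) : Prop :=
  ∃ A ∈ X.grp, ∀ s, X.SameLine (act A (x s)) (x' (xor s f))

/-- `x` is a parallel copy of the arc `x'` on `S`: a homotopy moves one to the other, with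
end-points sliding along `γ` without passing through the basepoints. -/
def SurfaceCopy (x x' : Bool → ℂ) : Prop :=
  ∃ A ∈ X.grp, ∀ s, X.SameInterval (act A (x s)) (x' s)

/-- An arc of `Ŝ` from cusp to cusp that crosses `γ` at `x false` and `x true`: the ray from the
cusp `c false` to `x false`, the segment from `x false` to `x true`, and the ray from `x true` to
the cusp `c true`. -/
def strandTrace (x c : Bool → ℂ) : Set ℂ :=
  segment ℝ (x false) (x true) ∪ ray (x false) (c false) ∪ ray (x true) (c true)

/-- Proper homotopy of (unoriented) arcs of `Ŝ`: their restrictions to the crown ends are properly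
homotopic, and their restrictions to `S` are homotopic. -/
def StrandHomotopic (x c x' c' : Bool → ℂ) : Prop :=
  ∃ f : Bool, X.SurfaceHomotopic f x x' ∧
    ∀ s, X.CrownHomotopic (x s) (c s) (x' (xor s f)) (c' (xor s f))

end CrownedSurface

/-! ### Measured laminations -/

/-- The leaves (with both orientations) of the geodesic lamination carried by a measure on the space
of pairs of distinct ideal points. -/
def leaves (μ : Measure (ℂ × ℂ)) : Set (ℂ × ℂ) := {p | p.1 ≠ p.2 ∧ p ∈ μ.support}

/-- A measured geodesic lamination on the quotient by `Γ` of the convex hull of a `Γ`-invariant set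
`E` of ideal points, as a measure on the space of pairs of distinct ideal points (geodesics of the
disc, each counted with both orientations): it is invariant, no two leaves cross, the prescribed
leaves `T` have infinite weight, and the measure is locally finite elsewhere. Only finitely many
leaves on the quotient exit through ideal points outside the limit set. -/
structure IsMeasuredLamination (Γ : Subgroup (GL (Fin 3) ℝ)) (E : Set ℂ) (T : Set (ℂ × ℂ))
    (μ : Measure (ℂ × ℂ)) : Prop where
  concentrated : μ {p | p.1 = p.2 ∨ p.1 ∉ E ∨ p.2 ∉ E} = 0
  invariant : ∀ A ∈ Γ, μ.map (actPair A) = μ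
  symmetric : μ.map Prod.swap = μ
  not_cross : ∀ p ∈ leaves μ, ∀ q ∈ leaves μ, p = q ∨ p = q.swap ∨
    Disjoint (openSegment ℝ p.1 p.2) (openSegment ℝ q.1 q.2)
  infinite_weight : ∀ p ∈ T, μ {p} = ∞
  locally_finite : ∀ p : ℂ × ℂ, p.1 ≠ p.2 → p ∉ T → μ.FiniteAtFilter (𝓝 p)
  finite_exits : ∃ F : Set (ℂ × ℂ), F.Finite ∧
    ∀ p ∈ leaves μ, (p.1 ∉ limitSet Γ ∨ p.2 ∉ limitSet Γ) → ∃ A ∈ Γ, ∃ q ∈ F, p = actPair A q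

/-- The sum of the unit masses at all lifts (with both orientations) of the geodesic with a lift
from `p.1` to `p.2`. -/
def orbitMeasure (Γ : Subgroup (GL (Fin 3) ℝ)) (p : ℂ × ℂ) : Measure (ℂ × ℂ) :=
  Measure.sum fun A : Γ =>
    Measure.dirac (actPair (A : GL (Fin 3) ℝ) p) +
      Measure.dirac (actPair (A : GL (Fin 3) ℝ) p).swap

/-- A measured lamination on the crowns of `Ŝ` (apart from the geodesic sides): finitely many
disjoint weighted geodesic arcs, namely the arcs `𝒢` from the crown boundary (with lifts from `foot`
to `tip`), no two of them properly homotopic, and arcs between two non-adjacent cusps of a crown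
(with lifts from `(diag i).1` to `(diag i).2`). -/
structure CrownLamination (X : CrownedSurface) where
  n : ℕ
  foot : Fin n → ℂ
  tip : Fin n → ℂ
  weight : Fin n → ℝ
  weight_pos : ∀ i, 0 < weight i
  isArc : ∀ i, X.IsCrownArc (foot i) (tip i)
  foot_not_base : ∀ i, foot i ∉ X.base
  disjoint : ∀ i j, ∀ A ∈ X.grp, (i = j ∧ A = 1) ∨
    Disjoint (CrownedSurface.ray (foot i) (tip i))
      (CrownedSurface.ray (act A (foot j)) (act A (tip j)))
  not_homotopic : ∀ i j, i ≠ j → ¬ X.CrownHomotopic (foot i) (tip i) (foot j) (tip j)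
  m : ℕ
  diag : Fin m → ℂ × ℂ
  diagWeight : Fin m → ℝ
  diagWeight_pos : ∀ i, 0 < diagWeight i
  diag_cusps : ∀ i, (diag i).1 ∈ X.cusps ∧ (diag i).2 ∈ X.cusps ∧ (diag i).1 ≠ (diag i).2
  diag_crown : ∀ i, Disjoint (openSegment ℝ (diag i).1 (diag i).2) (limitHull X.grp)
  diag_not_side : ∀ i, diag i ∉ X.sides
  diag_disjoint : ∀ i j, ∀ A ∈ X.grp, (i = j ∧ A = 1) ∨
    Disjoint (openSegment ℝ (diag i).1 (diag i).2)
      (openSegment ℝ (act A (diag j).1) (act A (diag j).2))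
  diag_disjoint_arc : ∀ i j, ∀ A ∈ X.grp,
    Disjoint (openSegment ℝ (diag i).1 (diag i).2)
      (CrownedSurface.ray (act A (foot j)) (act A (tip j)))

/-- A measured lamination `λ ∪ ℒ` on `S`: finitely many disjoint weighted geodesic arcs `ℒ` from `γ`
to `γ`, no two of them homotopic, and a measured geodesic lamination `lam` on `S` that is disjoint
from these arcs. -/
structure SurfaceLamination (X : CrownedSurface) where
  n : ℕ
  pt : Fin n → Bool → ℂ
  weight : Fin n → ℝ
  weight_pos : ∀ i, 0 < weight i
  isArc : ∀ i, X.IsSurfaceArc (pt i)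
  pt_not_base : ∀ i s, pt i s ∉ X.base
  disjoint : ∀ i j, ∀ A ∈ X.grp, (i = j ∧ A = 1) ∨
    Disjoint (segment ℝ (pt i false) (pt i true))
      (segment ℝ (act A (pt j false)) (act A (pt j true)))
  not_homotopic : ∀ i j, i ≠ j → ∀ f, ¬ X.SurfaceHomotopic f (pt i) (pt j)
  lam : Measure (ℂ × ℂ)
  isLamination : IsMeasuredLamination X.grp (limitSet X.grp) ∅ lam
  lam_disjoint : ∀ p ∈ leaves lam, ∀ i,
    Disjoint (openSegment ℝ p.1 p.2) (segment ℝ (pt i false) (pt i true))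

/-- The points of the disc that project to the component of `γ` covered by `β`. -/
def orbitOf (X : CrownedSurface) (β : Set ℂ) : Set ℂ := {x | ∃ A ∈ X.grp, act A x ∈ β}

/-- The transverse measure, induced by the lamination on the crown, of the component of `γ` covered
by `β`. -/
def CrownLamination.boundaryMeasure {X : CrownedSurface} (G : CrownLamination X) (β : Set ℂ) : ℝ :=
  ∑ i, (orbitOf X β).indicator (fun _ => G.weight i) (G.foot i)

/-- The transverse measure, induced by the lamination on `S`, of the component of `γ` covered
by `β`. -/
def SurfaceLamination.boundaryMeasure {X : CrownedSurface} (L : SurfaceLamination X) (β : Set ℂ) :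
    ℝ :=
  ∑ i, ∑ s, (orbitOf X β).indicator (fun _ => L.weight i) (L.pt i s)

/-! ### Splitting and matching -/

/-- A way to split the weighted arcs of `𝒢` and `ℒ`, redistribute the weights and match the
resulting arcs.

The arcs resulting from splitting the arcs of `ℒ` are indexed by `k : Fin n`; the `k`-th has the
lift from `pt k false` to `pt k true` and is a copy of the arc `arcOf k` of `ℒ`. The arcs resulting
from splitting the arcs of `𝒢` are indexed by `(k, s) : Fin n × Bool`; the one with index `(k, s)` is
matched with the end `s` of the `k`-th arc on `S`, so it has the lift from `pt k s` to a cusp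
`tip k s`, and it is a copy of the arc `crownOf k s` of `𝒢`. -/
structure SplitMatching {X : CrownedSurface} (G : CrownLamination X) (L : SurfaceLamination X) where
  n : ℕ
  pt : Fin n → Bool → ℂ
  tip : Fin n → Bool → ℂ
  arcWeight : Fin n → ℝ
  crownWeight : Fin n → Bool → ℝ
  arcOf : Fin n → Fin L.n
  crownOf : Fin n → Bool → Fin G.n
  arcWeight_pos : ∀ k, 0 < arcWeight k
  crownWeight_pos : ∀ k s, 0 < crownWeight k s
  /-- Arcs that are matched have the same weight. -/
  weight_eq : ∀ k s, crownWeight k s = arcWeight k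
  /-- A splitting replaces an arc by properly homotopic copies. -/
  surface_copy : ∀ k, X.SurfaceCopy (pt k) (L.pt (arcOf k))
  crown_arc : ∀ k s, X.IsCrownArc (pt k s) (tip k s)
  crown_copy : ∀ k s,
    X.CrownHomotopic (pt k s) (tip k s) (G.foot (crownOf k s)) (G.tip (crownOf k s))
  /-- The total weight of the arcs arising from a splitting of an arc is its original weight. -/
  surface_sum : ∀ i, ∑ k, (if arcOf k = i then arcWeight k else 0) = L.weight i
  crown_sum : ∀ i, ∑ k, ∑ s, (if crownOf k s = i then crownWeight k s else 0) = G.weight i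

namespace SplitMatching

variable {X : CrownedSurface} {G : CrownLamination X} {L : SurfaceLamination X}

/-- The resulting arcs on `Ŝ` are simple and pairwise disjoint. -/
def PairwiseDisjoint (M : SplitMatching G L) : Prop :=
  ∀ j k, ∀ A ∈ X.grp, (j = k ∧ A = 1) ∨
    Disjoint (CrownedSurface.strandTrace (M.pt j) (M.tip j))
      (CrownedSurface.strandTrace (fun s => act A (M.pt k s)) (fun s => act A (M.tip k s)))

/-- No two of the resulting arcs on `Ŝ` are properly homotopic. -/
def NoParallel (M : SplitMatching G L) : Prop :=
  ∀ j k, j ≠ k → ¬ X.StrandHomotopic (M.pt j) (M.tip j) (M.pt k) (M.tip k)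

/-- The measure of the lamination on `Ŝ` that consists of the geodesic representatives of the
resulting arcs with their weights, the lamination `λ` on `S`, the arcs of the crowns between cusps,
and the geodesic sides with infinite weight. -/
def glued (M : SplitMatching G L) : Measure (ℂ × ℂ) :=
  (∑ k, ENNReal.ofReal (M.arcWeight k) • orbitMeasure X.grp (M.tip k false, M.tip k true)) +
    L.lam +
    (∑ i, ENNReal.ofReal (G.diagWeight i) • orbitMeasure X.grp (G.diag i)) +
    Measure.sum fun p : X.sides => (∞ : ℝ≥0∞) • Measure.dirac (p : ℂ × ℂ)

/-- Two ways of splitting and matching are the same up to homotopy: there is a bijection between the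
resulting arcs on `Ŝ` such that corresponding arcs come from the same arcs of `ℒ` and `𝒢`, have the
same weights, and are homotopic with fixed ideal end-points through arcs that cross `γ` twice, away
from the basepoints. -/
def Equivalent (M M' : SplitMatching G L) : Prop :=
  ∃ e : Fin M.n ≃ Fin M'.n, ∀ k,
    M'.arcOf (e k) = M.arcOf k ∧ M'.arcWeight (e k) = M.arcWeight k ∧
    (∀ s, M'.crownOf (e k) s = M.crownOf k s ∧ M'.crownWeight (e k) s = M.crownWeight k s) ∧
    ∃ A ∈ X.grp, ∀ s, act A (M.tip k s) = M'.tip (e k) s ∧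
      X.SameInterval (act A (M.pt k s)) (M'.pt (e k) s)

end SplitMatching

end

/-! The proof takes place in the Klein disc, where everything reduces to the signs of two polynomials:
the orientation `cross x y z` of three points and the Lorentz form `polar z w`. A point of the closed
disc behind a boundary geodesic `(a, b)` lies in its `cap`; different caps are disjoint, and no line
meets three of them. Hence the orientation of three points in three different caps depends only on
the caps, and questions about segments and rays become questions about the order of end-points on
boundary geodesics. Along such a geodesic `coord` is a multiple of the hyperbolic arc length, which the group
translates. Cocompactness makes the stabilizer of a boundary geodesic non-trivial, so that every
end-point lies between two consecutive basepoints. Cutting the boundary at the basepoints, an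
end-point is determined up to the group by its interval `cls` and its position `pos` in it.

*Combinatorics.* In each interval, thicken the end-points of the arcs on the surface, and those of the
arcs on the crowns, to consecutive strips as wide as the weights, beginning at the lower end of the
interval. The two families fill the same total length, as the transverse measures agree. A surface
arc `i` carries one strip, traversed in opposite directions at its two ends, and the parameters of
the strip at which it meets the crown arcs `g` and `h` at the two ends form the set
`overlap P Q w i g h`.

*Uniqueness.* In a disjoint splitting, the copies keep the order of the surface arcs (`pos_lt_of_arc`)
and of the crown arcs (`pos_lt_of_crown`), and the copies of one arc are in opposite orders at its
two ends (`pos_lt_reversed`). The strip of a copy therefore lies in the overlap of its label (its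
surface arc and its two crown arcs). Without parallel strands, labels are different for different
copies, and as weights and overlaps have the same sums, each weight is the length of the overlap
(`refinement_eq_overlap`). So the splitting is determined by the given laminations
(`equivalent_of_disjoint`).

*Existence.* Take one copy for each label whose overlap has positive length, with that length as
weight, and slide its end-points away from those of the original arc by a small multiple of a
position in the overlap (`IsOverlapSplitting`, `exists_splitMatching`). The slides are smaller than
the gaps between end-points, so that copies of different arcs stay disjoint, and copies of one arc
are disjoint as their orders at the two ends are opposite.

*The glued lamination.* Cusps are away from the limit set, so the denominator of an isometry `A` at a
cusp is at least a fixed multiple of the height of `A` (`exists_height_le_den`); since the Lorentz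
form is invariant, the orbit of a pair of cusps is locally finite (`exists_nhds_finite_orbit`).
This describes the support of the glued measure and shows that it is locally finite away from the
sides. Its geodesics do not cross, because moving an end-point from a boundary geodesic to a cusp
behind it does not change sides (`PairwiseDisjoint.nonCrossing`, `nonCrossing_leaf`,
`nonCrossing_diag`, `nonCrossing_side`). -/

noncomputable section

/-! ### Orientation and the Lorentz form in the Klein disc -/

/-- Twice the signed area of the triangle `x y z`; its sign is the orientation of the triangle. -/
def cross (x y z : ℂ) : ℝ :=
  (y.re - x.re) * (z.im - x.im) - (y.im - x.im) * (z.re - x.re)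

/-- Minus the Lorentz product of the lifts `(z, 1)` and `(w, 1)`. The closed disc is `0 ≤ polar z z`,
the ideal boundary is `polar z z = 0`. -/
def polar (z w : ℂ) : ℝ := 1 - z.re * w.re - z.im * w.im

/-- The third coordinate of the image of `(z, 1)`: the denominator of the projective map `act A`. -/
def den (A : GL (Fin 3) ℝ) (z : ℂ) : ℝ :=
  (A : Matrix (Fin 3) (Fin 3) ℝ) 2 0 * z.re + (A : Matrix (Fin 3) (Fin 3) ℝ) 2 1 * z.im +
    (A : Matrix (Fin 3) (Fin 3) ℝ) 2 2

lemma cross_rotate (x y z : ℂ) : cross y z x = cross x y z := by unfold cross; ring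
lemma cross_swap (x y z : ℂ) : cross y x z = -cross x y z := by unfold cross; ring
lemma cross_swap_right (x y z : ℂ) : cross x z y = -cross x y z := by unfold cross; ring
@[simp] lemma cross_self_left (x z : ℂ) : cross x x z = 0 := by unfold cross; ring
@[simp] lemma cross_self_right (x z : ℂ) : cross x z z = 0 := by unfold cross; ring
@[simp] lemma cross_self_outer (x z : ℂ) : cross x z x = 0 := by unfold cross; ring

lemma cross_combo (x y p q : ℂ) {s t : ℝ} (h : s + t = 1) :
    cross x y (s • p + t • q) = s * cross x y p + t * cross x y q := by
  obtain rfl : s = 1 - t := by linarith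
  simp only [cross, Complex.add_re, Complex.add_im, Complex.real_smul, Complex.mul_re,
    Complex.mul_im, Complex.ofReal_re, Complex.ofReal_im]
  ring

lemma polar_comm (z w : ℂ) : polar z w = polar w z := by unfold polar; ring

lemma polar_combo (z p q : ℂ) {s t : ℝ} (h : s + t = 1) :
    polar z (s • p + t • q) = s * polar z p + t * polar z q := by
  obtain rfl : s = 1 - t := by linarith
  simp only [polar, Complex.add_re, Complex.add_im, Complex.real_smul, Complex.mul_re,
    Complex.mul_im, Complex.ofReal_re, Complex.ofReal_im]
  ring

lemma polar_self (z : ℂ) : polar z z = 1 - ‖z‖ ^ 2 := by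
  rw [← Complex.normSq_eq_norm_sq, Complex.normSq_apply]; unfold polar; ring

lemma two_mul_polar (z w : ℂ) :
    2 * polar z w = ‖z - w‖ ^ 2 + polar z z + polar w w := by
  rw [← Complex.normSq_eq_norm_sq, Complex.normSq_apply]
  simp only [polar, Complex.sub_re, Complex.sub_im]; ring

lemma mem_closedBall_iff_polar {z : ℂ} : z ∈ Metric.closedBall (0 : ℂ) 1 ↔ 0 ≤ polar z z := by
  rw [mem_closedBall_zero_iff, polar_self, sub_nonneg, sq_le_one_iff₀ (norm_nonneg z)]

lemma mem_ball_iff_polar {z : ℂ} : z ∈ Metric.ball (0 : ℂ) 1 ↔ 0 < polar z z := by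
  rw [mem_ball_zero_iff, polar_self, sub_pos, sq_lt_one_iff₀ (norm_nonneg z)]

lemma mem_sphere_iff_polar {z : ℂ} : z ∈ Metric.sphere (0 : ℂ) 1 ↔ polar z z = 0 := by
  rw [mem_sphere_zero_iff_norm, polar_self, sub_eq_zero, eq_comm (a := (1 : ℝ)),
    pow_eq_one_iff_of_nonneg (norm_nonneg z) two_ne_zero]

lemma polar_nonneg {z w : ℂ} (hz : 0 ≤ polar z z) (hw : 0 ≤ polar w w) : 0 ≤ polar z w := by
  have := two_mul_polar z w; nlinarith [sq_nonneg ‖z - w‖]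

lemma polar_pos {z w : ℂ} (hz : 0 ≤ polar z z) (hw : 0 ≤ polar w w) (h : z ≠ w) :
    0 < polar z w := by
  have := two_mul_polar z w
  have h2 : 0 < ‖z - w‖ := norm_pos_iff.2 (sub_ne_zero.2 h)
  nlinarith [pow_pos h2 2]

lemma polar_pos_of_ball {z w : ℂ} (hz : 0 < polar z z) (hw : 0 ≤ polar w w) :
    0 < polar z w := by
  have := two_mul_polar z w; nlinarith [sq_nonneg ‖z - w‖]

lemma polar_le_two {z w : ℂ} (hz : 0 ≤ polar z z) (hw : 0 ≤ polar w w) : polar z w ≤ 2 := by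
  unfold polar at *
  nlinarith [sq_nonneg (z.re + w.re), sq_nonneg (z.im + w.im)]

@[simp] lemma polar_zero_left (z : ℂ) : polar 0 z = 1 := by simp [polar]
@[simp] lemma polar_zero_right (z : ℂ) : polar z 0 = 1 := by simp [polar]

lemma polar_combo_self (p q : ℂ) {s t : ℝ} (h : s + t = 1) :
    polar (s • p + t • q) (s • p + t • q) =
      s ^ 2 * polar p p + 2 * s * t * polar p q + t ^ 2 * polar q q := by
  rw [polar_combo _ _ _ h, polar_comm _ p, polar_comm _ q, polar_combo _ _ _ h,
    polar_combo _ _ _ h, polar_comm q p]; ring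

lemma polar_combo_nonneg {p q : ℂ} (hp : 0 ≤ polar p p) (hq : 0 ≤ polar q q) {s t : ℝ}
    (hs : 0 ≤ s) (ht : 0 ≤ t) (h : s + t = 1) :
    0 ≤ polar (s • p + t • q) (s • p + t • q) := by
  rw [polar_combo_self _ _ h]
  have := polar_nonneg hp hq
  positivity

/-- The open unit disc is strictly convex. -/
lemma polar_combo_pos {p q : ℂ} (hp : 0 ≤ polar p p) (hq : 0 ≤ polar q q) (hpq : p ≠ q) {s t : ℝ}
    (hs : 0 < s) (ht : 0 < t) (h : s + t = 1) :
    0 < polar (s • p + t • q) (s • p + t • q) := by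
  rw [polar_combo_self _ _ h]
  have := polar_pos hp hq hpq
  positivity

lemma polar_segment_nonneg {p q z : ℂ} (hp : 0 ≤ polar p p) (hq : 0 ≤ polar q q)
    (hz : z ∈ segment ℝ p q) : 0 ≤ polar z z := by
  obtain ⟨s, t, hs, ht, hst, rfl⟩ := hz
  exact polar_combo_nonneg hp hq hs ht hst

lemma polar_openSegment_pos {p q z : ℂ} (hp : 0 ≤ polar p p) (hq : 0 ≤ polar q q) (hpq : p ≠ q)
    (hz : z ∈ openSegment ℝ p q) : 0 < polar z z := by
  obtain ⟨s, t, hs, ht, hst, rfl⟩ := hz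
  exact polar_combo_pos hp hq hpq hs ht hst

/-- A point on the line through two points is an affine combination of them. -/
lemma exists_combo_of_cross_eq_zero {a b q : ℂ} (hab : a ≠ b) (h : cross a b q = 0) :
    ∃ s t : ℝ, s + t = 1 ∧ q = s • a + t • b := by
  have hn : 0 < (b.re - a.re) ^ 2 + (b.im - a.im) ^ 2 := by
    rcases eq_or_ne a.re b.re with h1 | h1
    · have : a.im ≠ b.im := fun h2 => hab (Complex.ext h1 h2)
      have : 0 < (b.im - a.im) ^ 2 := by positivity [sub_ne_zero.2 this.symm]
      positivity
    · have : 0 < (b.re - a.re) ^ 2 := by positivity [sub_ne_zero.2 h1.symm]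
      positivity
  set N := (b.re - a.re) ^ 2 + (b.im - a.im) ^ 2 with hN
  set t := ((b.re - a.re) * (q.re - a.re) + (b.im - a.im) * (q.im - a.im)) / N with ht
  have htN : t * N = (b.re - a.re) * (q.re - a.re) + (b.im - a.im) * (q.im - a.im) := by
    rw [ht]; field_simp
  unfold cross at h
  refine ⟨1 - t, t, by ring, Complex.ext ?_ ?_⟩
  · simp only [Complex.add_re, Complex.real_smul, Complex.mul_re, Complex.ofReal_re,
      Complex.ofReal_im]
    apply mul_right_cancel₀ hn.ne'
    linear_combination (a.re - b.re) * htN + (a.im - b.im) * h + (q.re - a.re) * hN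
  · simp only [Complex.add_im, Complex.real_smul, Complex.mul_im, Complex.ofReal_re,
      Complex.ofReal_im]
    apply mul_right_cancel₀ hn.ne'
    linear_combination (a.im - b.im) * htN - (a.re - b.re) * h + (q.im - a.im) * hN

/-- A line through two ideal points meets the closed disc in the chord between them. -/
lemma mem_segment_of_cross_eq_zero {a b q : ℂ} (ha : polar a a = 0) (hb : polar b b = 0)
    (hab : a ≠ b) (hq : 0 ≤ polar q q) (h : cross a b q = 0) : q ∈ segment ℝ a b := by
  obtain ⟨s, t, hst, rfl⟩ := exists_combo_of_cross_eq_zero hab h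
  rw [polar_combo_self _ _ hst, ha, hb] at hq
  have hp := polar_pos ha.ge hb.ge hab
  have h2 : 0 ≤ s * t := by
    by_contra hc; push Not at hc; nlinarith
  refine ⟨s, t, ?_, ?_, hst, rfl⟩ <;> nlinarith

lemma mem_openSegment_of_cross_eq_zero {a b q : ℂ} (ha : polar a a = 0) (hb : polar b b = 0)
    (hab : a ≠ b) (hq : 0 ≤ polar q q) (hqa : q ≠ a) (hqb : q ≠ b) (h : cross a b q = 0) :
    q ∈ openSegment ℝ a b :=
  mem_openSegment_of_ne_left_right hqa.symm hqb.symm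
    (mem_segment_of_cross_eq_zero ha hb hab hq h)

lemma cross_ne_zero_of_sphere {a b c : ℂ} (ha : polar a a = 0) (hb : polar b b = 0)
    (hc : polar c c = 0) (hab : a ≠ b) (hac : a ≠ c) (hbc : b ≠ c) : cross a b c ≠ 0 := by
  intro h
  have := polar_openSegment_pos ha.ge hb.ge hab
    (mem_openSegment_of_cross_eq_zero ha hb hab hc.ge hac.symm hbc.symm h)
  exact this.ne' hc

/-! ### Klein isometries -/

lemma act_re (A : GL (Fin 3) ℝ) (z : ℂ) : (act A z).re =
    ((A : Matrix (Fin 3) (Fin 3) ℝ) 0 0 * z.re + (A : Matrix (Fin 3) (Fin 3) ℝ) 0 1 * z.im +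
    (A : Matrix (Fin 3) (Fin 3) ℝ) 0 2) / den A z := by
  simp [act, den, Matrix.mulVec, dotProduct, Fin.sum_univ_three]

lemma act_im (A : GL (Fin 3) ℝ) (z : ℂ) : (act A z).im =
    ((A : Matrix (Fin 3) (Fin 3) ℝ) 1 0 * z.re + (A : Matrix (Fin 3) (Fin 3) ℝ) 1 1 * z.im +
    (A : Matrix (Fin 3) (Fin 3) ℝ) 1 2) / den A z := by
  simp [act, den, Matrix.mulVec, dotProduct, Fin.sum_univ_three]

@[simp] lemma act_one (z : ℂ) : act 1 z = z := by
  apply Complex.ext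
  · rw [act_re]; simp [den]
  · rw [act_im]; simp [den]

@[simp] lemma den_one (z : ℂ) : den 1 z = 1 := by simp [den]

lemma den_mul (A B : GL (Fin 3) ℝ) {z : ℂ} (h : den B z ≠ 0) :
    den (A * B) z = den A (act B z) * den B z := by
  rw [den, den, act_re, act_im]
  simp only [Units.val_mul, Matrix.mul_apply, Fin.sum_univ_three]
  field_simp
  unfold den; ring

lemma act_mul (A B : GL (Fin 3) ℝ) {z : ℂ} (hB : den B z ≠ 0) :
    act (A * B) z = act A (act B z) := by
  have key := den_mul A B hB
  apply Complex.ext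
  · rw [act_re, act_re A, key, eq_comm, ← mul_div_mul_right _ _ hB]
    congr 1
    rw [act_re, act_im]
    simp only [Units.val_mul, Matrix.mul_apply, Fin.sum_univ_three]
    field_simp
    unfold den; ring
  · rw [act_im, act_im A, key, eq_comm, ← mul_div_mul_right _ _ hB]
    congr 1
    rw [act_re, act_im]
    simp only [Units.val_mul, Matrix.mul_apply, Fin.sum_univ_three]
    field_simp
    unfold den; ring

/-- The entry of an isometry that measures how far it moves the centre of the disc. -/
def height (A : GL (Fin 3) ℝ) : ℝ := (A : Matrix (Fin 3) (Fin 3) ℝ) 2 2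

@[simp] lemma den_zero (A : GL (Fin 3) ℝ) : den A 0 = height A := by simp [den, height]

namespace IsKleinIsometry

variable {A : GL (Fin 3) ℝ}

lemma entry (hA : IsKleinIsometry A) (i j : Fin 3) :
    (A : Matrix (Fin 3) (Fin 3) ℝ) 0 i * (A : Matrix (Fin 3) (Fin 3) ℝ) 0 j +
    (A : Matrix (Fin 3) (Fin 3) ℝ) 1 i * (A : Matrix (Fin 3) (Fin 3) ℝ) 1 j -
    (A : Matrix (Fin 3) (Fin 3) ℝ) 2 i * (A : Matrix (Fin 3) (Fin 3) ℝ) 2 j =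
      lorentzForm i j := by
  have h := congrFun (congrFun hA.1 i) j
  rw [← h]
  simp [lorentzForm, Matrix.mul_apply, Fin.sum_univ_three, Matrix.diagonal_apply]
  ring

lemma row_two (hA : IsKleinIsometry A) :
    (A : Matrix (Fin 3) (Fin 3) ℝ) 2 0 ^ 2 + (A : Matrix (Fin 3) (Fin 3) ℝ) 2 1 ^ 2 + 1 =
      (A : Matrix (Fin 3) (Fin 3) ℝ) 2 2 ^ 2 := by
  set M := (A : Matrix (Fin 3) (Fin 3) ℝ)
  have hJ : lorentzForm * lorentzForm = 1 := by
    unfold lorentzForm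
    rw [Matrix.diagonal_mul_diagonal, ← Matrix.diagonal_one]
    congr 1
    ext i; fin_cases i <;> simp
  have h1 : (lorentzForm * Mᵀ * lorentzForm) * M = 1 := by
    rw [Matrix.mul_assoc, Matrix.mul_assoc, ← Matrix.mul_assoc Mᵀ, hA.1, hJ]
  have h2 : M * (lorentzForm * Mᵀ * lorentzForm) = 1 := mul_eq_one_comm.1 h1
  have h3 := congrFun (congrFun h2 2) 2
  simp [lorentzForm, Matrix.mul_apply, Fin.sum_univ_three, Matrix.diagonal_apply] at h3
  linarith

lemma den_pos (hA : IsKleinIsometry A) {z : ℂ} (hz : 0 ≤ polar z z) : 0 < den A z := by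
  have h := hA.row_two
  have h0 := hA.2.2
  unfold den
  unfold polar at hz
  set p := (A : Matrix (Fin 3) (Fin 3) ℝ) 2 0
  set q := (A : Matrix (Fin 3) (Fin 3) ℝ) 2 1
  set r := (A : Matrix (Fin 3) (Fin 3) ℝ) 2 2
  have h1 : (p * z.re + q * z.im) ^ 2 < r ^ 2 := by
    have e : (p * z.re + q * z.im) ^ 2 =
      (p ^ 2 + q ^ 2) * (z.re * z.re + z.im * z.im) - (p * z.im - q * z.re) ^ 2 := by ring
    have : 0 ≤ p ^ 2 + q ^ 2 := by positivity
    nlinarith [sq_nonneg (p * z.im - q * z.re)]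
  have := abs_lt_of_sq_lt_sq' h1 h0.le
  linarith [this.1]

lemma polar_act (hA : IsKleinIsometry A) {z w : ℂ} (hz : 0 ≤ polar z z) (hw : 0 ≤ polar w w) :
    polar (act A z) (act A w) * (den A z * den A w) = polar z w := by
  have dz := (hA.den_pos hz).ne'
  have dw := (hA.den_pos hw).ne'
  have e := hA.entry
  have e00 := e 0 0
  have e01 := e 0 1
  have e02 := e 0 2
  have e11 := e 1 1
  have e12 := e 1 2
  have e22 := e 2 2
  simp [lorentzForm] at e00 e01 e02 e11 e12 e22
  rw [polar, act_re, act_im, act_re, act_im]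
  field_simp
  unfold den polar
  linear_combination (-z.re * w.re) * e00 - (z.re * w.im + z.im * w.re) * e01 -
    (z.re + w.re) * e02 - z.im * w.im * e11 - (z.im + w.im) * e12 - e22

lemma polar_act_nonneg (hA : IsKleinIsometry A) {z : ℂ} (hz : 0 ≤ polar z z) :
    0 ≤ polar (act A z) (act A z) := by
  have h := hA.polar_act hz hz
  have d := hA.den_pos hz
  by_contra hc; push Not at hc
  have := mul_neg_of_neg_of_pos hc (mul_pos d d)
  linarith

lemma polar_act_pos (hA : IsKleinIsometry A) {z : ℂ} (hz : 0 < polar z z) :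
    0 < polar (act A z) (act A z) := by
  have h := hA.polar_act hz.le hz.le
  have d := hA.den_pos hz.le
  by_contra hc; push Not at hc
  have := mul_nonpos_of_nonpos_of_nonneg hc (mul_pos d d).le
  linarith

lemma polar_act_eq_zero (hA : IsKleinIsometry A) {z : ℂ} (hz : polar z z = 0) :
    polar (act A z) (act A z) = 0 := by
  have h := hA.polar_act hz.ge hz.ge
  have d := hA.den_pos hz.ge
  rw [hz] at h
  exact (mul_eq_zero.1 h).resolve_right (mul_pos d d).ne'

lemma cross_act (hA : IsKleinIsometry A) {x y z : ℂ} (hx : 0 ≤ polar x x) (hy : 0 ≤ polar y y)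
    (hz : 0 ≤ polar z z) :
    cross (act A x) (act A y) (act A z) * (den A x * den A y * den A z) = cross x y z := by
  have dx := (hA.den_pos hx).ne'
  have dy := (hA.den_pos hy).ne'
  have dz := (hA.den_pos hz).ne'
  have hd := hA.2.1
  rw [Matrix.det_fin_three] at hd
  have key : cross (act A x) (act A y) (act A z) =
      (act A x).re * (act A y).im + (act A y).re * (act A z).im + (act A z).re * (act A x).im
      - (act A x).im * (act A y).re - (act A y).im * (act A z).re
      - (act A z).im * (act A x).re := by unfold cross; ring
  rw [key]
  simp only [act_re, act_im]
  field_simp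
  unfold den cross
  linear_combination ((y.re - x.re) * (z.im - x.im) - (y.im - x.im) * (z.re - x.re)) * hd

lemma cross_act_nonneg (hA : IsKleinIsometry A) {x y z : ℂ} (hx : 0 ≤ polar x x)
    (hy : 0 ≤ polar y y) (hz : 0 ≤ polar z z) :
    0 ≤ cross (act A x) (act A y) (act A z) ↔ 0 ≤ cross x y z := by
  rw [← hA.cross_act hx hy hz]
  have := mul_pos (mul_pos (hA.den_pos hx) (hA.den_pos hy)) (hA.den_pos hz)
  exact (mul_nonneg_iff_of_pos_right this).symm

lemma den_combo (A : GL (Fin 3) ℝ) (p q : ℂ) {s t : ℝ} (h : s + t = 1) :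
    den A (s • p + t • q) = s * den A p + t * den A q := by
  obtain rfl : s = 1 - t := by linarith
  simp only [den, Complex.add_re, Complex.add_im, Complex.real_smul, Complex.mul_re,
    Complex.mul_im, Complex.ofReal_re, Complex.ofReal_im]
  ring

lemma act_combo (hA : IsKleinIsometry A) {p q : ℂ} (hp : 0 ≤ polar p p) (hq : 0 ≤ polar q q)
    {s t : ℝ} (hs : 0 ≤ s) (ht : 0 ≤ t) (h : s + t = 1) :
    act A (s • p + t • q) = (s * den A p / (s * den A p + t * den A q)) • act A p +
      (t * den A q / (s * den A p + t * den A q)) • act A q := by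
  have dp := (hA.den_pos hp)
  have dq := (hA.den_pos hq)
  have d0 := hA.den_pos (polar_combo_nonneg hp hq hs ht h)
  have d := den_combo A p q h
  rw [d] at d0
  have hs' : s = 1 - t := by linarith
  have aux : ∀ P Q : ℝ, s * den A p / (s * den A p + t * den A q) * (P / den A p) +
      t * den A q / (s * den A p + t * den A q) * (Q / den A q) =
      (s * P + t * Q) / (s * den A p + t * den A q) := by
    intro P Q; field_simp
  apply Complex.ext
  · rw [act_re, d]
    simp only [Complex.add_re, Complex.real_smul, Complex.mul_re,
      Complex.ofReal_re, Complex.ofReal_im, zero_mul, sub_zero, act_re, Complex.add_im,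
      Complex.mul_im, add_zero]
    rw [aux]
    congr 1
    rw [hs']; ring
  · rw [act_im, d]
    simp only [Complex.add_re, Complex.real_smul, Complex.mul_re,
      Complex.ofReal_re, Complex.ofReal_im, zero_mul, sub_zero, act_im, Complex.add_im,
      Complex.mul_im, add_zero]
    rw [aux]
    congr 1
    rw [hs']; ring

lemma act_mem_openSegment (hA : IsKleinIsometry A) {p q z : ℂ} (hp : 0 ≤ polar p p)
    (hq : 0 ≤ polar q q) (hz : z ∈ openSegment ℝ p q) :
    act A z ∈ openSegment ℝ (act A p) (act A q) := by
  obtain ⟨s, t, hs, ht, hst, rfl⟩ := hz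
  rw [hA.act_combo hp hq hs.le ht.le hst]
  have dp := (hA.den_pos hp)
  have dq := (hA.den_pos hq)
  exact ⟨_, _, by positivity, by positivity, by field_simp, rfl⟩

lemma act_mem_segment (hA : IsKleinIsometry A) {p q z : ℂ} (hp : 0 ≤ polar p p)
    (hq : 0 ≤ polar q q) (hz : z ∈ segment ℝ p q) :
    act A z ∈ segment ℝ (act A p) (act A q) := by
  obtain ⟨s, t, hs, ht, hst, rfl⟩ := hz
  rw [hA.act_combo hp hq hs ht hst]
  have dp := (hA.den_pos hp)
  have dq := (hA.den_pos hq)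
  have d0 := hA.den_pos (polar_combo_nonneg hp hq hs ht hst)
  rw [den_combo A p q hst] at d0
  exact ⟨_, _, by positivity, by positivity, by field_simp, rfl⟩

lemma one_le_height (hA : IsKleinIsometry A) : 1 ≤ height A := by
  have h := hA.row_two
  have := hA.2.2
  unfold height
  nlinarith [sq_nonneg ((A : Matrix (Fin 3) (Fin 3) ℝ) 2 0),
    sq_nonneg ((A : Matrix (Fin 3) (Fin 3) ℝ) 2 1)]

lemma height_pos (hA : IsKleinIsometry A) : 0 < height A := one_pos.trans_le hA.one_le_height

lemma den_eq_height_mul (hA : IsKleinIsometry A) (hA' : IsKleinIsometry A⁻¹) {z : ℂ}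
    (hz : 0 ≤ polar z z) : den A z = height A * polar z (act A⁻¹ 0) := by
  have h0 : 0 ≤ polar (0:ℂ) 0 := by simp
  have hw := hA'.polar_act_nonneg h0
  have e : act A (act A⁻¹ 0) = 0 := by
    rw [← act_mul _ _ (hA'.den_pos h0).ne', mul_inv_cancel, act_one]
  have h1 := hA.polar_act hz hw
  have h2 := hA.polar_act h0 hw
  rw [e] at h1 h2
  simp at h1 h2
  rw [← h1]
  linear_combination (-den A z) * h2

lemma continuousAt_act (hA : IsKleinIsometry A) {z : ℂ} (hz : 0 ≤ polar z z) :
    ContinuousAt (act A) z := by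
  have e : act A = fun z => Complex.equivRealProdCLM.symm ((act A z).re, (act A z).im) := by
    ext z; apply Complex.ext <;> simp
  have hd : ContinuousAt (den A) z := by unfold den; fun_prop
  have := (hA.den_pos hz).ne'
  rw [e]
  apply Complex.equivRealProdCLM.symm.continuous.continuousAt.comp
  simp only [act_re, act_im]
  apply ContinuousAt.prodMk
  · apply ContinuousAt.div _ hd this
    fun_prop
  · apply ContinuousAt.div _ hd this
    fun_prop

end IsKleinIsometry
end

noncomputable section

/-! ### The deck group and the limit set -/

/-- The compact subset `ε ≤ polar z z` of the open disc. -/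
lemma isCompact_polar_ge (ε : ℝ) (hε : 0 ≤ ε) : IsCompact {z : ℂ | ε ≤ polar z z} := by
  apply (isCompact_closedBall (0 : ℂ) 1).of_isClosed_subset
  · apply isClosed_le continuous_const
    unfold polar; fun_prop
  · intro z hz
    exact mem_closedBall_iff_polar.2 (hε.trans hz)

namespace CrownedSurface

variable (X : CrownedSurface)

variable {X} {A B : GL (Fin 3) ℝ}

lemma isom_inv (hA : A ∈ X.grp) : IsKleinIsometry A⁻¹ := X.isom _ (inv_mem hA)

lemma act_mul_of_mem (hB : B ∈ X.grp) {z : ℂ} (hz : 0 ≤ polar z z) :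
    act (A * B) z = act A (act B z) :=
  act_mul A B ((X.isom B hB).den_pos hz).ne'

lemma act_inv_act (hA : A ∈ X.grp) {z : ℂ} (hz : 0 ≤ polar z z) : act A⁻¹ (act A z) = z := by
  rw [← act_mul_of_mem hA hz, inv_mul_cancel, act_one]

lemma act_act_inv (hA : A ∈ X.grp) {z : ℂ} (hz : 0 ≤ polar z z) : act A (act A⁻¹ z) = z := by
  rw [← act_mul_of_mem (inv_mem hA) hz, mul_inv_cancel, act_one]

lemma act_injective (hA : A ∈ X.grp) {z w : ℂ} (hz : 0 ≤ polar z z) (hw : 0 ≤ polar w w)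
    (h : act A z = act A w) : z = w := by
  rw [← act_inv_act hA hz, h, act_inv_act hA hw]

/-- Only finitely many deck transformations map a point of a compact set of the disc into another
one. -/
lemma finite_moving {ε : ℝ} (hε : 0 < ε) :
    {A | A ∈ X.grp ∧ ∃ z, ε ≤ polar z z ∧ ε ≤ polar (act A z) (act A z)}.Finite := by
  apply (X.properlyDiscontinuous {z | ε ≤ polar z z} (fun z hz => mem_ball_iff_polar.2
    (hε.trans_le hz)) (isCompact_polar_ge ε hε.le)).subset
  rintro A ⟨hA, z, hz, hz'⟩
  exact ⟨hA, act A z, ⟨z, hz, rfl⟩, hz'⟩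

lemma finite_height_le (R : ℝ) : {A | A ∈ X.grp ∧ height A ≤ R}.Finite := by
  rcases lt_or_ge R 1 with h | h
  · convert Set.finite_empty
    ext A
    simp only [mem_ofPred_eq, mem_empty_iff_false, iff_false, not_and, not_le]
    intro hA
    exact h.trans_le (X.isom A hA).one_le_height
  · apply (finite_moving (X := X) (ε := 1 / R ^ 2) (by positivity)).subset
    rintro A ⟨hA, hR⟩
    have h1 := (X.isom A hA).polar_act (z := 0) (w := 0) (by simp) (by simp)
    have h0 := (X.isom A hA).height_pos
    refine ⟨hA, 0, ?_, ?_⟩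
    · simp only [polar_zero_left]
      rw [div_le_one (by positivity)]; nlinarith
    · simp only [den_zero, polar_zero_left] at h1
      rw [div_le_iff₀ (by positivity)]
      rw [← h1]
      gcongr
      · exact (X.isom A hA).polar_act_nonneg (by simp)
      · nlinarith

instance : Countable X.grp := by
  have : (X.grp : Set (GL (Fin 3) ℝ)) = ⋃ n : ℕ, {A | A ∈ X.grp ∧ height A ≤ n} := by
    ext A
    simp only [SetLike.mem_coe, mem_iUnion, mem_ofPred_eq]
    refine ⟨fun h => ?_, fun ⟨_, h⟩ => h.1⟩
    obtain ⟨n, hn⟩ := exists_nat_ge (height A)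
    exact ⟨n, h, hn⟩
  have h2 : (X.grp : Set (GL (Fin 3) ℝ)).Countable := by
    rw [this]
    exact countable_iUnion fun n => (finite_height_le (n : ℝ)).countable
  exact h2.to_subtype

lemma eq_one_of_fixes_two (hA : A ∈ X.grp) {a b : ℂ} (ha : polar a a = 0) (hb : polar b b = 0)
    (hab : a ≠ b) (ha' : act A a = a) (hb' : act A b = b) (h : den A a = 1) : A = 1 := by
  have h1 := (X.isom A hA).polar_act ha.ge hb.ge
  rw [ha', hb', h, one_mul] at h1
  have hp := polar_pos ha.ge hb.ge hab
  have hd : den A b = 1 := mul_left_cancel₀ hp.ne' (by rw [h1, mul_one])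
  apply X.free A hA _ (mem_ball_iff_polar.2 (polar_combo_pos ha.ge hb.ge hab
    (s := 1 / 2) (t := 1 / 2) (by norm_num) (by norm_num) (by norm_num)))
  rw [(X.isom A hA).act_combo ha.ge hb.ge (by norm_num) (by norm_num) (by norm_num), ha', hb', h,
    hd]
  norm_num

/-- A deck transformation with three ideal fixed points is trivial. -/
lemma eq_one_of_fixes_three (hA : A ∈ X.grp) {a b c : ℂ} (ha : polar a a = 0)
    (hb : polar b b = 0) (hc : polar c c = 0) (hab : a ≠ b) (hac : a ≠ c) (hbc : b ≠ c)
    (ha' : act A a = a) (hb' : act A b = b) (hc' : act A c = c) : A = 1 := by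
  apply eq_one_of_fixes_two hA ha hb hab ha' hb'
  have e : ∀ {p q : ℂ}, polar p p = 0 → polar q q = 0 → p ≠ q → act A p = p → act A q = q →
      den A p * den A q = 1 := by
    intro p q hp hq hpq hp' hq'
    have h1 := (X.isom A hA).polar_act hp.ge hq.ge
    rw [hp', hq'] at h1
    exact mul_left_cancel₀ (polar_pos hp.ge hq.ge hpq).ne' (by rw [h1, mul_one])
  have e1 := e ha hb hab ha' hb'
  have e2 := e ha hc hac ha' hc'
  have e3 := e hb hc hbc hb' hc'
  have d := (X.isom A hA).den_pos ha.ge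
  have : den A a ^ 2 = 1 := by
    calc den A a ^ 2 = (den A a * den A b) * (den A a * den A c) := by
          rw [pow_two]; linear_combination (-den A a ^ 2) * e3
      _ = 1 := by rw [e1, e2, one_mul]
  exact (pow_eq_one_iff_of_nonneg d.le two_ne_zero).1 this

/-- The deck group has no involutions: the midpoint between the centre and its image would be
fixed. -/
lemma eq_one_of_mul_self (hA : A ∈ X.grp) (h : A * A = 1) : A = 1 := by
  have hI := X.isom A hA
  have h0 : (0 : ℝ) ≤ polar 0 0 := by simp
  have hp := hI.height_pos
  have hA0 := hI.polar_act_nonneg h0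
  have e1 : act A (act A 0) = 0 := by rw [← act_mul_of_mem hA h0, h, act_one]
  have e2 : den A (act A 0) * height A = 1 := by
    rw [← den_zero, ← den_mul A A (by simpa using hp.ne'), h, den_one]
  have hd : den A (act A 0) = 1 / height A := by field_simp; linarith
  have hs : (1 / (1 + height A)) + height A / (1 + height A) = 1 := by field_simp
  have hs1 : 0 < 1 / (1 + height A) := by positivity
  have hs2 : 0 < height A / (1 + height A) := by positivity
  have hz : 0 < polar ((1 / (1 + height A)) • (0 : ℂ) + (height A / (1 + height A)) • act A 0)
      ((1 / (1 + height A)) • (0 : ℂ) + (height A / (1 + height A)) • act A 0) := by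
    rw [polar_combo_self _ _ hs]
    simp only [polar_zero_left]
    positivity
  apply X.free A hA _ (mem_ball_iff_polar.2 hz)
  rw [hI.act_combo h0 hA0 hs1.le hs2.le hs, e1, hd, den_zero, smul_zero, smul_zero, zero_add,
    add_zero]
  congr 1
  field_simp
  ring

lemma polar_of_mem_limitSet {z : ℂ} (hz : z ∈ limitSet X.grp) : polar z z = 0 :=
  mem_sphere_iff_polar.1 hz.2

lemma polar_of_mem_cusps {z : ℂ} (hz : z ∈ X.cusps) : polar z z = 0 :=
  mem_sphere_iff_polar.1 (X.cusps_subset hz).1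

lemma act_mem_limitSet (hA : A ∈ X.grp) {z : ℂ} (hz : z ∈ limitSet X.grp) :
    act A z ∈ limitSet X.grp := by
  have hp := polar_of_mem_limitSet hz
  refine ⟨?_, mem_sphere_iff_polar.2 ((X.isom A hA).polar_act_eq_zero hp)⟩
  have hc := (X.isom A hA).continuousAt_act hp.ge
  apply hc.continuousWithinAt.mem_closure hz.1
  rintro _ ⟨B, hB, rfl⟩
  exact ⟨A * B, mul_mem hA hB, by rw [act_mul_of_mem hB (by simp)]⟩

lemma polar_of_mem_limitHull {z : ℂ} (hz : z ∈ limitHull X.grp) : 0 ≤ polar z z := by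
  rw [← mem_closedBall_iff_polar]
  have : limitHull X.grp ⊆ Metric.closedBall (0 : ℂ) 1 :=
    convexHull_min (fun x hx => Metric.sphere_subset_closedBall hx.2) (convex_closedBall _ _)
  exact this hz

lemma convex_limitHull : Convex ℝ (limitHull X.grp) := convex_convexHull ℝ _

lemma limitSet_subset_limitHull : limitSet X.grp ⊆ limitHull X.grp := subset_convexHull ℝ _

lemma act_mem_limitHull (hA : A ∈ X.grp) {z : ℂ} (hz : z ∈ limitHull X.grp) :
    act A z ∈ limitHull X.grp := by
  have : limitHull X.grp ⊆ {z | 0 ≤ polar z z ∧ act A z ∈ limitHull X.grp} := by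
    apply convexHull_min
    · intro x hx
      exact ⟨(polar_of_mem_limitSet hx).ge, limitSet_subset_limitHull (act_mem_limitSet hA hx)⟩
    · intro x hx y hy s t hs ht hst
      refine ⟨polar_combo_nonneg hx.1 hy.1 hs ht hst, ?_⟩
      apply convex_limitHull.segment_subset hx.2 hy.2
      apply (X.isom A hA).act_mem_segment hx.1 hy.1
      exact ⟨s, t, hs, ht, hst, rfl⟩
  exact (this hz).2

/-! ### Boundary geodesics -/

variable (X) in
/-- The chord from `a` to `b` is a boundary geodesic of the hull of the limit set, oriented so that
the hull lies on its left. -/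
structure IsEdge (a b : ℂ) : Prop where
  left : a ∈ limitSet X.grp
  right : b ∈ limitSet X.grp
  ne : a ≠ b
  nonneg : ∀ h ∈ limitHull X.grp, 0 ≤ cross a b h

variable {a b a' b' : ℂ}

namespace IsEdge

lemma polar_left (h : X.IsEdge a b) : polar a a = 0 := polar_of_mem_limitSet h.left
lemma polar_right (h : X.IsEdge a b) : polar b b = 0 := polar_of_mem_limitSet h.right

lemma map (h : X.IsEdge a b) (hA : A ∈ X.grp) : X.IsEdge (act A a) (act A b) where
  left := act_mem_limitSet hA h.left
  right := act_mem_limitSet hA h.right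
  ne := fun e => h.ne (act_injective hA h.polar_left.ge h.polar_right.ge e)
  nonneg := fun p hp => by
    have h1 := act_mem_limitHull (inv_mem hA) hp
    rw [← act_act_inv hA (polar_of_mem_limitHull hp), (X.isom A hA).cross_act_nonneg
      h.polar_left.ge h.polar_right.ge (polar_of_mem_limitHull h1)]
    exact h.nonneg _ h1

lemma openSegment_subset (h : X.IsEdge a b) : openSegment ℝ a b ⊆ limitHull X.grp :=
  convex_limitHull.openSegment_subset (limitSet_subset_limitHull h.left)
    (limitSet_subset_limitHull h.right)

lemma polar_pos (h : X.IsEdge a b) {x : ℂ} (hx : x ∈ openSegment ℝ a b) : 0 < polar x x :=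
  polar_openSegment_pos h.polar_left.ge h.polar_right.ge h.ne hx

lemma cross_eq_zero {x : ℂ} (hx : x ∈ openSegment ℝ a b) : cross a b x = 0 := by
  obtain ⟨s, t, -, -, hst, rfl⟩ := hx
  rw [cross_combo _ _ _ _ hst]; simp

end IsEdge

variable (X) in
/-- A point of the open disc that lies strictly on the inner side of all boundary geodesics. -/
lemma exists_center : ∃ o ∈ limitHull X.grp, 0 < polar o o ∧
    ∀ a b, X.IsEdge a b → 0 < cross a b o := by
  obtain ⟨o, ho⟩ := X.nonelementary
  refine ⟨o, interior_subset ho, ?_, ?_⟩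
  · rw [← mem_ball_iff_polar, ← interior_closedBall _ one_ne_zero]
    exact interior_mono (fun z hz => mem_closedBall_iff_polar.2 (polar_of_mem_limitHull hz)) ho
  · intro a b h
    obtain ⟨r, hr, hball⟩ := Metric.mem_nhds_iff.1 (mem_interior_iff_mem_nhds.1 ho)
    have hn : 0 < ‖b - a‖ := norm_pos_iff.2 (sub_ne_zero.2 h.ne.symm)
    set k : ℝ := r / 2 / ‖b - a‖ with hk
    have hk0 : 0 < k := by positivity
    have hp : o - k * (Complex.I * (b - a)) ∈ limitHull X.grp := by
      apply hball
      rw [mem_ball_iff_norm, sub_sub_cancel_left, norm_neg, norm_mul, norm_mul, Complex.norm_I,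
        one_mul, Complex.norm_real, Real.norm_of_nonneg hk0.le, hk, div_mul_cancel₀ _ hn.ne']
      linarith
    have h1 := h.nonneg _ hp
    have h2 : cross a b (o - k * (Complex.I * (b - a))) = cross a b o - k * ‖b - a‖ ^ 2 := by
      rw [← Complex.normSq_eq_norm_sq, Complex.normSq_apply]
      simp [cross]; ring
    have : 0 < k * ‖b - a‖ ^ 2 := by positivity
    linarith

lemma IsEdge.eq_of_mem (h : X.IsEdge a b) (h' : X.IsEdge a' b') {x : ℂ}
    (hx : x ∈ openSegment ℝ a b) (hx' : x ∈ openSegment ℝ a' b') : a = a' ∧ b = b' := by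
  have ha := h'.nonneg a (limitSet_subset_limitHull h.left)
  have hb := h'.nonneg b (limitSet_subset_limitHull h.right)
  have h0 := IsEdge.cross_eq_zero hx'
  obtain ⟨s, t, hs, ht, hst, rfl⟩ := hx
  rw [cross_combo _ _ _ _ hst] at h0
  have ha0 : cross a' b' a = 0 := by nlinarith
  have hb0 : cross a' b' b = 0 := by nlinarith
  have key : ∀ c, polar c c = 0 → cross a' b' c = 0 → c = a' ∨ c = b' := by
    intro c hc hc0
    by_contra hcon
    push Not at hcon
    exact cross_ne_zero_of_sphere h'.polar_left h'.polar_right hc h'.ne hcon.1.symm hcon.2.symm hc0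
  rcases key a h.polar_left ha0 with rfl | rfl <;> rcases key b h.polar_right hb0 with rfl | rfl
  · exact absurd rfl h.ne
  · exact ⟨rfl, rfl⟩
  · exfalso
    obtain ⟨o, -, -, ho⟩ := X.exists_center
    have h1 := ho _ _ h
    have h2 := ho _ _ h'
    rw [cross_swap] at h1; linarith
  · exact absurd rfl h.ne

/-- A chord on a supporting line of a set lies in its frontier. -/
lemma openSegment_subset_frontier {C : Set ℂ} {a b : ℂ} (hab : a ≠ b) (hC : openSegment ℝ a b ⊆ C)
    (h : ∀ p ∈ C, 0 ≤ cross a b p) : openSegment ℝ a b ⊆ frontier C := by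
  intro x hx
  refine ⟨subset_closure (hC hx), ?_⟩
  intro hi
  obtain ⟨r, hr, hball⟩ := Metric.mem_nhds_iff.1 (mem_interior_iff_mem_nhds.1 hi)
  have hn : 0 < ‖b - a‖ := norm_pos_iff.2 (sub_ne_zero.2 hab.symm)
  set k : ℝ := r / 2 / ‖b - a‖ with hk
  have hk0 : 0 < k := by positivity
  have hp : x - k * (Complex.I * (b - a)) ∈ C := by
    apply hball
    rw [mem_ball_iff_norm, sub_sub_cancel_left, norm_neg, norm_mul, norm_mul, Complex.norm_I,
      one_mul, Complex.norm_real, Real.norm_of_nonneg hk0.le, hk, div_mul_cancel₀ _ hn.ne']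
    linarith
  have h1 := h _ hp
  have h2 : cross a b (x - k * (Complex.I * (b - a))) = cross a b x - k * ‖b - a‖ ^ 2 := by
    rw [← Complex.normSq_eq_norm_sq, Complex.normSq_apply]
    simp [cross]; ring
  rw [h2, IsEdge.cross_eq_zero hx] at h1
  have : 0 < k * ‖b - a‖ ^ 2 := by positivity
  linarith

lemma IsEdge.mem_boundaryLines (h : X.IsEdge a b) :
    openSegment ℝ a b ∈ boundaryLines X.grp :=
  ⟨a, h.left, b, h.right, h.ne, openSegment_subset_frontier h.ne h.openSegment_subset h.nonneg, rfl⟩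

/-- A chord in the frontier of a convex set lies on a supporting line of the set. -/
lemma exists_cross_sign_of_subset_frontier {C : Set ℂ} (hC : Convex ℝ C)
    (hi : (interior C).Nonempty) {a b : ℂ} (hab : a ≠ b) (ha : a ∈ C) (hb : b ∈ C)
    (h : openSegment ℝ a b ⊆ frontier C) :
    (∀ p ∈ C, 0 ≤ cross a b p) ∨ ∀ p ∈ C, 0 ≤ cross b a p := by
  have hm : (1 / 2 : ℝ) • a + (1 / 2 : ℝ) • b ∉ interior C :=
    (h ⟨1 / 2, 1 / 2, by norm_num, by norm_num, by norm_num, rfl⟩).2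
  obtain ⟨f, hf⟩ := geometric_hahn_banach_open_point hC.interior isOpen_interior hm
  have hf' : ∀ p ∈ C, f p ≤ f ((1 / 2 : ℝ) • a + (1 / 2 : ℝ) • b) := by
    intro p hp
    have : p ∈ closure (interior C) := by
      rw [hC.closure_interior_eq_closure_of_nonempty_interior hi]; exact subset_closure hp
    have hcl : IsClosed {q | f q ≤ f ((1 / 2 : ℝ) • a + (1 / 2 : ℝ) • b)} :=
      isClosed_le f.continuous continuous_const
    exact closure_minimal (fun q hq => (hf q hq).le) hcl this
  have hform : ∀ z : ℂ, f z = z.re * f 1 + z.im * f Complex.I := by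
    intro z
    conv_lhs => rw [← Complex.re_add_im z]
    have e1 : (z.re : ℂ) = z.re • (1 : ℂ) := by simp
    have e2 : (z.im : ℂ) * Complex.I = z.im • Complex.I := by simp
    rw [map_add, e1, e2, map_smul, map_smul, smul_eq_mul, smul_eq_mul]
  have hma : f ((1 / 2 : ℝ) • a + (1 / 2 : ℝ) • b) = 1 / 2 * f a + 1 / 2 * f b := by
    rw [map_add, map_smul, map_smul, smul_eq_mul, smul_eq_mul]
  have h1 := hf' a ha
  have h2 := hf' b hb
  rw [hma] at h1 h2 hf'
  have hfab : f a = f b := by linarith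
  have hfC : ∀ p ∈ C, f p ≤ f a := fun p hp => by linarith [hf' p hp]
  obtain ⟨o, ho⟩ := hi
  have hlt : f o < f a := by have := hf o ho; rw [hma] at this; linarith
  -- the functional is a multiple of the signed area
  have hN : 0 < ‖b - a‖ ^ 2 := by
    have := norm_pos_iff.2 (sub_ne_zero.2 hab.symm); positivity
  have hN' : ‖b - a‖ ^ 2 = (b.re - a.re) ^ 2 + (b.im - a.im) ^ 2 := by
    rw [← Complex.normSq_eq_norm_sq, Complex.normSq_apply]; simp; ring
  have key : ∀ p, (f p - f a) * ‖b - a‖ ^ 2 =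
      cross a b p * (-(b.im - a.im) * f 1 + (b.re - a.re) * f Complex.I) := by
    intro p
    have e := hfab
    rw [hform a, hform b] at e
    rw [hform p, hform a, hN']
    unfold cross
    linear_combination (-((b.re - a.re) * (p.re - a.re) + (b.im - a.im) * (p.im - a.im))) * e
  set k := -(b.im - a.im) * f 1 + (b.re - a.re) * f Complex.I
  rcases lt_trichotomy k 0 with hk | hk | hk
  · left
    intro p hp
    have h3 := key p
    have h4 := hfC p hp
    by_contra hc; push Not at hc
    nlinarith [mul_pos_of_neg_of_neg hc hk]
  · have h3 := key o
    rw [hk, mul_zero] at h3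
    nlinarith
  · right
    intro p hp
    have h3 := key p
    have h4 := hfC p hp
    rw [cross_swap]
    by_contra hc; push Not at hc
    have : 0 < cross a b p := by linarith
    nlinarith [mul_pos this hk]

lemma mem_boundaryLines_iff {β : Set ℂ} :
    β ∈ boundaryLines X.grp ↔ ∃ a b, X.IsEdge a b ∧ β = openSegment ℝ a b := by
  constructor
  · rintro ⟨a, ha, b, hb, hab, hf, rfl⟩
    rcases exists_cross_sign_of_subset_frontier convex_limitHull X.nonelementary hab
      (limitSet_subset_limitHull ha) (limitSet_subset_limitHull hb) hf with h | h
    · exact ⟨a, b, ⟨ha, hb, hab, h⟩, rfl⟩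
    · exact ⟨b, a, ⟨hb, ha, hab.symm, h⟩, openSegment_symm ℝ a b⟩
  · rintro ⟨a, b, h, rfl⟩
    exact h.mem_boundaryLines

lemma exists_mem_boundaryLines_iff {x : ℂ} :
    (∃ β ∈ boundaryLines X.grp, x ∈ β) ↔ ∃ a b, X.IsEdge a b ∧ x ∈ openSegment ℝ a b := by
  constructor
  · rintro ⟨β, hβ, hx⟩
    obtain ⟨a, b, h, rfl⟩ := mem_boundaryLines_iff.1 hβ
    exact ⟨a, b, h, hx⟩
  · rintro ⟨a, b, h, hx⟩
    exact ⟨_, h.mem_boundaryLines, hx⟩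

lemma sameLine_iff {x y : ℂ} : X.SameLine x y ↔
    ∃ a b, X.IsEdge a b ∧ x ∈ openSegment ℝ a b ∧ y ∈ openSegment ℝ a b := by
  constructor
  · rintro ⟨β, hβ, hx, hy⟩
    obtain ⟨a, b, h, rfl⟩ := mem_boundaryLines_iff.1 hβ
    exact ⟨a, b, h, hx, hy⟩
  · rintro ⟨a, b, h, hx, hy⟩
    exact ⟨_, h.mem_boundaryLines, hx, hy⟩

lemma IsEdge.act_mem (h : X.IsEdge a b) (hA : A ∈ X.grp) {x : ℂ} (hx : x ∈ openSegment ℝ a b) :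
    act A x ∈ openSegment ℝ (act A a) (act A b) :=
  (X.isom A hA).act_mem_openSegment h.polar_left.ge h.polar_right.ge hx

/-- A deck transformation that maps a point of a boundary geodesic to a point of a boundary geodesic
maps the first geodesic to the second one. -/
lemma IsEdge.act_eq (h : X.IsEdge a b) (h' : X.IsEdge a' b') (hA : A ∈ X.grp) {x : ℂ}
    (hx : x ∈ openSegment ℝ a b) (hx' : act A x ∈ openSegment ℝ a' b') :
    act A a = a' ∧ act A b = b' :=
  (h.map hA).eq_of_mem h' (h.act_mem hA hx) hx'

/-! ### Caps -/

variable (X) in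
/-- The part of the closed disc behind a boundary geodesic, including the geodesic itself but not
its end-points. -/
def cap (a b : ℂ) : Set ℂ := {p | 0 ≤ polar p p ∧ p ≠ a ∧ p ≠ b ∧ cross a b p ≤ 0}

lemma IsEdge.subset_cap (h : X.IsEdge a b) {x : ℂ} (hx : x ∈ openSegment ℝ a b) :
    x ∈ cap a b := by
  refine ⟨(h.polar_pos hx).le, ?_, ?_, (IsEdge.cross_eq_zero hx).le⟩
  · rintro rfl; exact (h.polar_pos hx).ne' h.polar_left
  · rintro rfl; exact (h.polar_pos hx).ne' h.polar_right

/-- A ray from an inner point to a point of the cap crosses the boundary geodesic. -/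
lemma IsEdge.exists_crossing (h : X.IsEdge a b) {o p : ℂ} (ho : 0 < polar o o)
    (ho' : 0 < cross a b o) (hp : p ∈ cap a b) :
    ∃ t : ℝ, 0 < t ∧ t ≤ 1 ∧ (1 - t) • o + t • p ∈ openSegment ℝ a b ∧
      (1 - t) * cross a b o + t * cross a b p = 0 := by
  obtain ⟨hp0, hpa, hpb, hpc⟩ := hp
  set t := cross a b o / (cross a b o - cross a b p) with ht
  have hd : 0 < cross a b o - cross a b p := by linarith
  have ht0 : 0 < t := by positivity
  have ht1 : t ≤ 1 := by rw [ht, div_le_one hd]; linarith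
  have e : (1 - t) * cross a b o + t * cross a b p = 0 := by rw [ht]; field_simp; ring
  refine ⟨t, ht0, ht1, ?_, e⟩
  rcases ht1.eq_or_lt with h1 | h1
  · rw [h1] at e ⊢
    simp only [sub_self, zero_mul, one_mul, zero_add, zero_smul, one_smul] at e ⊢
    exact mem_openSegment_of_cross_eq_zero h.polar_left h.polar_right h.ne hp0 hpa hpb e
  · have hpos : 0 < polar ((1 - t) • o + t • p) ((1 - t) • o + t • p) := by
      rw [polar_combo_self _ _ (by ring)]
      have := polar_nonneg ho.le hp0
      have : 0 < 1 - t := by linarith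
      positivity
    apply mem_openSegment_of_cross_eq_zero h.polar_left h.polar_right h.ne hpos.le
    · intro he; rw [he] at hpos; exact hpos.ne' h.polar_left
    · intro he; rw [he] at hpos; exact hpos.ne' h.polar_right
    · rw [cross_combo _ _ _ _ (by ring)]; exact e

/-- The caps of different boundary geodesics are disjoint. -/
lemma IsEdge.cross_pos_of_mem_cap (h : X.IsEdge a b) (h' : X.IsEdge a' b')
    (hne : ¬ (a = a' ∧ b = b')) {p : ℂ} (hp : p ∈ cap a b) : 0 < cross a' b' p := by
  by_contra hc
  push Not at hc
  -- the segment from a point inside the hull to `p` would leave the hull through both geodesics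
  obtain ⟨o, -, ho, hpos⟩ := X.exists_center
  have h1 := hpos _ _ h
  have h1' := hpos _ _ h'
  obtain ⟨t, ht0, ht1, hx, e⟩ := h.exists_crossing ho h1 hp
  have hp' : p ∈ cap a' b' := by
    refine ⟨hp.1, ?_, ?_, hc⟩
    · rintro rfl
      have h2 := h.nonneg _ (limitSet_subset_limitHull h'.left)
      have h3 := hp.2.2.2
      exact cross_ne_zero_of_sphere h.polar_left h.polar_right h'.polar_left h.ne hp.2.1.symm
        hp.2.2.1.symm (le_antisymm h3 h2)
    · rintro rfl
      have h2 := h.nonneg _ (limitSet_subset_limitHull h'.right)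
      have h3 := hp.2.2.2
      exact cross_ne_zero_of_sphere h.polar_left h.polar_right h'.polar_right h.ne hp.2.1.symm
        hp.2.2.1.symm (le_antisymm h3 h2)
  obtain ⟨t', ht0', ht1', hx', e'⟩ := h'.exists_crossing ho h1' hp'
  have k1 := h.nonneg _ (h'.openSegment_subset hx')
  have k2 := h'.nonneg _ (h.openSegment_subset hx)
  rw [cross_combo _ _ _ _ (by ring)] at k1 k2
  have hp2 := hp.2.2.2
  have l1 : t' ≤ t := by
    by_contra hcon; push Not at hcon; nlinarith
  have l2 : t ≤ t' := by
    by_contra hcon; push Not at hcon; nlinarith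
  obtain rfl := le_antisymm l1 l2
  exact hne (h.eq_of_mem h' hx hx')

end CrownedSurface
end

noncomputable section

/-! ### Coordinates on boundary geodesics -/

/-- The point of the geodesic from `a` to `b` with coordinate `τ`. -/
def geo (a b : ℂ) (τ : ℝ) : ℂ :=
  (1 / (1 + Real.exp τ)) • a + (Real.exp τ / (1 + Real.exp τ)) • b

/-- The arc length coordinate (up to the scale) of a point of the geodesic from `a` to `b`: the
difference of the Busemann functions of the end-points. It increases from `a` to `b`, and isometries
act by translations in this coordinate. -/
def coord (a b x : ℂ) : ℝ := Real.log (polar x a) - Real.log (polar x b)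

lemma geo_mem (a b : ℂ) (τ : ℝ) : geo a b τ ∈ openSegment ℝ a b := by
  refine ⟨_, _, ?_, ?_, ?_, rfl⟩
  · positivity
  · positivity
  · have : 0 < 1 + Real.exp τ := by positivity
    field_simp

lemma polar_combo_left {a b : ℂ} (ha : polar a a = 0) {s t : ℝ} (h : s + t = 1) :
    polar (s • a + t • b) a = t * polar a b := by
  rw [polar_comm, polar_combo _ _ _ h, ha]; ring

lemma polar_combo_right {a b : ℂ} (hb : polar b b = 0) {s t : ℝ} (h : s + t = 1) :
    polar (s • a + t • b) b = s * polar a b := by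
  rw [polar_comm, polar_combo _ _ _ h, hb, polar_comm b a]; ring

lemma coord_combo {a b : ℂ} (ha : polar a a = 0) (hb : polar b b = 0) (hab : a ≠ b) {s t : ℝ}
    (hs : 0 < s) (ht : 0 < t) (h : s + t = 1) :
    coord a b (s • a + t • b) = Real.log t - Real.log s := by
  have := polar_pos ha.ge hb.ge hab
  rw [coord, polar_combo_left ha h, polar_combo_right hb h, Real.log_mul ht.ne' this.ne',
    Real.log_mul hs.ne' this.ne']
  ring

lemma coord_geo {a b : ℂ} (ha : polar a a = 0) (hb : polar b b = 0) (hab : a ≠ b) (τ : ℝ) :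
    coord a b (geo a b τ) = τ := by
  have h1 : 0 < 1 + Real.exp τ := by positivity
  have h2 := Real.exp_pos τ
  rw [geo, coord_combo ha hb hab (by positivity) (by positivity) (by field_simp),
    Real.log_div h2.ne' h1.ne', Real.log_exp, Real.log_div one_ne_zero h1.ne', Real.log_one]
  ring

lemma geo_coord {a b x : ℂ} (ha : polar a a = 0) (hb : polar b b = 0) (hab : a ≠ b)
    (hx : x ∈ openSegment ℝ a b) : geo a b (coord a b x) = x := by
  obtain ⟨s, t, hs, ht, hst, rfl⟩ := hx
  rw [coord_combo ha hb hab hs ht hst, geo, Real.exp_sub, Real.exp_log hs, Real.exp_log ht]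
  have e1 : 1 / (1 + t / s) = s := by field_simp; linarith
  have e2 : t / s / (1 + t / s) = t := by field_simp; linarith
  rw [e1, e2]

lemma continuous_geo (a b : ℂ) : Continuous (geo a b) := by
  unfold geo
  have h : ∀ τ : ℝ, 1 + Real.exp τ ≠ 0 := fun τ => by positivity
  fun_prop (disch := exact h _)

/-- The fraction of the way from `a` to `b` at which the point with coordinate `τ` lies. -/
lemma cross_geo (a b p : ℂ) (τ τ' : ℝ) : cross (geo a b τ) (geo a b τ') p =
    (Real.exp τ' / (1 + Real.exp τ') - Real.exp τ / (1 + Real.exp τ)) * cross a b p := by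
  have h1 : 1 / (1 + Real.exp τ) = 1 - Real.exp τ / (1 + Real.exp τ) := by
    have : 0 < 1 + Real.exp τ := by positivity
    field_simp; ring
  have h2 : 1 / (1 + Real.exp τ') = 1 - Real.exp τ' / (1 + Real.exp τ') := by
    have : 0 < 1 + Real.exp τ' := by positivity
    field_simp; ring
  rw [geo, geo, h1, h2]
  simp only [cross, Complex.add_re, Complex.add_im, Complex.real_smul, Complex.mul_re,
    Complex.mul_im, Complex.ofReal_re, Complex.ofReal_im]
  ring

lemma logistic_lt_iff {τ τ' : ℝ} :
    Real.exp τ / (1 + Real.exp τ) < Real.exp τ' / (1 + Real.exp τ') ↔ τ < τ' := by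
  have h1 := Real.exp_pos τ
  have h2 := Real.exp_pos τ'
  rw [div_lt_div_iff₀ (by positivity) (by positivity), ← Real.exp_lt_exp (x := τ)]
  constructor <;> intro h <;> nlinarith

namespace CrownedSurface

variable {X : CrownedSurface} {A B C : GL (Fin 3) ℝ} {a b a' b' x y z p : ℂ}

namespace IsEdge

lemma coord_geo (h : X.IsEdge a b) (τ : ℝ) : coord a b (geo a b τ) = τ :=
  _root_.coord_geo h.polar_left h.polar_right h.ne τ

lemma geo_coord (h : X.IsEdge a b) (hx : x ∈ openSegment ℝ a b) : geo a b (coord a b x) = x :=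
  _root_.geo_coord h.polar_left h.polar_right h.ne hx

lemma coord_injective (h : X.IsEdge a b) (hx : x ∈ openSegment ℝ a b)
    (hy : y ∈ openSegment ℝ a b) (e : coord a b x = coord a b y) : x = y := by
  rw [← h.geo_coord hx, e, h.geo_coord hy]

lemma cross_pos_iff (h : X.IsEdge a b) (hx : x ∈ openSegment ℝ a b)
    (hy : y ∈ openSegment ℝ a b) (hp : 0 < cross a b p) :
    0 < cross x y p ↔ coord a b x < coord a b y := by
  rw [← h.geo_coord hx, ← h.geo_coord hy, cross_geo, mul_pos_iff_of_pos_right hp, sub_pos,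
    logistic_lt_iff, h.coord_geo, h.coord_geo]

lemma cross_neg_iff (h : X.IsEdge a b) (hx : x ∈ openSegment ℝ a b)
    (hy : y ∈ openSegment ℝ a b) (hp : cross a b p < 0) :
    cross x y p < 0 ↔ coord a b x < coord a b y := by
  rw [← h.geo_coord hx, ← h.geo_coord hy, cross_geo, h.coord_geo, h.coord_geo,
    ← logistic_lt_iff (τ := coord a b x)]
  constructor <;> intro h <;> nlinarith

/-- Deck transformations translate the coordinates of boundary geodesics. -/
lemma coord_act (h : X.IsEdge a b) (hA : A ∈ X.grp) (hx : x ∈ openSegment ℝ a b) :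
    coord (act A a) (act A b) (act A x) =
      coord a b x + (Real.log (den A b) - Real.log (den A a)) := by
  have hI := X.isom A hA
  have hx0 := (h.polar_pos hx).le
  have da := hI.den_pos h.polar_left.ge
  have db := hI.den_pos h.polar_right.ge
  have dx := hI.den_pos hx0
  have key : ∀ {q}, polar q q = 0 → Real.log (polar (act A x) (act A q)) =
      Real.log (polar x q) - Real.log (den A x) - Real.log (den A q) := by
    intro q hq
    have hq' := hI.polar_act_eq_zero hq
    have dq := hI.den_pos hq.ge
    have := polar_pos_of_ball (hI.polar_act_pos (h.polar_pos hx)) hq'.ge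
    rw [← hI.polar_act hx0 hq.ge, Real.log_mul this.ne' (by positivity), Real.log_mul dx.ne' dq.ne']
    ring
  rw [coord, coord, key h.polar_left, key h.polar_right]
  ring

lemma mem_segment_geo (h : X.IsEdge a b) {τ₁ τ₂ τ : ℝ} (h1 : τ₁ ≤ τ) (h2 : τ ≤ τ₂) :
    geo a b τ ∈ segment ℝ (geo a b τ₁) (geo a b τ₂) := by
  have := h.ne
  rcases h1.eq_or_lt with rfl | h1
  · exact left_mem_segment ℝ _ _
  have l1 := logistic_lt_iff.2 h1
  have l2 : Real.exp τ / (1 + Real.exp τ) ≤ Real.exp τ₂ / (1 + Real.exp τ₂) := by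
    rcases h2.eq_or_lt with rfl | h2
    · exact le_rfl
    · exact (logistic_lt_iff.2 h2).le
  have e : ∀ τ, 1 / (1 + Real.exp τ) = 1 - Real.exp τ / (1 + Real.exp τ) := by
    intro τ
    have : 0 < 1 + Real.exp τ := by positivity
    field_simp; ring
  simp only [geo, e]
  set u := Real.exp τ / (1 + Real.exp τ)
  set v := Real.exp τ₁ / (1 + Real.exp τ₁)
  set w := Real.exp τ₂ / (1 + Real.exp τ₂)
  have hvw : 0 < w - v := by linarith
  refine ⟨(w - u) / (w - v), (u - v) / (w - v), div_nonneg (by linarith) hvw.le,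
    div_nonneg (by linarith) hvw.le, by field_simp; ring, ?_⟩
  rw [smul_add, smul_add, smul_smul, smul_smul, smul_smul, smul_smul]
  have e1 : (w - u) / (w - v) * (1 - v) + (u - v) / (w - v) * (1 - w) = 1 - u := by
    field_simp; ring
  have e2 : (w - u) / (w - v) * v + (u - v) / (w - v) * w = u := by
    field_simp; ring
  rw [add_add_add_comm, ← add_smul, ← add_smul, e1, e2]

lemma mem_segment_of_coord (h : X.IsEdge a b) (hx : x ∈ openSegment ℝ a b)
    (hy : y ∈ openSegment ℝ a b) (hz : z ∈ openSegment ℝ a b)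
    (h1 : coord a b x ≤ coord a b z) (h2 : coord a b z ≤ coord a b y) : z ∈ segment ℝ x y := by
  rw [← h.geo_coord hx, ← h.geo_coord hy, ← h.geo_coord hz]
  exact h.mem_segment_geo h1 h2

lemma segment_subset (hx : x ∈ openSegment ℝ a b) (hy : y ∈ openSegment ℝ a b) :
    segment ℝ x y ⊆ openSegment ℝ a b := (convex_openSegment a b).segment_subset hx hy

lemma coord_of_mem_segment (h : X.IsEdge a b) (hx : x ∈ openSegment ℝ a b)
    (hy : y ∈ openSegment ℝ a b) (hz : z ∈ segment ℝ x y) (hxy : coord a b x ≤ coord a b y) :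
    coord a b x ≤ coord a b z ∧ coord a b z ≤ coord a b y := by
  have hz' := segment_subset hx hy hz
  obtain ⟨o, -, -, ho⟩ := X.exists_center
  have hp := ho _ _ h
  have h1 : 0 ≤ cross x y o := by
    rcases hxy.eq_or_lt with e | e
    · rw [h.coord_injective hx hy e]; simp
    · exact ((h.cross_pos_iff hx hy hp).2 e).le
  obtain ⟨s, t, hs, ht, hst, rfl⟩ := hz
  constructor
  · by_contra hc
    push Not at hc
    rw [← h.cross_pos_iff hz' hx hp] at hc
    have e : ∀ w, cross w x o = -cross o x w := fun w => by unfold cross; ring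
    rw [e, cross_combo _ _ _ _ hst, cross_self_right,
      show cross o x y = cross x y o by unfold cross; ring] at hc
    nlinarith
  · by_contra hc
    push Not at hc
    rw [← h.cross_pos_iff hy hz' hp] at hc
    have e : ∀ w, cross y w o = cross o y w := fun w => by unfold cross; ring
    have : cross o y x = - cross x y o := by unfold cross; ring
    rw [e, cross_combo _ _ _ _ hst, cross_self_right, this] at hc
    nlinarith

end IsEdge

/-! ### Stabilizers of boundary geodesics -/

lemma polar_geo_ge (a b : ℂ) (R : ℝ) (h : X.IsEdge a b) :
    ∃ ε : ℝ, 0 < ε ∧ ∀ τ : ℝ, |τ| ≤ R → ε ≤ polar (geo a b τ) (geo a b τ) := by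
  have hc : Continuous fun τ => polar (geo a b τ) (geo a b τ) := by
    have := continuous_geo a b
    unfold polar
    exact ((continuous_const.sub ((Complex.continuous_re.comp this).mul
      (Complex.continuous_re.comp this))).sub ((Complex.continuous_im.comp this).mul
      (Complex.continuous_im.comp this)))
  rcases lt_or_ge R 0 with hR | hR
  · exact ⟨1, one_pos, fun τ hτ => absurd (abs_nonneg τ) (by linarith)⟩
  obtain ⟨τ₀, -, h0⟩ := (isCompact_Icc (a := -R) (b := R)).exists_isMinOn ⟨0, by simp [hR]⟩
    hc.continuousOn
  refine ⟨_, h.polar_pos (geo_mem a b τ₀), fun τ hτ => h0 (abs_le.1 hτ)⟩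

/-- Only finitely many translates of a point lie on a compact part of a boundary geodesic. -/
lemma IsEdge.finite_orbit (h : X.IsEdge a b) {x : ℂ} (hx : 0 < polar x x) (R : ℝ) :
    {A | A ∈ X.grp ∧ act A x ∈ openSegment ℝ a b ∧ |coord a b (act A x)| ≤ R}.Finite := by
  obtain ⟨ε, hε, hge⟩ := polar_geo_ge a b R h
  apply (finite_moving (X := X) (lt_min hε hx)).subset
  rintro A ⟨hA, hm, hR⟩
  refine ⟨hA, x, min_le_right _ _, (min_le_left _ _).trans ?_⟩
  rw [← h.geo_coord hm]
  exact hge _ hR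

/-- The translation length (in the coordinate) of a deck transformation that preserves a boundary
geodesic. -/
lemma IsEdge.translation_ne_zero (h : X.IsEdge a b) (hC : C ∈ X.grp) (ha : act C a = a)
    (hb : act C b = b) (h1 : C ≠ 1) : Real.log (den C b) - Real.log (den C a) ≠ 0 := by
  intro e
  apply h1
  have hx := geo_mem a b 0
  have e2 := h.coord_act hC hx
  rw [e, add_zero, ha, hb] at e2
  have hm := h.act_mem hC hx
  rw [ha, hb] at hm
  exact X.free C hC _ (mem_ball_iff_polar.2 (h.polar_pos hx)) (h.coord_injective hm hx e2)

lemma IsEdge.fixes_zpow (h : X.IsEdge a b) (hC : C ∈ X.grp) (ha : act C a = a)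
    (hb : act C b = b) (n : ℤ) : act (C ^ n) a = a ∧ act (C ^ n) b = b := by
  have key : ∀ q, polar q q = 0 → act C q = q → ∀ n : ℤ, act (C ^ n) q = q := by
    intro q hq hCq n
    have hi : act C⁻¹ q = q := by
      conv_lhs => rw [← hCq]
      exact act_inv_act hC hq.ge
    induction n using Int.induction_on with
    | zero => simp
    | succ n ih => rw [zpow_add, zpow_one, act_mul_of_mem hC hq.ge, hCq, ih]
    | pred n ih => rw [zpow_sub, zpow_one, act_mul_of_mem (inv_mem hC) hq.ge, hi, ih]
  exact ⟨key a h.polar_left ha n, key b h.polar_right hb n⟩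

lemma IsEdge.coord_zpow (h : X.IsEdge a b) (hC : C ∈ X.grp) (ha : act C a = a)
    (hb : act C b = b) (hx : x ∈ openSegment ℝ a b) (n : ℤ) :
    act (C ^ n) x ∈ openSegment ℝ a b ∧ coord a b (act (C ^ n) x) =
      coord a b x + n * (Real.log (den C b) - Real.log (den C a)) := by
  have hm : ∀ n : ℤ, act (C ^ n) x ∈ openSegment ℝ a b := by
    intro n
    have := h.act_mem (zpow_mem hC n) hx
    rwa [(h.fixes_zpow hC ha hb n).1, (h.fixes_zpow hC ha hb n).2] at this
  refine ⟨hm n, ?_⟩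
  have step : ∀ y ∈ openSegment ℝ a b, coord a b (act C y) =
      coord a b y + (Real.log (den C b) - Real.log (den C a)) := by
    intro y hy
    have := h.coord_act hC hy
    rwa [ha, hb] at this
  induction n using Int.induction_on with
  | zero => simp
  | succ n ih =>
    rw [add_comm, zpow_add, zpow_one, act_mul_of_mem (zpow_mem hC _) (h.polar_pos hx).le,
      step _ (hm _), ih]
    push_cast; ring
  | pred n ih =>
    have e : C ^ (-(n : ℤ)) = C * C ^ (-(n : ℤ) - 1) := by
      rw [← zpow_one_add]; congr 1; ring
    rw [e, act_mul_of_mem (zpow_mem hC _) (h.polar_pos hx).le, step _ (hm _)] at ih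
    push_cast at ih ⊢
    linarith

/-- Boundary geodesics that meet a common compact part of the disc and have nearby oriented unit
normals coincide: otherwise their caps would share an ideal point. -/
lemma IsEdge.eq_of_normal_close (h : X.IsEdge a b) (h' : X.IsEdge a' b') {x x' : ℂ} {ε : ℝ}
    (hx : x ∈ openSegment ℝ a b) (hx' : x' ∈ openSegment ℝ a' b') (hε : 0 < ε)
    (hx0 : ε ≤ polar x x) (hx0' : ε ≤ polar x' x') {n n' : ℂ}
    (hn : n = Complex.I * (b - a) / ‖b - a‖) (hn' : n' = Complex.I * (b' - a') / ‖b' - a'‖)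
    (hd : ‖n - n'‖ < ε / 2) : a = a' ∧ b = b' := by
  -- the ideal point `-n` lies behind both geodesics
  by_contra hne
  have hN : 0 < ‖b - a‖ := norm_pos_iff.2 (sub_ne_zero.2 h.ne.symm)
  have hN' : 0 < ‖b' - a'‖ := norm_pos_iff.2 (sub_ne_zero.2 h'.ne.symm)
  have hnn : ‖n‖ = 1 := by
    rw [hn, norm_div, norm_mul, Complex.norm_I, one_mul, Complex.norm_real, Real.norm_of_nonneg
      hN.le, div_self hN.ne']
  have hcr : ∀ {a b x q n : ℂ}, 0 < ‖b - a‖ → n = Complex.I * (b - a) / ‖b - a‖ →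
      x ∈ openSegment ℝ a b →
      cross a b q = ‖b - a‖ * ((q.re - x.re) * n.re + (q.im - x.im) * n.im) := by
    intro a b x q n hN hn hx
    have h0 := IsEdge.cross_eq_zero hx
    have e1 : n.re * ‖b - a‖ = -(b.im - a.im) := by
      have : (n * ‖b - a‖) = Complex.I * (b - a) := by
        rw [hn, div_mul_cancel₀]; exact_mod_cast hN.ne'
      have := congrArg Complex.re this
      simpa using this
    have e2 : n.im * ‖b - a‖ = (b.re - a.re) := by
      have : (n * ‖b - a‖) = Complex.I * (b - a) := by
        rw [hn, div_mul_cancel₀]; exact_mod_cast hN.ne'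
      have := congrArg Complex.im this
      simpa using this
    have e3 : cross a b q = cross a b q - cross a b x := by rw [h0, sub_zero]
    rw [e3]
    unfold cross
    linear_combination (-(q.re - x.re)) * e1 - (q.im - x.im) * e2
  have hbound : ∀ {x m : ℂ}, ε ≤ polar x x → ‖m‖ = 1 → -(1 - ε / 2) ≤ x.re * m.re + x.im * m.im := by
    intro x m hx hm
    have e1 : m.re ^ 2 + m.im ^ 2 = 1 := by
      have : ‖m‖ ^ 2 = 1 := by rw [hm, one_pow]
      rw [← Complex.normSq_eq_norm_sq, Complex.normSq_apply] at this; linarith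
    unfold polar at hx
    have h1 : (x.re * m.re + x.im * m.im) ^ 2 ≤ 1 - ε := by
      have : (x.re * m.re + x.im * m.im) ^ 2 + (x.re * m.im - x.im * m.re) ^ 2 =
        (x.re * x.re + x.im * x.im) * (m.re ^ 2 + m.im ^ 2) := by ring
      rw [e1] at this
      nlinarith [sq_nonneg (x.re * m.im - x.im * m.re)]
    have h2 : (1:ℝ) - ε ≤ (1 - ε / 2) ^ 2 := by nlinarith [sq_nonneg ε]
    have h3 : 0 ≤ 1 - ε / 2 := by nlinarith [sq_nonneg x.re, sq_nonneg x.im]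
    exact (abs_le_of_sq_le_sq' (h1.trans h2) h3).1
  have hnn' : ‖n'‖ = 1 := by
    rw [hn', norm_div, norm_mul, Complex.norm_I, one_mul, Complex.norm_real, Real.norm_of_nonneg
      hN'.le, div_self hN'.ne']
  have sq1 : n.re ^ 2 + n.im ^ 2 = 1 := by
    have : ‖n‖ ^ 2 = 1 := by rw [hnn, one_pow]
    rw [← Complex.normSq_eq_norm_sq, Complex.normSq_apply] at this; linarith
  have sq1' : n'.re ^ 2 + n'.im ^ 2 = 1 := by
    have : ‖n'‖ ^ 2 = 1 := by rw [hnn', one_pow]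
    rw [← Complex.normSq_eq_norm_sq, Complex.normSq_apply] at this; linarith
  have hin : 1 - ε / 2 < n.re * n'.re + n.im * n'.im := by
    have e : ‖n - n'‖ ^ 2 = (n.re - n'.re) ^ 2 + (n.im - n'.im) ^ 2 := by
      rw [← Complex.normSq_eq_norm_sq, Complex.normSq_apply]; simp; ring
    have hε2 : ε ≤ 1 := by unfold polar at hx0; nlinarith [sq_nonneg x.re, sq_nonneg x.im]
    have : ‖n - n'‖ ^ 2 < ε := by nlinarith [norm_nonneg (n - n')]
    nlinarith
  have k1 : cross a b (-n) < 0 := by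
    rw [hcr hN hn hx]
    apply mul_neg_of_pos_of_neg hN
    have := hbound hx0 hnn
    simp only [Complex.neg_re, Complex.neg_im]
    nlinarith
  have k2 : cross a' b' (-n) < 0 := by
    rw [hcr hN' hn' hx']
    apply mul_neg_of_pos_of_neg hN'
    have := hbound hx0' hnn'
    simp only [Complex.neg_re, Complex.neg_im]
    nlinarith
  have hcap : (-n) ∈ cap a b := by
    refine ⟨?_, ?_, ?_, k1.le⟩
    · rw [polar_self, norm_neg, hnn]; norm_num
    · rintro e; rw [e] at k1; simp at k1
    · rintro e; rw [e] at k1; simp at k1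
  exact absurd (h.cross_pos_of_mem_cap h' hne hcap) (by linarith)

/-- Boundary components of the surface are closed curves: the stabilizer of a boundary geodesic is
not trivial. -/
lemma IsEdge.exists_stabilizer (h : X.IsEdge a b) :
    ∃ C ∈ X.grp, C ≠ 1 ∧ act C a = a ∧ act C b = b := by
  by_contra hcon
  push Not at hcon
  obtain ⟨K, hKb, hK, hcov⟩ := X.cocompact
  obtain ⟨ε, hε, hKε⟩ : ∃ ε : ℝ, 0 < ε ∧ ∀ z ∈ K, ε ≤ polar z z := by
    rcases K.eq_empty_or_nonempty with rfl | hne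
    · exact ⟨1, one_pos, by simp⟩
    · obtain ⟨z₀, hz₀, hmin⟩ := hK.exists_isMinOn hne
        (f := fun z => polar z z) (by unfold polar; fun_prop)
      exact ⟨_, mem_ball_iff_polar.1 (hKb hz₀), fun z hz => hmin hz⟩
  let nrm : GL (Fin 3) ℝ → ℂ := fun A =>
    Complex.I * (act A b - act A a) / ‖act A b - act A a‖
  let S : Set (GL (Fin 3) ℝ) := {A | A ∈ X.grp ∧ ∃ x ∈ openSegment ℝ a b, act A x ∈ K}
  -- translates of the geodesic that meet `K` have separated normals, the circle is compact, and
  -- the translates are different as the stabilizer is assumed to be trivial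
  have hfin : S.Finite := by
    obtain ⟨t, -, htf, ht⟩ := (isCompact_sphere (0 : ℂ) 1).finite_cover_balls
      (e := ε / 4) (by positivity)
    have hnrm : ∀ A ∈ S, ∃ c ∈ t, nrm A ∈ Metric.ball c (ε / 4) := by
      intro A hA
      have hE := h.map hA.1
      have hN : 0 < ‖act A b - act A a‖ := norm_pos_iff.2 (sub_ne_zero.2 hE.ne.symm)
      have : nrm A ∈ Metric.sphere (0 : ℂ) 1 := by
        rw [mem_sphere_zero_iff_norm, norm_div, norm_mul, Complex.norm_I, one_mul,
          Complex.norm_real, Real.norm_of_nonneg hN.le, div_self hN.ne']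
      simpa using ht this
    choose! f hft hf using hnrm
    apply Set.Finite.of_finite_image (f := f) (htf.subset (by rintro _ ⟨A, hA, rfl⟩; exact hft A hA))
    rintro A hA B hB e
    obtain ⟨hAg, x, hx, hxK⟩ := id hA
    obtain ⟨hBg, y, hy, hyK⟩ := id hB
    have hd : ‖nrm A - nrm B‖ < ε / 2 := by
      have h1 := hf A hA
      have h2 := hf B hB
      rw [← e] at h2
      rw [← dist_eq_norm]
      calc dist (nrm A) (nrm B) ≤ dist (nrm A) (f A) + dist (nrm B) (f A) :=
            dist_triangle_right _ _ _
        _ < ε / 4 + ε / 4 := add_lt_add h1 h2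
        _ = ε / 2 := by ring
    obtain ⟨e1, e2⟩ := (h.map hAg).eq_of_normal_close (h.map hBg) (h.act_mem hAg hx)
      (h.act_mem hBg hy) hε (hKε _ hxK) (hKε _ hyK) rfl rfl hd
    by_contra hAB
    have h1 : B⁻¹ * A ≠ 1 := fun e => hAB (inv_mul_eq_one.1 e).symm
    apply hcon (B⁻¹ * A) (mul_mem (inv_mem hBg) hAg) h1
    · rw [act_mul_of_mem hAg h.polar_left.ge, e1, act_inv_act hBg h.polar_left.ge]
    · rw [act_mul_of_mem hAg h.polar_right.ge, e2, act_inv_act hBg h.polar_right.ge]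
  -- finitely many translates of `K` cannot cover a geodesic
  have hcov' : openSegment ℝ a b ⊆ ⋃ A ∈ S, (act A⁻¹) '' K := by
    intro x hx
    obtain ⟨A, hA, hAK⟩ := hcov x ⟨h.openSegment_subset hx, mem_ball_iff_polar.2 (h.polar_pos hx)⟩
    exact mem_iUnion₂.2 ⟨A, ⟨hA, x, hx, hAK⟩, _, hAK, act_inv_act hA (h.polar_pos hx).le⟩
  have hcomp : IsCompact (⋃ A ∈ S, (act A⁻¹) '' K) := by
    apply hfin.isCompact_biUnion
    intro A hA
    apply hK.image_of_continuousOn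
    intro z hz
    exact ((isom_inv hA.1).continuousAt_act (mem_ball_iff_polar.1 (hKb hz)).le).continuousWithinAt
  have ha : a ∈ closure (openSegment ℝ a b) := by
    rw [closure_openSegment]; exact left_mem_segment ℝ a b
  have ha' := closure_minimal hcov' hcomp.isClosed ha
  obtain ⟨A, hA, z, hz, hza⟩ := mem_iUnion₂.1 ha'
  have := (isom_inv hA.1).polar_act_pos (mem_ball_iff_polar.1 (hKb hz))
  rw [hza] at this
  exact this.ne' h.polar_left

end CrownedSurface
end

noncomputable section

namespace CrownedSurface

variable {X : CrownedSurface} {A B C : GL (Fin 3) ℝ} {a b a' b' x y z p : ℂ}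

/-! ### The boundary cut open at the basepoints -/

lemma IsEdge.disjoint_base_iff (h : X.IsEdge a b) (hx : x ∈ openSegment ℝ a b)
    (hy : y ∈ openSegment ℝ a b) : Disjoint (segment ℝ x y) X.base ↔
      ∀ z ∈ openSegment ℝ a b, z ∈ X.base → coord a b z ∉ uIcc (coord a b x) (coord a b y) := by
  wlog hxy : coord a b x ≤ coord a b y generalizing x y
  · rw [segment_symm, uIcc_comm]
    exact this hy hx (le_of_not_ge hxy)
  rw [uIcc_of_le hxy, Set.disjoint_left]
  constructor
  · intro hd z hz hzb hm
    exact hd (h.mem_segment_of_coord hx hy hz hm.1 hm.2) hzb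
  · intro hd z hz hzb
    exact hd z (IsEdge.segment_subset hx hy hz) hzb (h.coord_of_mem_segment hx hy hz hxy)

lemma IsEdge.sameInterval_iff (h : X.IsEdge a b) (hx : x ∈ openSegment ℝ a b)
    (hy : y ∈ openSegment ℝ a b) : X.SameInterval x y ↔
      ∀ z ∈ openSegment ℝ a b, z ∈ X.base → coord a b z ∉ uIcc (coord a b x) (coord a b y) := by
  rw [← h.disjoint_base_iff hx hy]
  exact ⟨fun ⟨_, _, _, _, hd⟩ => hd, fun hd => ⟨_, h.mem_boundaryLines, hx, hy, hd⟩⟩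

lemma SameInterval.sameLine (h : X.SameInterval x y) : X.SameLine x y := by
  obtain ⟨β, hβ, hx, hy, -⟩ := h
  exact ⟨β, hβ, hx, hy⟩

lemma SameLine.exists_edge (h : X.SameLine x y) :
    ∃ a b, X.IsEdge a b ∧ x ∈ openSegment ℝ a b ∧ y ∈ openSegment ℝ a b := sameLine_iff.1 h

lemma SameInterval.exists_edge (h : X.SameInterval x y) :
    ∃ a b, X.IsEdge a b ∧ x ∈ openSegment ℝ a b ∧ y ∈ openSegment ℝ a b :=
  h.sameLine.exists_edge

lemma SameInterval.symm (h : X.SameInterval x y) : X.SameInterval y x := by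
  obtain ⟨β, hβ, hx, hy, hd⟩ := h
  exact ⟨β, hβ, hy, hx, by rwa [segment_symm]⟩

lemma SameLine.symm (h : X.SameLine x y) : X.SameLine y x := by
  obtain ⟨β, hβ, hx, hy⟩ := h
  exact ⟨β, hβ, hy, hx⟩

lemma SameLine.trans (h : X.SameLine x y) (h' : X.SameLine y z) : X.SameLine x z := by
  obtain ⟨a, b, he, hx, hy⟩ := h.exists_edge
  obtain ⟨a', b', he', hy', hz⟩ := h'.exists_edge
  obtain ⟨rfl, rfl⟩ := he.eq_of_mem he' hy hy'
  exact sameLine_iff.2 ⟨a, b, he, hx, hz⟩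

lemma SameInterval.trans (h : X.SameInterval x y) (h' : X.SameInterval y z) :
    X.SameInterval x z := by
  obtain ⟨a, b, he, hx, hy⟩ := h.exists_edge
  obtain ⟨a', b', he', hy', hz⟩ := h'.exists_edge
  obtain ⟨rfl, rfl⟩ := he.eq_of_mem he' hy hy'
  rw [he.sameInterval_iff hx hy] at h
  rw [he.sameInterval_iff hy hz] at h'
  rw [he.sameInterval_iff hx hz]
  intro w hw hwb hm
  rcases uIcc_subset_uIcc_union_uIcc (b := coord a b y) hm with hm | hm
  · exact h w hw hwb hm
  · exact h' w hw hwb hm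

lemma SameInterval.notMem_base (h : X.SameInterval x y) : x ∉ X.base := by
  obtain ⟨β, hβ, hx, hy, hd⟩ := h
  exact Set.disjoint_left.1 hd (left_mem_segment ℝ x y)

lemma IsEdge.sameInterval_self (h : X.IsEdge a b) (hx : x ∈ openSegment ℝ a b)
    (hxb : x ∉ X.base) : X.SameInterval x x := by
  refine ⟨_, h.mem_boundaryLines, hx, hx, ?_⟩
  rw [segment_same]
  exact Set.disjoint_singleton_left.2 hxb

lemma IsEdge.sameLine (h : X.IsEdge a b) (hx : x ∈ openSegment ℝ a b)
    (hy : y ∈ openSegment ℝ a b) : X.SameLine x y := ⟨_, h.mem_boundaryLines, hx, hy⟩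

lemma SameLine.polar_pos (h : X.SameLine x y) : 0 < polar x x := by
  obtain ⟨a, b, he, hx, -⟩ := h.exists_edge
  exact he.polar_pos hx

lemma SameInterval.polar_pos (h : X.SameInterval x y) : 0 < polar x x := h.sameLine.polar_pos

lemma SameLine.act (hA : A ∈ X.grp) (h : X.SameLine x y) : X.SameLine (act A x) (act A y) := by
  obtain ⟨a, b, he, hx, hy⟩ := h.exists_edge
  exact (he.map hA).sameLine (he.act_mem hA hx) (he.act_mem hA hy)

lemma SameInterval.act (hA : A ∈ X.grp) (h : X.SameInterval x y) :
    X.SameInterval (act A x) (act A y) := by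
  obtain ⟨a, b, he, hx, hy⟩ := h.exists_edge
  rw [he.sameInterval_iff hx hy] at h
  rw [(he.map hA).sameInterval_iff (he.act_mem hA hx) (he.act_mem hA hy)]
  intro z hz hzb hm
  have hz0 := ((he.map hA).polar_pos hz).le
  have hz' := (he.map hA).act_mem (inv_mem hA) hz
  rw [act_inv_act hA he.polar_left.ge, act_inv_act hA he.polar_right.ge] at hz'
  apply h _ hz' (X.base_invariant _ (inv_mem hA) z hzb)
  rw [← act_act_inv hA hz0, he.coord_act hA hz', he.coord_act hA hx, he.coord_act hA hy] at hm
  simp only [mem_uIcc] at hm ⊢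
  rcases hm with hm | hm
  · left; constructor <;> linarith
  · right; constructor <;> linarith

/-- A deck transformation that maps a point into the same interval of the boundary cut open at the
basepoints is trivial. -/
lemma SameInterval.eq_one (hC : C ∈ X.grp) (h : X.SameInterval (_root_.act C x) x) : C = 1 := by
  by_contra hne
  obtain ⟨a, b, he, hCx, hx⟩ := h.exists_edge
  obtain ⟨ha, hb⟩ := he.act_eq he hC hx hCx
  have hl := he.translation_ne_zero hC ha hb hne
  set l := Real.log (den C b) - Real.log (den C a) with hldef
  have hc := he.coord_act hC hx
  rw [ha, hb] at hc
  rw [he.sameInterval_iff hCx hx, hc] at h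
  obtain ⟨w, hw, hwb⟩ := X.base_nonempty _ he.mem_boundaryLines
  -- a translate of a basepoint lies between the point and its image
  have key : ∀ n : ℤ, coord a b w + n * l ∉ uIcc (coord a b x + l) (coord a b x) := by
    intro n
    obtain ⟨h1, h2⟩ := he.coord_zpow hC ha hb hw n
    have := h _ h1 (X.base_invariant _ (zpow_mem hC n) w hwb)
    rwa [h2] at this
  set q := (coord a b x - coord a b w) / l with hq
  have hql : q * l = coord a b x - coord a b w := by rw [hq]; field_simp
  apply key ⌈q⌉
  have h1 := Int.le_ceil q
  have h2 := Int.ceil_lt_add_one q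
  rw [mem_uIcc]
  rcases lt_or_gt_of_ne hl with hl | hl
  · left; constructor <;> nlinarith
  · right; constructor <;> nlinarith

lemma SameInterval.act_unique (hA : A ∈ X.grp) (hB : B ∈ X.grp) (hx : 0 ≤ polar x x)
    (h : X.SameInterval (_root_.act A x) y) (h' : X.SameInterval (_root_.act B x) y) : A = B := by
  have h1 := h.trans h'.symm
  have h2 : X.SameInterval (_root_.act (B⁻¹ * A) x) x := by
    rw [act_mul_of_mem hA hx]
    have := h1.act (inv_mem hB)
    rwa [act_inv_act hB hx] at this
  exact (inv_mul_eq_one.1 (h2.eq_one (mul_mem (inv_mem hB) hA))).symm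

/-- The last basepoint before a point of a boundary geodesic. -/
lemma IsEdge.exists_base_below (h : X.IsEdge a b) (x : ℂ) :
    ∃ w ∈ openSegment ℝ a b, w ∈ X.base ∧ coord a b w < coord a b x ∧
      ∀ z ∈ openSegment ℝ a b, z ∈ X.base → coord a b z < coord a b x →
        coord a b z ≤ coord a b w := by
  obtain ⟨v, hv, hvb⟩ := X.base_nonempty _ h.mem_boundaryLines
  obtain ⟨C, hC, hC1, ha, hb⟩ := h.exists_stabilizer
  have hl := h.translation_ne_zero hC ha hb hC1
  set l := Real.log (den C b) - Real.log (den C a) with hldef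
  -- a power of a translation along the geodesic moves a basepoint below `x`
  obtain ⟨u, hu, hub, hux⟩ : ∃ u ∈ openSegment ℝ a b, u ∈ X.base ∧ coord a b u < coord a b x := by
    set q := (coord a b x - coord a b v) / l with hq
    have hql : q * l = coord a b x - coord a b v := by rw [hq]; field_simp
    have hmem : ∀ n : ℤ, act (C ^ n) v ∈ X.base := fun n =>
      X.base_invariant _ (zpow_mem hC n) v hvb
    rcases lt_or_gt_of_ne hl with hl | hl
    · obtain ⟨h1, h2⟩ := h.coord_zpow hC ha hb hv (⌊q⌋ + 1)
      refine ⟨_, h1, hmem _, ?_⟩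
      rw [h2]
      have := Int.lt_floor_add_one q
      push_cast
      nlinarith
    · obtain ⟨h1, h2⟩ := h.coord_zpow hC ha hb hv (⌈q⌉ - 1)
      refine ⟨_, h1, hmem _, ?_⟩
      rw [h2]
      have := Int.ceil_lt_add_one q
      push_cast
      nlinarith
  set S := {z | z ∈ openSegment ℝ a b ∧ z ∈ X.base ∧ coord a b u ≤ coord a b z ∧
    coord a b z < coord a b x} with hS
  have hfin : S.Finite := by
    have := (h.finite_orbit (h.polar_pos hu) (max |coord a b u| |coord a b x|)).image
      (fun A => act A u)
    apply this.subset
    rintro z ⟨hz, hzb, h1, h2⟩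
    obtain ⟨A, hA, rfl⟩ := X.base_unique _ h.mem_boundaryLines u ⟨hu, hub⟩ z ⟨hz, hzb⟩
    exact ⟨A, ⟨hA, hz, abs_le_max_abs_abs h1 h2.le⟩, rfl⟩
  obtain ⟨w, ⟨hw, hwb, hw1, hw2⟩, hmax⟩ := hfin.exists_maximalFor (coord a b) S
    ⟨u, hu, hub, le_rfl, hux⟩
  refine ⟨w, hw, hwb, hw2, fun z hz hzb hzx => ?_⟩
  rcases le_total (coord a b z) (coord a b w) with hle | hle
  · exact hle
  · exact hmax ⟨hz, hzb, hw1.trans hle, hzx⟩ hle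

/-- Any two points of a boundary geodesic differ by a deck transformation up to the choice of a point
in the same interval. -/
lemma IsEdge.exists_sameInterval (h : X.IsEdge a b) (hx : x ∈ openSegment ℝ a b)
    (hy : y ∈ openSegment ℝ a b) (hxb : x ∉ X.base) (hyb : y ∉ X.base) :
    ∃ A ∈ X.grp, X.SameInterval (act A x) y := by
  obtain ⟨u, hu, hub, hux, humax⟩ := h.exists_base_below x
  obtain ⟨v, hv, hvb, hvy, hvmax⟩ := h.exists_base_below y
  obtain ⟨A, hA, rfl⟩ := X.base_unique _ h.mem_boundaryLines u ⟨hu, hub⟩ v ⟨hv, hvb⟩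
  obtain ⟨ha, hb⟩ := h.act_eq h hA hu hv
  refine ⟨A, hA, ?_⟩
  have hAx := h.act_mem hA hx
  rw [ha, hb] at hAx
  have hcoord : ∀ z ∈ openSegment ℝ a b, coord a b (act A z) = coord a b z +
      (Real.log (den A b) - Real.log (den A a)) := by
    intro z hz
    have := h.coord_act hA hz
    rwa [ha, hb] at this
  rw [h.sameInterval_iff hAx hy]
  intro z hz hzb hm
  have ne : ∀ {p q}, p ∈ openSegment ℝ a b → q ∈ openSegment ℝ a b → p ∉ X.base → q ∈ X.base →
      coord a b q ≠ coord a b p := by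
    intro p q hp hq hpb hqb e
    rw [h.coord_injective hq hp e] at hqb; exact hpb hqb
  have hz' : act A⁻¹ z ∈ openSegment ℝ a b := by
    have := h.act_mem (inv_mem hA) hz
    rwa [show act A⁻¹ a = a by conv_lhs => rw [← ha, act_inv_act hA h.polar_left.ge],
      show act A⁻¹ b = b by conv_lhs => rw [← hb, act_inv_act hA h.polar_right.ge]] at this
  have hzb' := X.base_invariant _ (inv_mem hA) z hzb
  have e1 := hcoord _ hz'
  rw [act_act_inv hA (h.polar_pos hz).le] at e1
  have e2 := hcoord _ hx
  have e3 := hcoord _ hu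
  have n1 := ne hx hz' hxb hzb'
  have n2 := ne hy hz hyb hzb
  rw [mem_uIcc, e2] at hm
  rcases hm with ⟨h1, h2⟩ | ⟨h1, h2⟩
  · have := hvmax z hz hzb (lt_of_le_of_ne h2 n2)
    linarith
  · have := humax _ hz' hzb' (lt_of_le_of_ne (by linarith) n1)
    linarith

/-! ### Rigidity of pairs of boundary geodesics -/

lemma IsEdge.exists_third (h : X.IsEdge a b) (h' : X.IsEdge a' b') (hne : ¬ (a = a' ∧ b = b')) :
    ∃ c, (c = a' ∨ c = b') ∧ c ≠ a ∧ c ≠ b := by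
  by_contra hcon
  push Not at hcon
  obtain ⟨o, -, -, ho⟩ := X.exists_center
  have h1 := ho _ _ h
  have h2 := ho _ _ h'
  have ka := hcon a' (Or.inl rfl)
  have kb := hcon b' (Or.inr rfl)
  by_cases ea : a' = a
  · by_cases eb : b' = a
    · exact h'.ne (ea.trans eb.symm)
    · exact hne ⟨ea.symm, (kb eb).symm⟩
  · have ea' := ka ea
    by_cases eb : b' = a
    · subst ea' eb
      rw [cross_swap] at h1; linarith
    · exact h'.ne (ea'.trans (kb eb).symm)

/-- A deck transformation that preserves two boundary geodesics is trivial. -/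
lemma IsEdge.eq_one_of_preserves_two (h : X.IsEdge a b) (h' : X.IsEdge a' b')
    (hne : ¬ (a = a' ∧ b = b')) (hA : A ∈ X.grp) (e1 : act A a = a) (e2 : act A b = b)
    (e3 : act A a' = a') (e4 : act A b' = b') : A = 1 := by
  obtain ⟨c, hc, hca, hcb⟩ := h.exists_third h' hne
  rcases hc with rfl | rfl
  · exact eq_one_of_fixes_three hA h.polar_left h.polar_right h'.polar_left h.ne hca.symm hcb.symm
      e1 e2 e3
  · exact eq_one_of_fixes_three hA h.polar_left h.polar_right h'.polar_right h.ne hca.symm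
      hcb.symm e1 e2 e4

/-- No deck transformation exchanges two boundary geodesics. -/
lemma IsEdge.not_swap (h : X.IsEdge a b) (h' : X.IsEdge a' b')
    (hne : ¬ (a = a' ∧ b = b')) (hA : A ∈ X.grp) (e1 : act A a = a') (e2 : act A b = b')
    (e3 : act A a' = a) (e4 : act A b' = b) : False := by
  have m : ∀ {q}, 0 ≤ polar q q → act (A * A) q = act A (act A q) := fun hq => act_mul_of_mem hA hq
  have h1 : A * A = 1 := by
    apply h.eq_one_of_preserves_two h' hne (mul_mem hA hA)
    · rw [m h.polar_left.ge, e1, e3]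
    · rw [m h.polar_right.ge, e2, e4]
    · rw [m h'.polar_left.ge, e3, e1]
    · rw [m h'.polar_right.ge, e4, e2]
  have h2 := eq_one_of_mul_self hA h1
  rw [h2, act_one] at e1 e2
  exact hne ⟨e1, e2⟩

/-! ### Intervals of the boundary and positions in them -/

variable (X) in
/-- A point of a lift of the boundary that does not lie over a basepoint. -/
def Marked (x : ℂ) : Prop := (∃ a b, X.IsEdge a b ∧ x ∈ openSegment ℝ a b) ∧ x ∉ X.base

variable (X) in
/-- The component, of the boundary cut open at the basepoints, below `x`: the set of the points that
lie in the same interval as a translate of `x`. -/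
def cls (x : ℂ) : Set ℂ := {y | ∃ A ∈ X.grp, X.SameInterval (act A x) y}

variable (X) in
/-- The position of `x` in its component of the boundary cut open at the basepoints: the coordinate
of the translate of `x` that lies in the same interval as a chosen point of the component. -/
def pos (x : ℂ) : ℝ := Classical.epsilon fun τ => ∃ A ∈ X.grp, ∃ a b, X.IsEdge a b ∧
  act A x ∈ openSegment ℝ a b ∧
  X.SameInterval (act A x) (Classical.epsilon fun y => y ∈ X.cls x) ∧ τ = coord a b (act A x)

lemma Marked.polar_pos (h : X.Marked x) : 0 < polar x x := by
  obtain ⟨⟨a, b, he, hx⟩, -⟩ := h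
  exact he.polar_pos hx

lemma SameInterval.marked (h : X.SameInterval x y) : X.Marked x := by
  obtain ⟨a, b, he, hx, -⟩ := h.exists_edge
  exact ⟨⟨a, b, he, hx⟩, h.notMem_base⟩

lemma Marked.refl (h : X.Marked x) : X.SameInterval x x := by
  obtain ⟨⟨a, b, he, hx⟩, hb⟩ := h
  exact he.sameInterval_self hx hb

lemma Marked.act (hA : A ∈ X.grp) (h : X.Marked x) : X.Marked (act A x) :=
  (h.refl.act hA).marked

lemma Marked.of_act (hA : A ∈ X.grp) (hx : 0 ≤ polar x x) (h : X.Marked (_root_.act A x)) :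
    X.Marked x := by
  have := h.act (inv_mem hA)
  rwa [act_inv_act hA hx] at this

lemma Marked.cls_eq_iff (hx : X.Marked x) (hy : X.Marked y) :
    X.cls x = X.cls y ↔ ∃ A ∈ X.grp, X.SameInterval (_root_.act A x) y := by
  constructor
  · intro h
    have : y ∈ X.cls y := ⟨1, one_mem _, by rw [act_one]; exact hy.refl⟩
    rwa [← h] at this
  · rintro ⟨A, hA, h⟩
    ext z
    constructor
    · rintro ⟨B, hB, hz⟩
      refine ⟨B * A⁻¹, mul_mem hB (inv_mem hA), ?_⟩
      rw [act_mul_of_mem (inv_mem hA) hy.polar_pos.le]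
      have h1 := h.symm.act (inv_mem hA)
      rw [act_inv_act hA hx.polar_pos.le] at h1
      exact (h1.act hB).trans hz
    · rintro ⟨B, hB, hz⟩
      refine ⟨B * A, mul_mem hB hA, ?_⟩
      rw [act_mul_of_mem hA hx.polar_pos.le]
      exact (h.act hB).trans hz

lemma Marked.cls_act (hx : X.Marked x) (hA : A ∈ X.grp) : X.cls (_root_.act A x) = X.cls x :=
  (((hx.cls_eq_iff (hx.act hA)).2 ⟨A, hA, (hx.act hA).refl⟩)).symm

lemma SameInterval.cls_eq (h : X.SameInterval x y) : X.cls x = X.cls y :=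
  (h.marked.cls_eq_iff h.symm.marked).2 ⟨1, one_mem _, by rwa [act_one]⟩

lemma Marked.exists_pos (hx : X.Marked x) : ∃ A ∈ X.grp, ∃ a b, X.IsEdge a b ∧
    _root_.act A x ∈ openSegment ℝ a b ∧
    X.SameInterval (_root_.act A x) (Classical.epsilon fun y => y ∈ X.cls x) ∧
    X.pos x = coord a b (_root_.act A x) := by
  have h1 : (Classical.epsilon fun y => y ∈ X.cls x) ∈ X.cls x :=
    Classical.epsilon_spec (p := fun y => y ∈ X.cls x)
      ⟨x, 1, one_mem _, by rw [act_one]; exact hx.refl⟩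
  obtain ⟨A, hA, h⟩ := h1
  obtain ⟨a, b, he, h1, h2⟩ := h.exists_edge
  exact Classical.epsilon_spec (p := fun τ => ∃ A ∈ X.grp, ∃ a b, X.IsEdge a b ∧
    _root_.act A x ∈ openSegment ℝ a b ∧
    X.SameInterval (_root_.act A x) (Classical.epsilon fun y => y ∈ X.cls x) ∧
      τ = coord a b (_root_.act A x)) ⟨_, A, hA, a, b, he, h1, h, rfl⟩

/-- Positions in an interval agree with the coordinate up to a constant. -/
lemma SameInterval.pos_sub (h : X.SameInterval x y) (he : X.IsEdge a b)
    (hx : x ∈ openSegment ℝ a b) (hy : y ∈ openSegment ℝ a b) :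
    X.pos x - X.pos y = coord a b x - coord a b y := by
  obtain ⟨A, hA, a₁, b₁, he₁, hx₁, hs₁, hp₁⟩ := h.marked.exists_pos
  obtain ⟨B, hB, a₂, b₂, he₂, hy₂, hs₂, hp₂⟩ := h.symm.marked.exists_pos
  rw [h.cls_eq] at hs₁
  have hAB : A = B := by
    apply SameInterval.act_unique hA hB h.symm.polar_pos.le _ hs₂
    exact (h.symm.act hA).trans hs₁
  subst hAB
  have hx' := he.act_mem hA hx
  have hy' := he.act_mem hA hy
  obtain ⟨rfl, rfl⟩ := (he.map hA).eq_of_mem he₁ hx' hx₁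
  obtain ⟨rfl, rfl⟩ := (he.map hA).eq_of_mem he₂ hy' hy₂
  rw [hp₁, hp₂, he.coord_act hA hx, he.coord_act hA hy]
  ring

lemma Marked.pos_act (hx : X.Marked x) (hA : A ∈ X.grp) : X.pos (_root_.act A x) = X.pos x := by
  obtain ⟨B, hB, a₁, b₁, he₁, hx₁, hs₁, hp₁⟩ := (hx.act hA).exists_pos
  obtain ⟨C, hC, a₂, b₂, he₂, hx₂, hs₂, hp₂⟩ := hx.exists_pos
  rw [hx.cls_act hA] at hs₁
  rw [← act_mul_of_mem hA hx.polar_pos.le] at hx₁ hs₁ hp₁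
  obtain rfl : B * A = C := SameInterval.act_unique (mul_mem hB hA) hC hx.polar_pos.le hs₁ hs₂
  obtain ⟨rfl, rfl⟩ := he₁.eq_of_mem he₂ hx₁ hx₂
  rw [hp₁, hp₂]

lemma SameInterval.pos_lt_iff (h : X.SameInterval x y) (he : X.IsEdge a b)
    (hx : x ∈ openSegment ℝ a b) (hy : y ∈ openSegment ℝ a b) :
    X.pos x < X.pos y ↔ coord a b x < coord a b y := by
  have := h.pos_sub he hx hy
  constructor <;> intro _ <;> linarith

lemma SameInterval.eq_of_pos_eq (h : X.SameInterval x y) (e : X.pos x = X.pos y) : x = y := by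
  obtain ⟨a, b, he, hx, hy⟩ := h.exists_edge
  have := h.pos_sub he hx hy
  exact he.coord_injective hx hy (by linarith)

end CrownedSurface
end

noncomputable section

/-! ### Sides of chords and rays -/

/-- A determinant that vanishes nowhere on a product of convex sets has constant sign. -/
lemma cross_pos_iff_of_convex {S T U : Set ℂ} (hS : Convex ℝ S) (hT : Convex ℝ T)
    (hU : Convex ℝ U) (h : ∀ u ∈ S, ∀ v ∈ T, ∀ w ∈ U, cross u v w ≠ 0) {u u' v v' w w' : ℂ}
    (hu : u ∈ S) (hu' : u' ∈ S) (hv : v ∈ T) (hv' : v' ∈ T) (hw : w ∈ U) (hw' : w' ∈ U) :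
    0 < cross u v w ↔ 0 < cross u' v' w' := by
  have key : ∀ {x y p q : ℂ}, (∀ r ∈ segment ℝ p q, cross x y r ≠ 0) →
      0 < cross x y p → 0 < cross x y q := by
    intro x y p q hne hp
    by_contra hq
    push Not at hq
    set P := cross x y p
    set Q := cross x y q
    have hd : 0 < P - Q := by linarith
    have hst : -Q / (P - Q) + P / (P - Q) = 1 := by field_simp; ring
    apply hne ((-Q / (P - Q)) • p + (P / (P - Q)) • q)
      ⟨_, _, div_nonneg (by linarith) hd.le, div_nonneg hp.le hd.le, hst, rfl⟩
    rw [cross_combo _ _ _ _ hst]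
    change -Q / (P - Q) * P + P / (P - Q) * Q = 0
    field_simp; ring
  have mono : ∀ {u u' v v' w w' : ℂ}, u ∈ S → u' ∈ S → v ∈ T → v' ∈ T → w ∈ U → w' ∈ U →
      0 < cross u v w → 0 < cross u' v' w' := by
    intro u u' v v' w w' hu hu' hv hv' hw hw' h0
    have h1 : 0 < cross u v w' := key (fun r hr => h u hu v hv r (hU.segment_subset hw hw' hr)) h0
    have h2 : 0 < cross w' u v' := by
      apply key (p := v) _ (by rwa [← cross_rotate])
      intro r hr
      rw [← cross_rotate]
      exact h u hu r (hT.segment_subset hv hv' hr) w' hw'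
    have h3 : 0 < cross v' w' u' := by
      apply key (p := u) _ (by rwa [← cross_rotate])
      intro r hr
      rw [cross_rotate]
      exact h r (hS.segment_subset hu hu' hr) v' hv' w' hw'
    rwa [cross_rotate] at h3
  exact ⟨mono hu hu' hv hv' hw hw', mono hu' hu hv' hv hw' hw⟩

/-- Of three collinear points one lies between the other two. -/
lemma between_of_cross_eq_zero {p q r : ℂ} (h : cross p q r = 0) :
    r ∈ segment ℝ p q ∨ p ∈ segment ℝ q r ∨ q ∈ segment ℝ r p := by
  rcases eq_or_ne p q with rfl | hpq
  · exact Or.inr (Or.inl (left_mem_segment ℝ _ _))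
  obtain ⟨s, t, hst, rfl⟩ := exists_combo_of_cross_eq_zero hpq h
  rcases le_or_gt 0 s with hs | hs
  · rcases le_or_gt 0 t with ht | ht
    · exact Or.inl ⟨s, t, hs, ht, hst, rfl⟩
    · right; left
      have hs0 : 0 < s := by linarith
      refine ⟨-t / s, 1 / s, div_nonneg (by linarith) hs0.le, by positivity, ?_, ?_⟩
      · rw [← add_div, div_eq_one_iff_eq hs0.ne']; linarith
      · rw [smul_add, smul_smul, smul_smul, one_div, inv_mul_cancel₀ hs0.ne', one_smul,
          add_comm p, ← add_assoc, ← add_smul]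
        have : -t / s + s⁻¹ * t = 0 := by field_simp; ring
        rw [this, zero_smul, zero_add]
  · right; right
    have ht0 : 0 < t := by linarith
    refine ⟨1 / t, -s / t, by positivity, div_nonneg (by linarith) ht0.le, ?_, ?_⟩
    · rw [← add_div, div_eq_one_iff_eq ht0.ne']; linarith
    · rw [smul_add, smul_smul, smul_smul, one_div, inv_mul_cancel₀ ht0.ne', one_smul,
        add_comm _ q, add_assoc, ← add_smul]
      have : t⁻¹ * s + -s / t = 0 := by field_simp; ring
      rw [this, zero_smul, add_zero]

/-- A line separates a point pair on different sides from it: intersection with the line. -/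
lemma exists_combo_cross_eq_zero {x y p q : ℂ} (h : cross x y p * cross x y q < 0) :
    ∃ s t : ℝ, 0 < s ∧ 0 < t ∧ s + t = 1 ∧ cross x y (s • p + t • q) = 0 := by
  rcases mul_neg_iff.1 h with ⟨hp, hq⟩ | ⟨hp, hq⟩
  · have hd : 0 < cross x y p - cross x y q := by linarith
    have hst : -cross x y q / (cross x y p - cross x y q) +
        cross x y p / (cross x y p - cross x y q) = 1 := by field_simp; ring
    refine ⟨_, _, div_pos (by linarith) hd, div_pos hp hd, hst, ?_⟩
    rw [cross_combo _ _ _ _ hst]; field_simp; ring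
  · have hd : 0 < cross x y q - cross x y p := by linarith
    have hst : cross x y q / (cross x y q - cross x y p) +
        -cross x y p / (cross x y q - cross x y p) = 1 := by field_simp; ring
    refine ⟨_, _, div_pos hq hd, div_pos (by linarith) hd, hst, ?_⟩
    rw [cross_combo _ _ _ _ hst]; field_simp; ring

lemma cross_eq_zero_of_mem_segment {x y w : ℂ} (hw : w ∈ segment ℝ x y) : cross x y w = 0 := by
  obtain ⟨s, t, -, -, hst, rfl⟩ := hw
  rw [cross_combo _ _ _ _ hst]; simp

lemma disjoint_segment_of_same_side {x z p q : ℂ} (h : 0 < cross x z p * cross x z q) :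
    Disjoint (segment ℝ x z) (segment ℝ p q) := by
  rw [Set.disjoint_left]
  rintro w hw ⟨s, t, hs, ht, hst, rfl⟩
  have := cross_eq_zero_of_mem_segment hw
  rw [cross_combo _ _ _ _ hst] at this
  rcases mul_pos_iff.1 h with ⟨h1, h2⟩ | ⟨h1, h2⟩
  · have : 0 < s * cross x z p + t * cross x z q := by
      rcases hs.eq_or_lt with rfl | hs
      · obtain rfl : t = 1 := by linarith
        linarith
      · have := mul_pos hs h1; have := mul_nonneg ht h2.le; linarith
    linarith
  · have : s * cross x z p + t * cross x z q < 0 := by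
      rcases hs.eq_or_lt with rfl | hs
      · obtain rfl : t = 1 := by linarith
        linarith
      · have := mul_neg_of_pos_of_neg hs h1
        have := mul_nonpos_of_nonneg_of_nonpos ht h2.le; linarith
    linarith

namespace CrownedSurface

variable {X : CrownedSurface} {A B C : GL (Fin 3) ℝ} {a b a' b' a₁ b₁ a₂ b₂ a₃ b₃ x y z p q c c' : ℂ}

lemma IsEdge.convex_cap (h : X.IsEdge a b) : Convex ℝ (cap a b) := by
  intro p hp q hq s t hs ht hst
  rcases hs.eq_or_lt with rfl | hs
  · obtain rfl : t = 1 := by linarith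
    simpa using hq
  rcases ht.eq_or_lt with rfl | ht
  · obtain rfl : s = 1 := by linarith
    simpa using hp
  rcases eq_or_ne p q with rfl | hpq
  · rwa [← add_smul, hst, one_smul]
  have hpos := polar_combo_pos hp.1 hq.1 hpq hs ht hst
  refine ⟨hpos.le, ?_, ?_, ?_⟩
  · intro e; rw [e] at hpos; exact hpos.ne' h.polar_left
  · intro e; rw [e] at hpos; exact hpos.ne' h.polar_right
  · rw [cross_combo _ _ _ _ hst]
    have := mul_nonpos_of_nonneg_of_nonpos hs.le hp.2.2.2
    have := mul_nonpos_of_nonneg_of_nonpos ht.le hq.2.2.2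
    linarith

lemma ne_symm (h : ¬ (a = a' ∧ b = b')) : ¬ (a' = a ∧ b' = b) :=
  fun ⟨h1, h2⟩ => h ⟨h1.symm, h2.symm⟩

lemma cap_not_mem_segment (hr : y ∈ cap a b) (hp : 0 < cross a b p)
    (hq : 0 < cross a b q) (h : y ∈ segment ℝ p q) : False := by
  obtain ⟨s, t, hs, ht, hst, rfl⟩ := h
  have h1 := hr.2.2.2
  rw [cross_combo _ _ _ _ hst] at h1
  rcases hs.eq_or_lt with rfl | hs
  · obtain rfl : t = 1 := by linarith
    linarith
  · have := mul_pos hs hp; have := mul_nonneg ht hq.le; linarith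

/-- Points in three different caps are not collinear. -/
lemma IsEdge.cross_ne_zero_of_caps (h₁ : X.IsEdge a₁ b₁) (h₂ : X.IsEdge a₂ b₂)
    (h₃ : X.IsEdge a₃ b₃) (h12 : ¬ (a₁ = a₂ ∧ b₁ = b₂)) (h13 : ¬ (a₁ = a₃ ∧ b₁ = b₃))
    (h23 : ¬ (a₂ = a₃ ∧ b₂ = b₃)) (hp : p ∈ cap a₁ b₁) (hq : q ∈ cap a₂ b₂)
    (hr : y ∈ cap a₃ b₃) : cross p q y ≠ 0 := by
  intro h0
  rcases between_of_cross_eq_zero h0 with h | h | h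
  · exact cap_not_mem_segment hr (h₁.cross_pos_of_mem_cap h₃ h13 hp)
      (h₂.cross_pos_of_mem_cap h₃ h23 hq) h
  · exact cap_not_mem_segment hp (h₂.cross_pos_of_mem_cap h₁ (ne_symm h12) hq)
      (h₃.cross_pos_of_mem_cap h₁ (ne_symm h13) hr) h
  · exact cap_not_mem_segment hq (h₃.cross_pos_of_mem_cap h₂ (ne_symm h23) hr)
      (h₁.cross_pos_of_mem_cap h₂ h12 hp) h

lemma eq_or_eq_of_ideal_mem_segment (hp : 0 ≤ polar p p) (hq : 0 ≤ polar q q)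
    (hy : polar y y = 0) (h : y ∈ segment ℝ p q) : y = p ∨ y = q := by
  by_contra hcon
  push Not at hcon
  have h1 := mem_openSegment_of_ne_left_right hcon.1.symm hcon.2.symm h
  have hpq : p ≠ q := by
    rintro rfl; rw [segment_same] at h; exact hcon.1 h
  exact (polar_openSegment_pos hp hq hpq h1).ne' hy

lemma IsEdge.limit_notMem_cap (h : X.IsEdge a b) (hy : y ∈ limitSet X.grp) : y ∉ cap a b := by
  intro hc
  have h0 := le_antisymm hc.2.2.2 (h.nonneg _ (limitSet_subset_limitHull hy))
  exact cross_ne_zero_of_sphere h.polar_left h.polar_right (polar_of_mem_limitSet hy) h.ne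
    hc.2.1.symm hc.2.2.1.symm h0

/-- Points in two different caps and a point of the limit set are not collinear. -/
lemma IsEdge.cross_ne_zero_of_caps_limit (h₁ : X.IsEdge a₁ b₁) (h₂ : X.IsEdge a₂ b₂)
    (h12 : ¬ (a₁ = a₂ ∧ b₁ = b₂)) (hp : p ∈ cap a₁ b₁) (hq : q ∈ cap a₂ b₂)
    (hy : y ∈ limitSet X.grp) : cross p q y ≠ 0 := by
  intro h0
  have aux : ∀ {a b p q : ℂ}, X.IsEdge a b → p ∈ cap a b → 0 < cross a b q →
      p ∈ segment ℝ q y → False := by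
    intro a b p q h hp hq hm
    have hpy : p ≠ y := fun e => h.limit_notMem_cap hy (e ▸ hp)
    obtain ⟨s, t, hs, ht, hst, rfl⟩ := hm
    have h1 := hp.2.2.2
    rw [cross_combo _ _ _ _ hst] at h1
    have h2 := h.nonneg _ (limitSet_subset_limitHull hy)
    rcases hs.eq_or_lt with rfl | hs
    · obtain rfl : t = 1 := by linarith
      exact hpy (by simp)
    · have := mul_pos hs hq; have := mul_nonneg ht h2; linarith
  rcases between_of_cross_eq_zero h0 with h | h | h
  · rcases eq_or_eq_of_ideal_mem_segment hp.1 hq.1 (polar_of_mem_limitSet hy) h with e | e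
    · exact h₁.limit_notMem_cap hy (e ▸ hp)
    · exact h₂.limit_notMem_cap hy (e ▸ hq)
  · exact aux h₁ hp (h₂.cross_pos_of_mem_cap h₁ (ne_symm h12) hq) h
  · rw [segment_symm] at h
    exact aux h₂ hq (h₁.cross_pos_of_mem_cap h₂ h12 hp) h

lemma IsEdge.cross_pos_of_mem (h : X.IsEdge a b) (h' : X.IsEdge a' b')
    (hne : ¬ (a = a' ∧ b = b')) (hx : x ∈ openSegment ℝ a b) : 0 < cross a' b' x :=
  h.cross_pos_of_mem_cap h' hne (h.subset_cap hx)

/-- The side of a chord on which a point of the boundary geodesic of its first end-point lies. -/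
lemma IsEdge.cross_chord_pos_iff (h : X.IsEdge a b) (hx : x ∈ openSegment ℝ a b)
    (hp : p ∈ openSegment ℝ a b) (hz : 0 < cross a b z) :
    0 < cross x z p ↔ coord a b p < coord a b x := by
  rw [← cross_rotate, ← cross_rotate, h.cross_pos_iff hp hx hz]

lemma IsEdge.cross_chord_neg_iff (h : X.IsEdge a b) (hx : x ∈ openSegment ℝ a b)
    (hp : p ∈ openSegment ℝ a b) (hz : 0 < cross a b z) :
    cross x z p < 0 ↔ coord a b x < coord a b p := by
  rw [show cross x z p = -cross x p z by unfold cross; ring, neg_lt_zero, h.cross_pos_iff hx hp hz]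

/-- The chord between two different boundary geodesics separates the points of the hull on its two
sides. -/
lemma IsEdge.exists_mem_chord (h₁ : X.IsEdge a₁ b₁) (h₂ : X.IsEdge a₂ b₂)
    (hne : ¬ (a₁ = a₂ ∧ b₁ = b₂)) (hx : x ∈ openSegment ℝ a₁ b₁) (hz : z ∈ openSegment ℝ a₂ b₂)
    (hp : p ∈ limitHull X.grp) (hq : q ∈ limitHull X.grp)
    (h : cross x z p * cross x z q < 0) : ∃ w ∈ openSegment ℝ p q, w ∈ segment ℝ x z := by
  obtain ⟨s, t, hs, ht, hst, h0⟩ := exists_combo_cross_eq_zero h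
  have hz1 := h₂.cross_pos_of_mem h₁ (ne_symm hne) hz
  have hx2 := h₁.cross_pos_of_mem h₂ hne hx
  have hxz : x ≠ z := by
    rintro rfl; rw [IsEdge.cross_eq_zero hx] at hz1; exact lt_irrefl _ hz1
  have hw : s • p + t • q ∈ limitHull X.grp := convex_limitHull hp hq hs.le ht.le hst
  refine ⟨s • p + t • q, ⟨s, t, hs, ht, hst, rfl⟩, ?_⟩
  obtain ⟨s', t', hst', e⟩ := exists_combo_of_cross_eq_zero hxz h0
  rw [e] at hw ⊢
  have k1 := h₁.nonneg _ hw
  have k2 := h₂.nonneg _ hw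
  rw [cross_combo _ _ _ _ hst', IsEdge.cross_eq_zero hx, mul_zero, zero_add] at k1
  rw [cross_combo _ _ _ _ hst', IsEdge.cross_eq_zero hz, mul_zero, add_zero] at k2
  exact ⟨s', t', nonneg_of_mul_nonneg_left k2 hx2, nonneg_of_mul_nonneg_left k1 hz1, hst', rfl⟩

lemma IsEdge.mul_cross_pos_of_disjoint (h₁ : X.IsEdge a₁ b₁) (h₂ : X.IsEdge a₂ b₂)
    (hne : ¬ (a₁ = a₂ ∧ b₁ = b₂)) (hx : x ∈ openSegment ℝ a₁ b₁) (hz : z ∈ openSegment ℝ a₂ b₂)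
    (hp : p ∈ limitHull X.grp) (hq : q ∈ limitHull X.grp) (hp0 : cross x z p ≠ 0)
    (hq0 : cross x z q ≠ 0) (hd : Disjoint (segment ℝ x z) (openSegment ℝ p q)) :
    0 < cross x z p * cross x z q := by
  by_contra hcon
  have : cross x z p * cross x z q < 0 :=
    lt_of_le_of_ne (not_lt.1 hcon) (mul_ne_zero hp0 hq0)
  obtain ⟨w, hw, hw'⟩ := h₁.exists_mem_chord h₂ hne hx hz hp hq this
  exact Set.disjoint_left.1 hd hw' hw

/-- A chord between different boundary geodesics meets the boundary only at its end-points. -/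
lemma IsEdge.cross_chord_ne_zero (h₁ : X.IsEdge a₁ b₁) (h₂ : X.IsEdge a₂ b₂)
    (h₃ : X.IsEdge a₃ b₃) (hne : ¬ (a₁ = a₂ ∧ b₁ = b₂)) (hx : x ∈ openSegment ℝ a₁ b₁)
    (hz : z ∈ openSegment ℝ a₂ b₂) (hy : y ∈ openSegment ℝ a₃ b₃) (hyx : y ≠ x) (hyz : y ≠ z) :
    cross x z y ≠ 0 := by
  have hz1 := h₂.cross_pos_of_mem h₁ (ne_symm hne) hz
  have hx2 := h₁.cross_pos_of_mem h₂ hne hx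
  by_cases e1 : a₁ = a₃ ∧ b₁ = b₃
  · obtain ⟨rfl, rfl⟩ := e1
    rcases lt_trichotomy (coord a₁ b₁ x) (coord a₁ b₁ y) with hlt | heq | hlt
    · exact ((h₁.cross_chord_neg_iff hx hy hz1).2 hlt).ne
    · exact absurd (h₁.coord_injective hx hy heq).symm hyx
    · exact ((h₁.cross_chord_pos_iff hx hy hz1).2 hlt).ne'
  · by_cases e2 : a₂ = a₃ ∧ b₂ = b₃
    · obtain ⟨rfl, rfl⟩ := e2
      rw [cross_swap, neg_ne_zero]
      rcases lt_trichotomy (coord a₂ b₂ z) (coord a₂ b₂ y) with hlt | heq | hlt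
      · exact ((h₂.cross_chord_neg_iff hz hy hx2).2 hlt).ne
      · exact absurd (h₂.coord_injective hz hy heq).symm hyz
      · exact ((h₂.cross_chord_pos_iff hz hy hx2).2 hlt).ne'
    · exact h₁.cross_ne_zero_of_caps h₂ h₃ hne e1 e2 (h₁.subset_cap hx) (h₂.subset_cap hz)
        (h₃.subset_cap hy)

/-! ### Crown arcs -/

/-- A ray from a point of a boundary geodesic to a cusp leaves the hull at once if and only if the
cusp lies behind that geodesic. -/
lemma isCrownArc_iff {x c : ℂ} : X.IsCrownArc x c ↔
    ∃ a b, X.IsEdge a b ∧ x ∈ openSegment ℝ a b ∧ c ∈ X.cusps ∧ cross a b c < 0 := by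
  constructor
  · rintro ⟨hx, hc, hd⟩
    obtain ⟨a, b, h, hx⟩ := exists_mem_boundaryLines_iff.1 hx
    refine ⟨a, b, h, hx, hc, ?_⟩
    by_contra hcon
    have hcl := (X.cusps_subset hc).2
    have hne : cross a b c ≠ 0 := cross_ne_zero_of_sphere h.polar_left h.polar_right
      (polar_of_mem_cusps hc) h.ne (fun e => hcl (e ▸ h.left)) (fun e => hcl (e ▸ h.right))
    have hpos : 0 < cross a b c := lt_of_le_of_ne (not_lt.1 hcon) hne.symm
    -- near `x` the segment towards `c` runs inside a triangle in the hull
    obtain ⟨o, hoH, -, ho⟩ := X.exists_center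
    have hD := ho _ _ h
    set D := cross a b o with hDdef
    obtain ⟨s, t, hs, ht, hst, rfl⟩ := hx
    set α := cross c b o / D with hα
    set β := cross a c o / D with hβ
    set γ := cross a b c / D with hγ
    have hsum : α + β + γ = 1 := by
      rw [hα, hβ, hγ, ← add_div, ← add_div, div_eq_one_iff_eq hD.ne', hDdef]
      unfold cross; ring
    have hc' : c = α • a + β • b + γ • o := by
      have e1 : α * D = cross c b o := by rw [hα]; field_simp
      have e2 : β * D = cross a c o := by rw [hβ]; field_simp
      have e3 : γ * D = cross a b c := by rw [hγ]; field_simp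
      apply Complex.ext
      · simp only [Complex.add_re, Complex.real_smul, Complex.mul_re, Complex.ofReal_re,
          Complex.ofReal_im, zero_mul, sub_zero]
        apply mul_right_cancel₀ hD.ne'
        rw [add_mul, add_mul, mul_right_comm, mul_right_comm β, mul_right_comm γ, e1, e2, e3, hDdef]
        unfold cross; ring
      · simp only [Complex.add_im, Complex.real_smul, Complex.mul_im, Complex.ofReal_re,
          Complex.ofReal_im, zero_mul, add_zero]
        apply mul_right_cancel₀ hD.ne'
        rw [add_mul, add_mul, mul_right_comm, mul_right_comm β, mul_right_comm γ, e1, e2, e3, hDdef]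
        unfold cross; ring
    have hγ0 : 0 < γ := by positivity
    set m := min s t with hm
    have hm0 : 0 < m := lt_min hs ht
    set N := m + 1 + |α| + |β| with hN
    have hN0 : 0 < N := by positivity
    set ε := m / N with hε
    have hε0 : 0 < ε := by positivity
    have hεN : ε * N = m := by rw [hε]; field_simp
    have hε1 : ε < 1 := by rw [hε, div_lt_one hN0, hN]; linarith [abs_nonneg α, abs_nonneg β]
    have bound : ∀ {u v : ℝ}, m ≤ u → |v| ≤ |α| + |β| → 0 ≤ (1 - ε) * u + ε * v := by
      intro u v hu hv
      have h1 : (1 - ε) * m ≤ (1 - ε) * u := by gcongr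
      have h2 : ε * (-(|α| + |β|)) ≤ ε * v := by
        gcongr; exact (neg_le_neg hv).trans (neg_abs_le v)
      have h3 : (1 - ε) * m - ε * (|α| + |β|) = ε := by linear_combination -hεN
      linarith
    have hα' := bound (min_le_left s t) (v := α) (by linarith [abs_nonneg β])
    have hβ' := bound (min_le_right s t) (v := β) (by linarith [abs_nonneg α])
    have hmem : (1 - ε) • (s • a + t • b) + ε • c ∈ limitHull X.grp := by
      have e : (1 - ε) • (s • a + t • b) + ε • c =
          ((1 - ε) * s + ε * α) • a + ((1 - ε) * t + ε * β) • b + (ε * γ) • o := by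
        conv_lhs => rw [hc']
        simp only [smul_add, smul_smul, add_smul]; abel
      rw [e]
      have hab := limitSet_subset_limitHull h.left
      have hbb := limitSet_subset_limitHull h.right
      have := (convex_limitHull (X := X)).sum_mem (t := Finset.univ)
        (w := ![(1 - ε) * s + ε * α, (1 - ε) * t + ε * β, ε * γ]) (z := ![a, b, o])
        (by intro i _; fin_cases i
            · exact hα'
            · exact hβ'
            · exact (mul_pos hε0 hγ0).le)
        (by simp only [Fin.sum_univ_three, Matrix.cons_val_zero, Matrix.cons_val_one,
              Matrix.cons_val]
            linear_combination (1 - ε) * hst + ε * hsum)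
        (by intro i _; fin_cases i
            · exact hab
            · exact hbb
            · exact hoH)
      simpa [Fin.sum_univ_three] using this
    exact Set.disjoint_left.1 hd ⟨1 - ε, ε, by linarith, hε0, by ring, rfl⟩ hmem
  · rintro ⟨a, b, h, hx, hc, hneg⟩
    refine ⟨⟨_, h.mem_boundaryLines, hx⟩, hc, ?_⟩
    rw [Set.disjoint_left]
    rintro w ⟨s, t, hs, ht, hst, rfl⟩ hw
    have := h.nonneg _ hw
    rw [cross_combo _ _ _ _ hst, IsEdge.cross_eq_zero hx] at this
    nlinarith [mul_neg_of_pos_of_neg ht hneg]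

lemma IsCrownArc.cross_neg (hc : X.IsCrownArc x c) (h : X.IsEdge a b)
    (hx : x ∈ openSegment ℝ a b) : cross a b c < 0 := by
  obtain ⟨a', b', h', hx', -, hn⟩ := isCrownArc_iff.1 hc
  obtain ⟨rfl, rfl⟩ := h.eq_of_mem h' hx hx'
  exact hn

lemma IsCrownArc.of_sameLine (hc : X.IsCrownArc x c) (h : X.SameLine x y) : X.IsCrownArc y c := by
  obtain ⟨a, b, he, hx, hy⟩ := h.exists_edge
  exact isCrownArc_iff.2 ⟨a, b, he, hy, hc.2.1, hc.cross_neg he hx⟩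

lemma IsCrownArc.act (hc : X.IsCrownArc x c) (hA : A ∈ X.grp) :
    X.IsCrownArc (act A x) (act A c) := by
  obtain ⟨a, b, h, hx, hcc, hn⟩ := isCrownArc_iff.1 hc
  refine isCrownArc_iff.2 ⟨_, _, h.map hA, h.act_mem hA hx, X.cusps_invariant A hA c hcc, ?_⟩
  have h1 := (X.isom A hA).cross_act_nonneg h.polar_left.ge h.polar_right.ge
    (polar_of_mem_cusps hcc).ge
  exact not_le.1 fun h2 => absurd (h1.1 h2) (not_le.2 hn)

lemma IsEdge.mem_cap_of_neg (h : X.IsEdge a b) (hc : polar c c = 0) (hn : cross a b c < 0) :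
    c ∈ cap a b := by
  refine ⟨hc.ge, ?_, ?_, hn.le⟩ <;> (rintro rfl; simp at hn)

/-- From an inner point two different ideal points behind a boundary geodesic are seen in different
directions. -/
lemma cross_tips_ne_zero (hc : polar c c = 0) (hc' : polar c' c' = 0) (hne : c ≠ c')
    (hn : cross a b c < 0) (hn' : cross a b c' < 0) (hp : 0 ≤ polar p p) (hp' : 0 ≤ cross a b p) :
    cross p c c' ≠ 0 := by
  intro h0
  rw [← cross_rotate] at h0
  obtain ⟨s, t, hs, ht, hst, rfl⟩ := mem_segment_of_cross_eq_zero hc hc' hne hp h0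
  rw [cross_combo _ _ _ _ hst] at hp'
  rcases hs.eq_or_lt with rfl | hs
  · obtain rfl : t = 1 := by linarith
    linarith
  · nlinarith [mul_neg_of_pos_of_neg hs hn, mul_nonpos_of_nonneg_of_nonpos ht hn'.le]

/-- The order of the cusps behind a boundary geodesic does not depend on the point from which they
are seen. -/
lemma cross_tips_pos_iff (hc : polar c c = 0) (hc' : polar c' c' = 0)
    (hn : cross a b c < 0) (hn' : cross a b c' < 0) (hp : 0 ≤ polar p p) (hp' : 0 ≤ cross a b p)
    (hq : 0 ≤ polar q q) (hq' : 0 ≤ cross a b q) : 0 < cross p c c' ↔ 0 < cross q c c' := by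
  rcases eq_or_ne c c' with rfl | hne
  · simp
  have hS : Convex ℝ {p : ℂ | 0 ≤ polar p p ∧ 0 ≤ cross a b p} := by
    intro p hp q hq s t hs ht hst
    refine ⟨polar_combo_nonneg hp.1 hq.1 hs ht hst, ?_⟩
    rw [cross_combo _ _ _ _ hst]
    exact add_nonneg (mul_nonneg hs hp.2) (mul_nonneg ht hq.2)
  apply cross_pos_iff_of_convex hS (convex_singleton c) (convex_singleton c') _ ⟨hp, hp'⟩ ⟨hq, hq'⟩
    rfl rfl rfl rfl
  rintro u hu _ rfl _ rfl
  exact cross_tips_ne_zero hc hc' hne hn hn' hu.1 hu.2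

/-- Rays from a boundary geodesic to ideal points behind it are disjoint if and only if their tips
are in the (weak) order of their starting points. -/
lemma IsEdge.disjoint_ray_iff (h : X.IsEdge a b) (hx : x ∈ openSegment ℝ a b)
    (hy : y ∈ openSegment ℝ a b) (hc : polar c c = 0) (hc' : polar c' c' = 0)
    (hn : cross a b c < 0) (hn' : cross a b c' < 0) (hlt : coord a b x < coord a b y) :
    Disjoint (ray x c) (ray y c') ↔ 0 ≤ cross x c c' := by
  have hpos : 0 < cross x c y := by
    have := (h.cross_neg_iff hx hy hn).2 hlt
    rw [cross_swap_right] at this; linarith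
  have hxp := h.polar_pos hx
  have hyp := h.polar_pos hy
  constructor
  · intro hd
    by_contra hcon
    push Not at hcon
    obtain ⟨s, t, hs, ht, hst, h0⟩ := exists_combo_cross_eq_zero
      (mul_neg_of_pos_of_neg hpos hcon)
    have hyc : y ≠ c' := by rintro rfl; exact hyp.ne' hc'
    have hxc : x ≠ c := by rintro rfl; exact hxp.ne' hc
    have hw := polar_combo_pos hyp.le hc'.ge hyc hs ht hst
    have hcw : cross a b (s • y + t • c') < 0 := by
      rw [cross_combo _ _ _ _ hst, IsEdge.cross_eq_zero hy]
      nlinarith [mul_neg_of_pos_of_neg ht hn']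
    have hwr' : s • y + t • c' ∈ ray y c' := by
      refine ⟨⟨s, t, hs.le, ht.le, hst, rfl⟩, ?_⟩
      intro e; rw [mem_singleton_iff.1 e] at hw; exact hw.ne' hc'
    refine Set.disjoint_left.1 hd ?_ hwr'
    obtain ⟨s', t', hst', e⟩ := exists_combo_of_cross_eq_zero hxc h0
    rw [e] at hcw hw ⊢
    rw [cross_combo _ _ _ _ hst', IsEdge.cross_eq_zero hx, mul_zero, zero_add] at hcw
    have ht' : 0 < t' := by
      by_contra hcon; push Not at hcon; nlinarith [mul_nonneg_of_nonpos_of_nonpos hcon hn.le]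
    refine ⟨⟨s', t', ?_, ht'.le, hst', rfl⟩, ?_⟩
    · by_contra hs'
      push Not at hs'
      rw [polar_combo_self _ _ hst', hc, mul_zero, add_zero] at hw
      have h2 := two_mul_polar x c
      rw [hc] at h2
      have h3 : polar x x ≤ 2 * polar x c := by nlinarith [sq_nonneg ‖x - c‖]
      have h4 : 0 < s' * polar x x + t' * (2 * polar x c) := by nlinarith
      nlinarith [mul_neg_of_neg_of_pos hs' h4]
    · intro e; rw [mem_singleton_iff.1 e] at hw; exact hw.ne' hc
  · intro h0
    rw [Set.disjoint_left]
    rintro w ⟨hw, -⟩ ⟨⟨s, t, hs, ht, hst, rfl⟩, hne⟩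
    have e := cross_eq_zero_of_mem_segment hw
    rw [cross_combo _ _ _ _ hst] at e
    rcases hs.eq_or_lt with rfl | hs
    · obtain rfl : t = 1 := by linarith
      exact hne (by simp)
    · nlinarith [mul_pos hs hpos, mul_nonneg ht h0]

/-- A chord in the hull and a ray behind a boundary geodesic meet at most at the starting point of
the ray. -/
lemma IsEdge.disjoint_segment_ray (h₁ : X.IsEdge a₁ b₁) (h₂ : X.IsEdge a₂ b₂)
    (h₃ : X.IsEdge a₃ b₃) (hne : ¬ (a₁ = a₂ ∧ b₁ = b₂)) (hx : x ∈ openSegment ℝ a₁ b₁)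
    (hz : z ∈ openSegment ℝ a₂ b₂) (hy : y ∈ openSegment ℝ a₃ b₃) (hyx : y ≠ x) (hyz : y ≠ z)
    (hn : cross a₃ b₃ c < 0) : Disjoint (segment ℝ x z) (ray y c) := by
  rw [Set.disjoint_left]
  rintro w hw ⟨⟨s, t, hs, ht, hst, rfl⟩, -⟩
  have h1 := h₃.nonneg _ (convex_limitHull.segment_subset (h₁.openSegment_subset hx)
    (h₂.openSegment_subset hz) hw)
  rw [cross_combo _ _ _ _ hst, IsEdge.cross_eq_zero hy, mul_zero, zero_add] at h1
  have ht0 : t = 0 := by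
    rcases ht.eq_or_lt with h | h
    · exact h.symm
    · nlinarith [mul_neg_of_pos_of_neg h hn]
  subst ht0
  obtain rfl : s = 1 := by linarith
  simp only [one_smul, zero_smul, add_zero] at hw
  exact h₁.cross_chord_ne_zero h₂ h₃ hne hx hz hy hyx hyz (cross_eq_zero_of_mem_segment hw)

lemma IsEdge.ray_subset_cap (h : X.IsEdge a b) (hx : x ∈ openSegment ℝ a b) (hc : polar c c = 0)
    (hn : cross a b c < 0) : ray x c ⊆ cap a b :=
  sdiff_subset.trans (h.convex_cap.segment_subset (h.subset_cap hx) (h.mem_cap_of_neg hc hn))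

/-- Rays behind different boundary geodesics are disjoint. -/
lemma IsEdge.disjoint_ray_of_ne (h₁ : X.IsEdge a₁ b₁) (h₂ : X.IsEdge a₂ b₂)
    (hne : ¬ (a₁ = a₂ ∧ b₁ = b₂)) (hx : x ∈ openSegment ℝ a₁ b₁) (hy : y ∈ openSegment ℝ a₂ b₂)
    (hc : polar c c = 0) (hc' : polar c' c' = 0) (hn : cross a₁ b₁ c < 0)
    (hn' : cross a₂ b₂ c' < 0) : Disjoint (ray x c) (ray y c') := by
  rw [Set.disjoint_left]
  intro w hw hw'
  have h1 := h₁.cross_pos_of_mem_cap h₂ hne (h₁.ray_subset_cap hx hc hn hw)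
  have h2 := (h₂.ray_subset_cap hy hc' hn' hw').2.2.2
  linarith

end CrownedSurface
end

noncomputable section

/-! ### Weighted points on intervals -/

/-- A family of weighted points on a disjoint union of oriented intervals: the point `s` lies on the
interval `comp s`, at the position `pos s`. -/
structure WeightedPoints (S κ : Type*) where
  comp : S → κ
  pos : S → ℝ
  wt : S → ℝ
  wt_pos : ∀ s, 0 < wt s
  inj : ∀ s t, comp s = comp t → pos s = pos t → s = t

namespace WeightedPoints

open Classical in
/-- The total weight of the points before `s` on its interval. -/
def lower {S κ : Type*} [Fintype S] (P : WeightedPoints S κ) (s : S) : ℝ :=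
  ∑ t, if P.comp t = P.comp s ∧ P.pos t < P.pos s then P.wt t else 0

open Classical in
/-- The total weight of an interval. -/
def total {S κ : Type*} [Fintype S] (P : WeightedPoints S κ) (c : κ) : ℝ :=
  ∑ t, if P.comp t = c then P.wt t else 0

/-- The strip of width `wt s` that replaces the point `s` when all points of its interval are
thickened to strips stacked in their order. -/
def strip {S κ : Type*} [Fintype S] (P : WeightedPoints S κ) (s : S) : Set ℝ :=
  Ioo (P.lower s) (P.lower s + P.wt s)

variable {S κ : Type*} [Fintype S] (P : WeightedPoints S κ)

lemma lower_nonneg (s : S) : 0 ≤ P.lower s := by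
  classical
  apply Finset.sum_nonneg
  intro t _
  split_ifs
  · exact (P.wt_pos t).le
  · exact le_rfl

lemma lower_add_le_lower {s t : S} (h : P.comp s = P.comp t) (hlt : P.pos s < P.pos t) :
    P.lower s + P.wt s ≤ P.lower t := by
  classical
  have e : P.wt s = ∑ u, if u = s then P.wt u else 0 := by simp
  rw [e, lower, lower, ← Finset.sum_add_distrib]
  apply Finset.sum_le_sum
  intro u _
  have := (P.wt_pos u).le
  by_cases h1 : u = s
  · subst h1; simp [h, hlt]
  · simp only [h1, if_false, add_zero]
    split_ifs with h2 h3
    · exact le_rfl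
    · exact absurd ⟨h2.1.trans h, h2.2.trans hlt⟩ h3
    · exact this
    · exact le_rfl

lemma lower_add_le_total (s : S) : P.lower s + P.wt s ≤ P.total (P.comp s) := by
  classical
  have e : P.wt s = ∑ u, if u = s then P.wt u else 0 := by simp
  rw [e, lower, total, ← Finset.sum_add_distrib]
  apply Finset.sum_le_sum
  intro u _
  have := (P.wt_pos u).le
  by_cases h1 : u = s
  · subst h1; simp
  · simp only [h1, if_false, add_zero]
    split_ifs with h2 h3
    · exact le_rfl
    · exact absurd h2.1 h3
    · exact this
    · exact le_rfl

/-- The order of strips is the order of the points. -/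
lemma pos_le_of_mem_strip {s t : S} (h : P.comp s = P.comp t) {u v : ℝ} (hu : u ∈ P.strip s)
    (hv : v ∈ P.strip t) (huv : u ≤ v) : P.pos s ≤ P.pos t := by
  by_contra hc
  push Not at hc
  have := P.lower_add_le_lower h.symm hc
  linarith [hu.1, hv.2]

lemma eq_of_mem_strip {s t : S} (h : P.comp s = P.comp t) {u : ℝ} (hu : u ∈ P.strip s)
    (hv : u ∈ P.strip t) : s = t :=
  P.inj s t h (le_antisymm (P.pos_le_of_mem_strip h hu hv le_rfl)
    (P.pos_le_of_mem_strip h.symm hv hu le_rfl))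

lemma volume_strip (s : S) : volume.real (P.strip s) = P.wt s := by
  rw [strip, Real.volume_real_Ioo_of_le (by linarith [P.wt_pos s])]; ring

lemma strip_subset (s : S) : P.strip s ⊆ Ioo 0 (P.total (P.comp s)) :=
  Ioo_subset_Ioo (P.lower_nonneg s) (P.lower_add_le_total s)

lemma total_nonneg (c : κ) : 0 ≤ P.total c := by
  classical
  apply Finset.sum_nonneg
  intro t _
  split_ifs
  · exact (P.wt_pos t).le
  · exact le_rfl

/-- The strips on an interval cover it up to finitely many points. -/
lemma ae_exists_mem_strip (c : κ) :
    ∀ᵐ u : ℝ, u ∈ Ioo 0 (P.total c) → ∃ s, P.comp s = c ∧ u ∈ P.strip s := by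
  classical
  set F := Finset.univ.filter fun s => P.comp s = c with hF
  have hmem : ∀ s, s ∈ F ↔ P.comp s = c := by simp [hF]
  have hd : PairwiseDisjoint (↑F) P.strip := by
    intro s hs t ht hst
    rw [Function.onFun, Set.disjoint_left]
    intro u hu hv
    exact hst (P.eq_of_mem_strip (((hmem s).1 hs).trans ((hmem t).1 ht).symm) hu hv)
  have hU : volume.real (⋃ s ∈ F, P.strip s) = P.total c := by
    rw [measureReal_biUnion_finset hd (fun s _ => measurableSet_Ioo)
      (fun s _ => measure_Ioo_lt_top.ne), total, hF, Finset.sum_filter]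
    apply Finset.sum_congr rfl
    intro s _
    simp [volume_strip]
  have hsub : (⋃ s ∈ F, P.strip s) ⊆ Ioo 0 (P.total c) := by
    apply iUnion₂_subset
    intro s hs
    rw [← (hmem s).1 hs]
    exact P.strip_subset s
  have hae : (⋃ s ∈ F, P.strip s) =ᵐ[volume] Ioo 0 (P.total c) := by
    apply ae_eq_of_subset_of_measure_ge hsub
    · rw [← ENNReal.toReal_le_toReal measure_Ioo_lt_top.ne
        ((measure_mono hsub).trans_lt measure_Ioo_lt_top).ne]
      change volume.real _ ≤ volume.real _
      rw [hU, Real.volume_real_Ioo_of_le (P.total_nonneg c)]; linarith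
    · exact (Finset.measurableSet_biUnion F fun s _ => measurableSet_Ioo).nullMeasurableSet
    · exact measure_Ioo_lt_top.ne
  filter_upwards [hae] with u hu hmemu
  have : u ∈ ⋃ s ∈ F, P.strip s := by
    change (⋃ s ∈ F, P.strip s) u
    rw [hu]; exact hmemu
  obtain ⟨s, hs, hus⟩ := mem_iUnion₂.1 this
  exact ⟨s, (hmem s).1 hs, hus⟩

/-- Points that refine the points of `P` in an order preserving way: the strip of a point is
subdivided into the strips of the points over it. -/
lemma lower_eq_of_refinement {K : Type*} [Fintype K] (Q : WeightedPoints K κ) (f : K → S)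
    [DecidableEq S]
    (hcomp : ∀ k, Q.comp k = P.comp (f k))
    (hwt : ∀ s, ∑ k, (if f k = s then Q.wt k else 0) = P.wt s)
    (hmono : ∀ k k', P.comp (f k) = P.comp (f k') → P.pos (f k) < P.pos (f k') →
      Q.pos k < Q.pos k') (k : K) :
    Q.lower k = P.lower (f k) +
      ∑ k', if f k' = f k ∧ Q.pos k' < Q.pos k then Q.wt k' else 0 := by
  classical
  have e : P.lower (f k) = ∑ k', if P.comp (f k') = P.comp (f k) ∧ P.pos (f k') < P.pos (f k)
      then Q.wt k' else 0 := by
    unfold lower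
    have : ∀ s, (if P.comp s = P.comp (f k) ∧ P.pos s < P.pos (f k) then P.wt s else 0) =
        ∑ k', if f k' = s then (if P.comp (f k') = P.comp (f k) ∧ P.pos (f k') < P.pos (f k)
          then Q.wt k' else 0) else 0 := by
      intro s
      rw [← hwt s]
      split_ifs with h
      · apply Finset.sum_congr rfl
        intro k' _
        by_cases h1 : f k' = s
        · subst h1; simp [h]
        · simp [h1]
      · symm
        apply Finset.sum_eq_zero
        intro k' _
        by_cases h1 : f k' = s
        · subst h1; simp [h]
        · simp [h1]
    rw [Finset.sum_congr rfl (fun s _ => this s), Finset.sum_comm]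
    apply Finset.sum_congr rfl
    intro k' _
    simp
  rw [e, lower, ← Finset.sum_add_distrib]
  apply Finset.sum_congr rfl
  intro k' _
  rw [hcomp, hcomp]
  by_cases hc : P.comp (f k') = P.comp (f k)
  · rcases lt_trichotomy (P.pos (f k')) (P.pos (f k)) with hlt | heq | hlt
    · have h1 := hmono _ _ hc hlt
      have h2 : f k' ≠ f k := fun e => by rw [e] at hlt; exact lt_irrefl _ hlt
      simp [hc, hlt, h1, h2]
    · have h2 := P.inj _ _ hc heq
      simp [h2]
    · have h1 := hmono _ _ hc.symm hlt
      have h2 : f k' ≠ f k := fun e => by rw [e] at hlt; exact lt_irrefl _ hlt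
      simp [hlt.not_gt, h1.not_gt, h2]
  · have h2 : f k' ≠ f k := fun e => hc (by rw [e])
    simp [hc, h2]

/-- The strip of a refining point is contained in the strip of the refined point. -/
lemma strip_subset_of_refinement {K : Type*} [Fintype K] (Q : WeightedPoints K κ) (f : K → S)
    [DecidableEq S] (hcomp : ∀ k, Q.comp k = P.comp (f k))
    (hwt : ∀ s, ∑ k, (if f k = s then Q.wt k else 0) = P.wt s)
    (hmono : ∀ k k', P.comp (f k) = P.comp (f k') → P.pos (f k) < P.pos (f k') →
      Q.pos k < Q.pos k') (k : K) : Q.strip k ⊆ P.strip (f k) := by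
  classical
  have h := P.lower_eq_of_refinement Q f hcomp hwt hmono k
  have h0 : 0 ≤ ∑ k', if f k' = f k ∧ Q.pos k' < Q.pos k then Q.wt k' else 0 := by
    apply Finset.sum_nonneg
    intro t _
    split_ifs
    · exact (Q.wt_pos t).le
    · exact le_rfl
  have h1 : (∑ k', if f k' = f k ∧ Q.pos k' < Q.pos k then Q.wt k' else 0) + Q.wt k ≤
      P.wt (f k) := by
    have e : Q.wt k = ∑ u, if u = k then Q.wt u else 0 := by simp
    rw [e, ← hwt, ← Finset.sum_add_distrib]
    apply Finset.sum_le_sum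
    intro u _
    have := (Q.wt_pos u).le
    by_cases h1 : u = k
    · subst h1; simp
    · simp only [h1, if_false, add_zero]
      split_ifs with h2 h3
      · exact le_rfl
      · exact absurd h2.1 h3
      · exact this
      · exact le_rfl
  unfold strip
  rw [h]
  apply Ioo_subset_Ioo <;> linarith

end WeightedPoints

lemma measureReal_eq_sum_of_ae_cover {T : Type*} [Fintype T] {B : Set ℝ} (hB : volume B ≠ ∞)
    {f : T → Set ℝ} (hm : ∀ t, MeasurableSet (f t)) (hd : Pairwise (Function.onFun Disjoint f))
    (hsub : ∀ t, f t ⊆ B) (hc : ∀ᵐ u : ℝ, u ∈ B → ∃ t, u ∈ f t) :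
    volume.real B = ∑ t, volume.real (f t) := by
  have : B =ᵐ[volume] ⋃ t, f t := by
    filter_upwards [hc] with u hu
    apply propext
    exact ⟨fun h => mem_iUnion.2 (hu h), fun h => by
      obtain ⟨t, ht⟩ := mem_iUnion.1 h
      exact hsub t ht⟩
  rw [measureReal_congr this, measureReal_iUnion_fintype hd hm
    (fun t => ((measure_mono (hsub t)).trans_lt hB.lt_top).ne)]

/-! ### Overlaps of strips -/

section Overlap

variable {ι γ κ : Type*} [Fintype ι] [Fintype γ] (P : WeightedPoints (ι × Bool) κ)
  (Q : WeightedPoints γ κ) (w : ι → ℝ)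

/-- The strip of an arc `i`, of width `w i`, is glued at both ends (with opposite orientations) to
the strips of the crown arcs. This is the part of it, as a subset of `(0, w i)`, that is glued to the
crown arc `g` at the end `false` and to `h` at the end `true`. -/
def overlap (i : ι) (g h : γ) : Set ℝ :=
  {t | t ∈ Ioo 0 (w i) ∧ (Q.comp g = P.comp (i, false) ∧ P.lower (i, false) + t ∈ Q.strip g) ∧
    (Q.comp h = P.comp (i, true) ∧ P.lower (i, true) + w i - t ∈ Q.strip h)}

lemma measurableSet_overlap (i : ι) (g h : γ) : MeasurableSet (overlap P Q w i g h) := by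
  unfold overlap WeightedPoints.strip
  apply measurableSet_Ioo.inter
  apply MeasurableSet.inter
  · apply MeasurableSet.inter (MeasurableSet.const _)
    exact (measurable_const.add measurable_id) measurableSet_Ioo
  · apply MeasurableSet.inter (MeasurableSet.const _)
    exact (measurable_const.sub measurable_id) measurableSet_Ioo

lemma overlap_disjoint {i : ι} {g h g' h' : γ} {t : ℝ} (h1 : t ∈ overlap P Q w i g h)
    (h2 : t ∈ overlap P Q w i g' h') : g = g' ∧ h = h' :=
  ⟨Q.eq_of_mem_strip (h1.2.1.1.trans h2.2.1.1.symm) h1.2.1.2 h2.2.1.2,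
    Q.eq_of_mem_strip (h1.2.2.1.trans h2.2.2.1.symm) h1.2.2.2 h2.2.2.2⟩

variable {P Q w}

lemma ae_exists_left (hw : ∀ e, P.wt e = w e.1) (hT : ∀ e, Q.total (P.comp e) = P.total (P.comp e))
    (i : ι) : ∀ᵐ t : ℝ, t ∈ Ioo 0 (w i) →
      ∃ g, Q.comp g = P.comp (i, false) ∧ P.lower (i, false) + t ∈ Q.strip g := by
  have h := Q.ae_exists_mem_strip (P.comp (i, false))
  have h2 := (measurePreserving_add_left volume (P.lower (i, false))).quasiMeasurePreserving.ae h
  filter_upwards [h2] with t ht hti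
  apply ht
  have h3 := P.strip_subset (i, false)
  rw [hT]
  apply h3
  rw [WeightedPoints.strip, hw]
  constructor <;> linarith [hti.1, hti.2]

lemma ae_exists_right (hw : ∀ e, P.wt e = w e.1)
    (hT : ∀ e, Q.total (P.comp e) = P.total (P.comp e))
    (i : ι) : ∀ᵐ t : ℝ, t ∈ Ioo 0 (w i) →
      ∃ g, Q.comp g = P.comp (i, true) ∧ P.lower (i, true) + w i - t ∈ Q.strip g := by
  have h := Q.ae_exists_mem_strip (P.comp (i, true))
  have h2 := (Measure.measurePreserving_sub_left volume
    (P.lower (i, true) + w i)).quasiMeasurePreserving.ae h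
  filter_upwards [h2] with t ht hti
  apply ht
  have h3 := P.strip_subset (i, true)
  rw [hT]
  apply h3
  rw [WeightedPoints.strip, hw]
  constructor <;> linarith [hti.1, hti.2]

/-- The overlaps subdivide the strip of an arc. -/
lemma sum_overlap (hw : ∀ e, P.wt e = w e.1) (hT : ∀ e, Q.total (P.comp e) = P.total (P.comp e))
    (i : ι) : ∑ g, ∑ h, volume.real (overlap P Q w i g h) = w i := by
  have h0 : 0 < w i := by rw [← hw (i, false)]; exact P.wt_pos _
  have e : volume.real (Ioo 0 (w i)) =
      ∑ p : γ × γ, volume.real (overlap P Q w i p.1 p.2) := by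
    apply measureReal_eq_sum_of_ae_cover measure_Ioo_lt_top.ne
    · exact fun p => measurableSet_overlap P Q w i p.1 p.2
    · intro p q hpq
      rw [Function.onFun, Set.disjoint_left]
      intro t h1 h2
      obtain ⟨e1, e2⟩ := overlap_disjoint P Q w h1 h2
      exact hpq (Prod.ext e1 e2)
    · exact fun p t ht => ht.1
    · filter_upwards [ae_exists_left hw hT i, ae_exists_right hw hT i] with t h1 h2 ht
      obtain ⟨g, hg⟩ := h1 ht
      obtain ⟨h, hh⟩ := h2 ht
      exact ⟨(g, h), ht, hg, hh⟩
  rw [← Fintype.sum_prod_type', ← e, Real.volume_real_Ioo_of_le h0.le, sub_zero]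

/-- The part of the strip of the arc `i` that is glued to the strip of the crown arc `g` at the
first end. -/
lemma sum_overlap_left (hw : ∀ e, P.wt e = w e.1)
    (hT : ∀ e, Q.total (P.comp e) = P.total (P.comp e)) (i : ι) (g : γ) :
    ∑ h, volume.real (overlap P Q w i g h) =
      volume.real {u | Q.comp g = P.comp (i, false) ∧ u ∈ P.strip (i, false) ∩ Q.strip g} := by
  set B := {t | t ∈ Ioo 0 (w i) ∧ Q.comp g = P.comp (i, false) ∧
    P.lower (i, false) + t ∈ Q.strip g} with hB
  have e : volume.real B = ∑ h, volume.real (overlap P Q w i g h) := by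
    apply measureReal_eq_sum_of_ae_cover
    · exact ((measure_mono (fun t ht => ht.1)).trans_lt (measure_Ioo_lt_top (a := 0) (b := w i))).ne
    · exact fun h => measurableSet_overlap P Q w i g h
    · intro p q hpq
      rw [Function.onFun, Set.disjoint_left]
      intro t h1 h2
      exact hpq (overlap_disjoint P Q w h1 h2).2
    · exact fun p t ht => ⟨ht.1, ht.2.1⟩
    · filter_upwards [ae_exists_right hw hT i] with t h2 ht
      obtain ⟨h, hh⟩ := h2 ht.1
      exact ⟨h, ht.1, ht.2, hh⟩
  have hpre : B = (fun t => P.lower (i, false) + t) ⁻¹'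
      {u | Q.comp g = P.comp (i, false) ∧ u ∈ P.strip (i, false) ∩ Q.strip g} := by
    ext t
    simp only [hB, WeightedPoints.strip, hw, mem_ofPred_eq, mem_preimage, mem_inter_iff, mem_Ioo]
    constructor
    · rintro ⟨⟨h1, h2⟩, h3, h4⟩
      exact ⟨h3, ⟨by linarith, by linarith⟩, h4⟩
    · rintro ⟨h3, ⟨h1, h2⟩, h4⟩
      exact ⟨⟨by linarith, by linarith⟩, h3, h4⟩
  rw [← e, hpre]
  apply (measurePreserving_add_left volume (P.lower (i, false))).measureReal_preimage
  exact ((MeasurableSet.const _).inter (measurableSet_Ioo.inter measurableSet_Ioo)).nullMeasurableSet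

/-- The part of the strip of the arc `i` that is glued to the strip of the crown arc `h` at the
second end, where the strip is traversed in the opposite direction. -/
lemma sum_overlap_right (hw : ∀ e, P.wt e = w e.1)
    (hT : ∀ e, Q.total (P.comp e) = P.total (P.comp e)) (i : ι) (h : γ) :
    ∑ g, volume.real (overlap P Q w i g h) =
      volume.real {u | Q.comp h = P.comp (i, true) ∧ u ∈ P.strip (i, true) ∩ Q.strip h} := by
  set B := {t | t ∈ Ioo 0 (w i) ∧ Q.comp h = P.comp (i, true) ∧
    P.lower (i, true) + w i - t ∈ Q.strip h} with hB
  have e : volume.real B = ∑ g, volume.real (overlap P Q w i g h) := by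
    apply measureReal_eq_sum_of_ae_cover
    · exact ((measure_mono (fun t ht => ht.1)).trans_lt (measure_Ioo_lt_top (a := 0) (b := w i))).ne
    · exact fun g => measurableSet_overlap P Q w i g h
    · intro p q hpq
      rw [Function.onFun, Set.disjoint_left]
      intro t h1 h2
      exact hpq (overlap_disjoint P Q w h1 h2).1
    · exact fun p t ht => ⟨ht.1, ht.2.2⟩
    · filter_upwards [ae_exists_left hw hT i] with t h2 ht
      obtain ⟨g, hg⟩ := h2 ht.1
      exact ⟨g, ht.1, hg, ht.2⟩
  have hpre : B = (fun t => P.lower (i, true) + w i - t) ⁻¹'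
      {u | Q.comp h = P.comp (i, true) ∧ u ∈ P.strip (i, true) ∩ Q.strip h} := by
    ext t
    simp only [hB, WeightedPoints.strip, hw, mem_ofPred_eq, mem_preimage, mem_inter_iff, mem_Ioo]
    constructor
    · rintro ⟨⟨h1, h2⟩, h3, h4⟩
      exact ⟨h3, ⟨by linarith, by linarith⟩, h4⟩
    · rintro ⟨h3, ⟨h1, h2⟩, h4⟩
      exact ⟨⟨by linarith, by linarith⟩, h3, h4⟩
  rw [← e, hpre]
  apply (Measure.measurePreserving_sub_left volume (P.lower (i, true) + w i)).measureReal_preimage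
  exact ((MeasurableSet.const _).inter (measurableSet_Ioo.inter measurableSet_Ioo)).nullMeasurableSet

/-- The overlaps subdivide the strips of the crown arcs. -/
lemma sum_overlap_crown (hw : ∀ e, P.wt e = w e.1)
    (hT : ∀ e, Q.total (P.comp e) = P.total (P.comp e))
    (hT' : ∀ g, Q.total (Q.comp g) = P.total (Q.comp g)) (g : γ) :
    ∑ i, (∑ h, volume.real (overlap P Q w i g h) + ∑ h, volume.real (overlap P Q w i h g)) =
      Q.wt g := by
  have e : volume.real (Q.strip g) = ∑ e : ι × Bool,
      volume.real {u | Q.comp g = P.comp e ∧ u ∈ P.strip e ∩ Q.strip g} := by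
    apply measureReal_eq_sum_of_ae_cover measure_Ioo_lt_top.ne
    · intro e
      exact (MeasurableSet.const _).inter (measurableSet_Ioo.inter measurableSet_Ioo)
    · intro e e' hne
      rw [Function.onFun, Set.disjoint_left]
      rintro t ⟨h1, h2, -⟩ ⟨h3, h4, -⟩
      exact hne (P.eq_of_mem_strip (h1.symm.trans h3) h2 h4)
    · exact fun e t ht => ht.2.2
    · filter_upwards [P.ae_exists_mem_strip (Q.comp g)] with t ht htg
      rw [← hT'] at ht
      obtain ⟨e, he, hte⟩ := ht (Q.strip_subset g htg)
      exact ⟨e, he.symm, hte, htg⟩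
  rw [Q.volume_strip, Fintype.sum_prod_type] at e
  rw [e]
  apply Finset.sum_congr rfl
  intro i _
  rw [sum_overlap_left hw hT, sum_overlap_right hw hT, Fintype.sum_bool, add_comm]

/-- A refinement of the strips of the arcs and of the crown arcs, reversing the order from one end of
an arc to the other, is the subdivision into overlaps, provided that different parts have different
labels. -/
lemma refinement_eq_overlap [DecidableEq ι] [DecidableEq γ] (hw : ∀ e, P.wt e = w e.1)
    (hT : ∀ e, Q.total (P.comp e) = P.total (P.comp e)) {K : Type*} [Fintype K]
    (R : WeightedPoints (K × Bool) κ) (v : K → ℝ) (hv : ∀ e, R.wt e = v e.1)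
    (arcOf : K → ι) (crownOf : K → Bool → γ)
    (hcomp : ∀ k s, R.comp (k, s) = P.comp (arcOf k, s))
    (hcomp' : ∀ k s, R.comp (k, s) = Q.comp (crownOf k s))
    (hsum : ∀ i, ∑ k, (if arcOf k = i then v k else 0) = w i)
    (hsum' : ∀ g, ∑ k, ∑ s, (if crownOf k s = g then v k else 0) = Q.wt g)
    (hmono : ∀ k k' s s', P.comp (arcOf k, s) = P.comp (arcOf k', s') →
      P.pos (arcOf k, s) < P.pos (arcOf k', s') → R.pos (k, s) < R.pos (k', s'))
    (hmono' : ∀ k k' s s', Q.comp (crownOf k s) = Q.comp (crownOf k' s') →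
      Q.pos (crownOf k s) < Q.pos (crownOf k' s') → R.pos (k, s) < R.pos (k', s'))
    (hrev : ∀ k k', arcOf k = arcOf k' → R.pos (k, false) < R.pos (k', false) →
      R.pos (k', true) < R.pos (k, true))
    (hlabel : ∀ k k', arcOf k = arcOf k' → (∀ s, crownOf k s = crownOf k' s) → k = k') :
    (∀ k, v k = volume.real (overlap P Q w (arcOf k) (crownOf k false) (crownOf k true))) ∧
      ∀ i g h, 0 < volume.real (overlap P Q w i g h) →
        ∃ k, arcOf k = i ∧ crownOf k false = g ∧ crownOf k true = h := by
  classical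
  have hvpos : ∀ k, 0 < v k := fun k => by rw [← hv (k, false)]; exact R.wt_pos _
  have hwt : ∀ e : ι × Bool, ∑ κ, (if ((arcOf κ.1, κ.2) : ι × Bool) = e then R.wt κ else 0) =
      P.wt e := by
    rintro ⟨i, s⟩
    rw [hw, Fintype.sum_prod_type, ← hsum i]
    apply Finset.sum_congr rfl
    intro k _
    rw [Fintype.sum_bool, hv, hv]
    by_cases h : arcOf k = i <;> cases s <;> simp [h]
  have hwt' : ∀ g, ∑ κ : K × Bool, (if crownOf κ.1 κ.2 = g then R.wt κ else 0) = Q.wt g := by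
    intro g
    rw [Fintype.sum_prod_type, ← hsum' g]
    apply Finset.sum_congr rfl
    intro k _
    apply Finset.sum_congr rfl
    intro s _
    rw [hv]
  have hlow := P.lower_eq_of_refinement R (fun κ => (arcOf κ.1, κ.2)) (fun κ => hcomp κ.1 κ.2)
    hwt (fun κ κ' => hmono κ.1 κ'.1 κ.2 κ'.2)
  have hstrip := Q.strip_subset_of_refinement R (fun κ => crownOf κ.1 κ.2)
    (fun κ => hcomp' κ.1 κ.2) hwt' (fun κ κ' => hmono' κ.1 κ'.1 κ.2 κ'.2)
  have hlow' : ∀ k s, R.lower (k, s) = P.lower (arcOf k, s) +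
      ∑ k', if arcOf k' = arcOf k ∧ R.pos (k', s) < R.pos (k, s) then v k' else 0 := by
    intro k s
    rw [hlow, Fintype.sum_prod_type]
    congr 1
    apply Finset.sum_congr rfl
    intro k' _
    rw [Fintype.sum_bool, hv, hv]
    by_cases h : arcOf k' = arcOf k <;> cases s <;> simp [h]
  -- the copies before `k` at one end are the copies after `k` at the other end
  have hrev' : ∀ k, (∑ k', if arcOf k' = arcOf k ∧ R.pos (k', false) < R.pos (k, false)
      then v k' else 0) + (∑ k', if arcOf k' = arcOf k ∧ R.pos (k', true) < R.pos (k, true)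
      then v k' else 0) + v k = w (arcOf k) := by
    intro k
    have e : v k = ∑ u, if u = k then v u else 0 := by simp
    rw [← hsum]
    conv_lhs => rw [e]
    rw [← Finset.sum_add_distrib, ← Finset.sum_add_distrib]
    apply Finset.sum_congr rfl
    intro k' _
    by_cases h : arcOf k' = arcOf k
    · by_cases hk : k' = k
      · subst hk; simp
      · rcases lt_trichotomy (R.pos (k', false)) (R.pos (k, false)) with hlt | heq | hlt
        · have := hrev _ _ h hlt
          simp [h, hk, hlt, this.not_gt]
        · exfalso
          have := R.inj (k', false) (k, false) (by rw [hcomp, hcomp, h]) heq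
          exact hk (congrArg Prod.fst this)
        · have := hrev _ _ h.symm hlt
          simp [h, hk, hlt.not_gt, this]
    · have hk : k' ≠ k := fun e => h (by rw [e])
      simp [h, hk]
  -- the strip of the copy `k` lies in the overlap of its label
  have hle : ∀ k, v k ≤ volume.real (overlap P Q w (arcOf k) (crownOf k false)
      (crownOf k true)) := by
    intro k
    set r := ∑ k', if arcOf k' = arcOf k ∧ R.pos (k', false) < R.pos (k, false)
      then v k' else 0 with hr
    set r' := ∑ k', if arcOf k' = arcOf k ∧ R.pos (k', true) < R.pos (k, true)
      then v k' else 0 with hr'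
    have hrr : r + r' + v k = w (arcOf k) := hrev' k
    have nn : ∀ s, 0 ≤ ∑ k', if arcOf k' = arcOf k ∧ R.pos (k', s) < R.pos (k, s)
      then v k' else 0 := by
      intro s
      apply Finset.sum_nonneg
      intro t _
      split_ifs
      · exact (hvpos t).le
      · exact le_rfl
    have hr0 : 0 ≤ r := nn false
    have hr0' : 0 ≤ r' := nn true
    have l1 : R.lower (k, false) = P.lower (arcOf k, false) + r := hlow' k false
    have l2 : R.lower (k, true) = P.lower (arcOf k, true) + r' := hlow' k true
    have hsub : Ioo r (r + v k) ⊆ overlap P Q w (arcOf k) (crownOf k false) (crownOf k true) := by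
      intro t ht
      refine ⟨⟨by linarith [ht.1], by linarith [ht.2]⟩, ⟨?_, ?_⟩, ⟨?_, ?_⟩⟩
      · rw [← hcomp, ← hcomp']
      · apply hstrip (k, false)
        rw [WeightedPoints.strip, l1, hv]
        constructor <;> linarith [ht.1, ht.2]
      · rw [← hcomp, ← hcomp']
      · apply hstrip (k, true)
        rw [WeightedPoints.strip, l2, hv]
        constructor <;> linarith [ht.1, ht.2]
    have hfin : volume (overlap P Q w (arcOf k) (crownOf k false) (crownOf k true)) ≠ ∞ :=
      ((measure_mono (fun t ht => ht.1)).trans_lt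
        (measure_Ioo_lt_top (a := 0) (b := w (arcOf k)))).ne
    have := measureReal_mono (μ := volume) hsub hfin
    rw [Real.volume_real_Ioo_of_le (by linarith [hvpos k])] at this
    linarith
  -- equality holds because both sides add up to the weight of the arc
  have key : ∀ i, ∑ p : γ × γ, (volume.real (overlap P Q w i p.1 p.2) -
      ∑ k, if arcOf k = i ∧ crownOf k false = p.1 ∧ crownOf k true = p.2 then v k else 0) = 0 := by
    intro i
    rw [Finset.sum_sub_distrib, Fintype.sum_prod_type, sum_overlap hw hT, Finset.sum_comm,
      sub_eq_zero, ← hsum i]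
    apply Finset.sum_congr rfl
    intro k _
    rw [Finset.sum_eq_single (crownOf k false, crownOf k true)]
    · simp
    · intro p _ hp
      rw [if_neg]
      rintro ⟨-, h1, h2⟩
      exact hp (Prod.ext h1.symm h2.symm)
    · simp
  have hterm : ∀ i (p : γ × γ), 0 ≤ volume.real (overlap P Q w i p.1 p.2) -
      ∑ k, if arcOf k = i ∧ crownOf k false = p.1 ∧ crownOf k true = p.2 then v k else 0 := by
    intro i p
    rw [sub_nonneg]
    by_cases hex : ∃ k, arcOf k = i ∧ crownOf k false = p.1 ∧ crownOf k true = p.2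
    · obtain ⟨k, h1, h2, h3⟩ := hex
      rw [Finset.sum_eq_single k]
      · rw [if_pos ⟨h1, h2, h3⟩, ← h1, ← h2, ← h3]; exact hle k
      · intro k' _ hk'
        rw [if_neg]
        rintro ⟨h1', h2', h3'⟩
        apply hk'
        apply hlabel _ _ (h1'.trans h1.symm)
        intro s; cases s
        · exact h2'.trans h2.symm
        · exact h3'.trans h3.symm
      · simp
    · rw [Finset.sum_eq_zero]
      · exact measureReal_nonneg
      · intro k _
        rw [if_neg]
        exact fun h => hex ⟨k, h⟩
  have heq : ∀ i (p : γ × γ), volume.real (overlap P Q w i p.1 p.2) =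
      ∑ k, if arcOf k = i ∧ crownOf k false = p.1 ∧ crownOf k true = p.2 then v k else 0 := by
    intro i p
    have := (Finset.sum_eq_zero_iff_of_nonneg (fun p _ => hterm i p)).1 (key i) p
      (Finset.mem_univ _)
    linarith
  constructor
  · intro k
    rw [heq (arcOf k) (crownOf k false, crownOf k true), Finset.sum_eq_single k]
    · simp
    · intro k' _ hk'
      rw [if_neg]
      rintro ⟨h1', h2', h3'⟩
      apply hk'
      apply hlabel _ _ h1'
      intro s; cases s
      · exact h2'
      · exact h3'
    · simp
  · intro i g h hpos
    rw [heq i (g, h)] at hpos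
    obtain ⟨k, -, hk⟩ := Finset.exists_ne_zero_of_sum_ne_zero hpos.ne'
    refine ⟨k, ?_⟩
    by_contra hc
    exact hk (if_neg hc)

end Overlap
end

noncomputable section

namespace CrownedSurface

variable {X : CrownedSurface} {A B D : GL (Fin 3) ℝ}
  {a b a₁ b₁ a₂ b₂ x y z p q u v c c' x₀ x₁ y₀ y₁ z₀ z₁ v₀ v₁ : ℂ}

/-! ### Order of the end-points of disjoint arcs -/

/-- Disjoint arcs that start from one boundary geodesic and end on two others have their starting
points in an order that only depends on these geodesics. -/
lemma IsEdge.coord_lt_of_disjoint (h : X.IsEdge a b) (h₁ : X.IsEdge a₁ b₁) (h₂ : X.IsEdge a₂ b₂)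
    (n01 : ¬ (a = a₁ ∧ b = b₁)) (n02 : ¬ (a = a₂ ∧ b = b₂)) (n12 : ¬ (a₁ = a₂ ∧ b₁ = b₂))
    (hx₀ : x₀ ∈ openSegment ℝ a b) (hx₁ : x₁ ∈ openSegment ℝ a b) (hy₀ : y₀ ∈ openSegment ℝ a b)
    (hy₁ : y₁ ∈ openSegment ℝ a b) (hz₀ : z₀ ∈ openSegment ℝ a₁ b₁)
    (hv₀ : v₀ ∈ openSegment ℝ a₁ b₁) (hz₁ : z₁ ∈ openSegment ℝ a₂ b₂)
    (hv₁ : v₁ ∈ openSegment ℝ a₂ b₂) (hd : Disjoint (segment ℝ x₀ z₀) (segment ℝ x₁ z₁))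
    (hd' : Disjoint (segment ℝ y₀ v₀) (segment ℝ y₁ v₁)) (hlt : coord a b x₀ < coord a b x₁) :
    coord a b y₀ < coord a b y₁ := by
  have pz := h₁.cross_pos_of_mem h (ne_symm n01) hz₀
  have pv := h₁.cross_pos_of_mem h (ne_symm n01) hv₀
  have ne3 : ∀ {x z w : ℂ}, x ∈ openSegment ℝ a b → z ∈ openSegment ℝ a₁ b₁ →
      w ∈ openSegment ℝ a₂ b₂ → cross x z w ≠ 0 := fun hx hz hw =>
    h.cross_ne_zero_of_caps h₁ h₂ n01 n02 n12 (h.subset_cap hx) (h₁.subset_cap hz) (h₂.subset_cap hw)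
  have k1 : cross x₀ z₀ x₁ < 0 := (h.cross_chord_neg_iff hx₀ hx₁ pz).2 hlt
  have k2 := h.mul_cross_pos_of_disjoint h₁ n01 hx₀ hz₀ (h.openSegment_subset hx₁)
    (h₂.openSegment_subset hz₁) k1.ne (ne3 hx₀ hz₀ hz₁)
    (hd.mono_right (openSegment_subset_segment ℝ _ _))
  have k3 : cross x₀ z₀ z₁ < 0 := by
    by_contra hc; push Not at hc; nlinarith [mul_nonpos_of_nonpos_of_nonneg k1.le hc]
  have k4 : cross y₀ v₀ v₁ < 0 := by
    have := cross_pos_iff_of_convex (convex_openSegment a b) (convex_openSegment a₁ b₁)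
      (convex_openSegment a₂ b₂) (fun _ hu _ hv _ hw => ne3 hu hv hw) hx₀ hy₀ hz₀ hv₀ hz₁ hv₁
    exact lt_of_le_of_ne (not_lt.1 fun hc => absurd (this.2 hc) k3.not_gt) (ne3 hy₀ hv₀ hv₁)
  have hyy : y₁ ≠ y₀ := by
    rintro rfl
    exact Set.disjoint_left.1 hd' (left_mem_segment ℝ _ _) (left_mem_segment ℝ _ _)
  have hyv : y₁ ≠ v₀ := by
    rintro rfl
    rw [IsEdge.cross_eq_zero hy₁] at pv; exact lt_irrefl _ pv
  have k5 := h.cross_chord_ne_zero h₁ h n01 hy₀ hv₀ hy₁ hyy hyv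
  have k6 := h.mul_cross_pos_of_disjoint h₁ n01 hy₀ hv₀ (h.openSegment_subset hy₁)
    (h₂.openSegment_subset hv₁) k5 k4.ne
    (hd'.mono_right (openSegment_subset_segment ℝ _ _))
  rw [← h.cross_chord_neg_iff hy₀ hy₁ pv]
  by_contra hc; push Not at hc; nlinarith [mul_nonpos_of_nonneg_of_nonpos hc k4.le]

/-- Arcs between the same two boundary geodesics are disjoint if and only if their end-points are in
opposite orders. -/
lemma IsEdge.disjoint_iff_reversed (h : X.IsEdge a b) (h₁ : X.IsEdge a₁ b₁)
    (n01 : ¬ (a = a₁ ∧ b = b₁)) (hy₀ : y₀ ∈ openSegment ℝ a b)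
    (hy₁ : y₁ ∈ openSegment ℝ a b) (hv₀ : v₀ ∈ openSegment ℝ a₁ b₁)
    (hv₁ : v₁ ∈ openSegment ℝ a₁ b₁) (hlt : coord a b y₀ < coord a b y₁) :
    Disjoint (segment ℝ y₀ v₀) (segment ℝ y₁ v₁) ↔ coord a₁ b₁ v₁ < coord a₁ b₁ v₀ := by
  have pv := h₁.cross_pos_of_mem h (ne_symm n01) hv₀
  have py := h.cross_pos_of_mem h₁ n01 hy₀
  have k1 : cross y₀ v₀ y₁ < 0 := (h.cross_chord_neg_iff hy₀ hy₁ pv).2 hlt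
  have k2 : cross y₀ v₀ v₁ < 0 ↔ coord a₁ b₁ v₁ < coord a₁ b₁ v₀ := by
    rw [cross_swap, neg_lt_zero, h₁.cross_chord_pos_iff hv₀ hv₁ py]
  rw [← k2]
  constructor
  · intro hd
    have hvv : v₁ ≠ v₀ := by
      rintro rfl
      exact Set.disjoint_left.1 hd (right_mem_segment ℝ _ _) (right_mem_segment ℝ _ _)
    have hvy : v₁ ≠ y₀ := by
      rintro rfl
      rw [IsEdge.cross_eq_zero hv₁] at py; exact lt_irrefl _ py
    have k3 := h.mul_cross_pos_of_disjoint h₁ n01 hy₀ hv₀ (h.openSegment_subset hy₁)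
      (h₁.openSegment_subset hv₁) k1.ne (h.cross_chord_ne_zero h₁ h₁ n01 hy₀ hv₀ hv₁ hvy hvv)
      (hd.mono_right (openSegment_subset_segment ℝ _ _))
    by_contra hc; push Not at hc; nlinarith [mul_nonpos_of_nonpos_of_nonneg k1.le hc]
  · intro hc
    exact disjoint_segment_of_same_side (mul_pos_of_neg_of_neg k1 hc)

lemma disjoint_segment_act (hA : A ∈ X.grp) (hp : 0 ≤ polar p p) (hq : 0 ≤ polar q q)
    (hu : 0 ≤ polar u u) (hv : 0 ≤ polar v v) (hd : Disjoint (segment ℝ p q) (segment ℝ u v)) :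
    Disjoint (segment ℝ (act A p) (act A q)) (segment ℝ (act A u) (act A v)) := by
  have key : ∀ {r t w : ℂ}, 0 ≤ polar r r → 0 ≤ polar t t → w ∈ segment ℝ (act A r) (act A t) →
      act A⁻¹ w ∈ segment ℝ r t := by
    intro r t w hr ht hw
    have := (isom_inv hA).act_mem_segment ((X.isom A hA).polar_act_nonneg hr)
      ((X.isom A hA).polar_act_nonneg ht) hw
    rwa [act_inv_act hA hr, act_inv_act hA ht] at this
  rw [Set.disjoint_left] at hd ⊢
  exact fun w hw hw' => hd (key hp hq hw) (key hu hv hw')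

lemma disjoint_ray_act (hA : A ∈ X.grp) (hp : 0 ≤ polar p p) (hq : 0 ≤ polar q q)
    (hu : 0 ≤ polar u u) (hv : 0 ≤ polar v v) (hd : Disjoint (ray p q) (ray u v)) :
    Disjoint (ray (act A p) (act A q)) (ray (act A u) (act A v)) := by
  have key : ∀ {r t w : ℂ}, 0 ≤ polar r r → 0 ≤ polar t t → w ∈ ray (act A r) (act A t) →
      act A⁻¹ w ∈ ray r t := by
    intro r t w hr ht hw
    have hr' := (X.isom A hA).polar_act_nonneg hr
    have ht' := (X.isom A hA).polar_act_nonneg ht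
    have := (isom_inv hA).act_mem_segment hr' ht' hw.1
    rw [act_inv_act hA hr, act_inv_act hA ht] at this
    refine ⟨this, fun e => hw.2 ?_⟩
    rw [mem_singleton_iff] at e ⊢
    rw [← e, act_act_inv hA (polar_segment_nonneg hr' ht' hw.1)]
  rw [Set.disjoint_left] at hd ⊢
  exact fun w hw hw' => hd (key hp hq hw) (key hu hv hw')

lemma left_mem_ray (h : x ≠ c) : x ∈ ray x c := ⟨left_mem_segment ℝ _ _, h⟩

lemma Marked.exists_act_eq (hx : X.Marked x) (hy : X.Marked y) (hc : X.cls x = X.cls y)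
    (hp : X.pos x = X.pos y) : ∃ A ∈ X.grp, _root_.act A x = y := by
  obtain ⟨A, hA, h⟩ := (hx.cls_eq_iff hy).1 hc
  refine ⟨A, hA, h.eq_of_pos_eq ?_⟩
  rw [hx.pos_act hA, hp]

lemma Marked.cls_eq_iff_exists_mem (hx : X.Marked x) (hy : X.Marked y) (h : X.IsEdge a b)
    (hm : x ∈ openSegment ℝ a b) :
    X.cls y = X.cls x ↔ ∃ A ∈ X.grp, _root_.act A y ∈ openSegment ℝ a b := by
  rw [hy.cls_eq_iff hx]
  constructor
  · rintro ⟨A, hA, hs⟩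
    refine ⟨A, hA, ?_⟩
    obtain ⟨a', b', h', h1, h2⟩ := hs.exists_edge
    obtain ⟨rfl, rfl⟩ := h.eq_of_mem h' hm h2
    exact h1
  · rintro ⟨A, hA, hs⟩
    obtain ⟨B, hB, h1⟩ := h.exists_sameInterval hs hm (hy.act hA).2 hx.2
    exact ⟨B * A, mul_mem hB hA, by rwa [act_mul_of_mem hA hy.polar_pos.le]⟩

lemma IsCrownArc.polar_pos (h : X.IsCrownArc x c) : 0 < polar x x := by
  obtain ⟨a, b, he, hx, -⟩ := isCrownArc_iff.1 h
  exact he.polar_pos hx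

lemma IsCrownArc.polar_tip (h : X.IsCrownArc x c) : polar c c = 0 := polar_of_mem_cusps h.2.1

lemma IsCrownArc.ne (h : X.IsCrownArc x c) : x ≠ c := by
  rintro rfl
  exact h.polar_pos.ne' h.polar_tip

end CrownedSurface

open CrownedSurface

variable {X : CrownedSurface}

/-! ### The weighted points of the laminations on the boundary -/

namespace CrownLamination

variable (G : CrownLamination X)

lemma marked (i : Fin G.n) : X.Marked (G.foot i) :=
  ⟨exists_mem_boundaryLines_iff.1 (G.isArc i).1, G.foot_not_base i⟩

lemma disjoint_ray {A B : GL (Fin 3) ℝ} (hA : A ∈ X.grp) (hB : B ∈ X.grp) (i j : Fin G.n) :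
    (i = j ∧ A = B) ∨ Disjoint (ray (act A (G.foot i)) (act A (G.tip i)))
      (ray (act B (G.foot j)) (act B (G.tip j))) := by
  have hi := G.isArc i
  have hj := G.isArc j
  rcases G.disjoint i j (A⁻¹ * B) (mul_mem (inv_mem hA) hB) with ⟨h1, h2⟩ | h
  · exact Or.inl ⟨h1, inv_mul_eq_one.1 h2⟩
  · right
    have hBf := ((X.isom B hB).polar_act_pos hj.polar_pos).le
    have hBt := ((X.isom B hB).polar_act_eq_zero hj.polar_tip).ge
    have hAi := isom_inv hA
    rw [act_mul_of_mem hB hj.polar_pos.le, act_mul_of_mem hB hj.polar_tip.ge] at h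
    have := disjoint_ray_act hA hi.polar_pos.le hi.polar_tip.ge (hAi.polar_act_nonneg hBf)
      (hAi.polar_act_nonneg hBt) h
    rwa [act_act_inv hA hBf, act_act_inv hA hBt] at this

/-- The starting points of the crown arcs as weighted points on the boundary cut open at the
basepoints. -/
def points : WeightedPoints (Fin G.n) (Set ℂ) where
  comp i := X.cls (G.foot i)
  pos i := X.pos (G.foot i)
  wt := G.weight
  wt_pos := G.weight_pos
  inj i j hc hp := by
    obtain ⟨A, hA, h⟩ := (G.marked i).exists_act_eq (G.marked j) hc hp
    rcases G.disjoint_ray hA (one_mem _) i j with ⟨h1, -⟩ | hd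
    · exact h1
    · exfalso
      refine Set.disjoint_left.1 hd (left_mem_ray ((G.isArc i).act hA).ne) ?_
      rw [h, act_one, act_one]
      exact left_mem_ray (G.isArc j).ne

lemma total_points {x : ℂ} (hx : X.Marked x) {a b : ℂ} (h : X.IsEdge a b)
    (hm : x ∈ openSegment ℝ a b) :
    G.points.total (X.cls x) = G.boundaryMeasure (openSegment ℝ a b) := by
  classical
  unfold WeightedPoints.total boundaryMeasure
  apply Finset.sum_congr rfl
  intro i _
  rw [Set.indicator_apply]
  congr 1
  exact propext (hx.cls_eq_iff_exists_mem (G.marked i) h hm)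

end CrownLamination

lemma segment_bool {f : Bool → ℂ} (s : Bool) :
    segment ℝ (f s) (f (!s)) = segment ℝ (f false) (f true) := by
  cases s
  · rfl
  · exact segment_symm ℝ _ _

namespace SurfaceLamination

variable (L : SurfaceLamination X)

lemma marked (i : Fin L.n) (s : Bool) : X.Marked (L.pt i s) :=
  ⟨exists_mem_boundaryLines_iff.1 ((L.isArc i).1 s), L.pt_not_base i s⟩

lemma not_sameLine (i : Fin L.n) (s : Bool) : ¬ X.SameLine (L.pt i s) (L.pt i (!s)) := by
  cases s
  · exact (L.isArc i).2
  · exact fun h => (L.isArc i).2 h.symm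

lemma disjoint_segment {A B : GL (Fin 3) ℝ} (hA : A ∈ X.grp) (hB : B ∈ X.grp) (i j : Fin L.n)
    (s r : Bool) : (i = j ∧ A = B) ∨
    Disjoint (segment ℝ (act A (L.pt i s)) (act A (L.pt i (!s))))
      (segment ℝ (act B (L.pt j r)) (act B (L.pt j (!r)))) := by
  have hi := fun s => (L.marked i s).polar_pos.le
  have hj := fun s => (L.marked j s).polar_pos.le
  rcases L.disjoint i j (A⁻¹ * B) (mul_mem (inv_mem hA) hB) with ⟨h1, h2⟩ | h
  · exact Or.inl ⟨h1, inv_mul_eq_one.1 h2⟩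
  · right
    have hBj := fun s => (X.isom B hB).polar_act_nonneg (hj s)
    have hAi := isom_inv hA
    rw [act_mul_of_mem hB (hj _), act_mul_of_mem hB (hj _)] at h
    have := disjoint_segment_act hA (hi _) (hi _) (hAi.polar_act_nonneg (hBj _))
      (hAi.polar_act_nonneg (hBj _)) h
    rw [act_act_inv hA (hBj _), act_act_inv hA (hBj _)] at this
    rwa [segment_bool (f := fun s => act A (L.pt i s)), segment_bool (f := fun s => act B (L.pt j s))]

/-- Different ends of arcs (up to deck transformations) are different points. -/
lemma act_pt_injective {A B : GL (Fin 3) ℝ} (hA : A ∈ X.grp) (hB : B ∈ X.grp) {i j : Fin L.n}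
    {s r : Bool} (h : act A (L.pt i s) = act B (L.pt j r)) : i = j ∧ s = r ∧ A = B := by
  rcases L.disjoint_segment hA hB i j s r with ⟨rfl, rfl⟩ | hd
  · refine ⟨rfl, ?_, rfl⟩
    by_contra hne
    have hr : r = !s := by cases s <;> cases r <;> simp_all
    have := act_injective hA (L.marked i s).polar_pos.le (L.marked i r).polar_pos.le h
    apply L.not_sameLine i s
    rw [← hr, ← this]
    exact (L.marked i s).refl.sameLine
  · exfalso
    refine Set.disjoint_left.1 hd (left_mem_segment ℝ _ _) ?_
    rw [h]
    exact left_mem_segment ℝ _ _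

/-- The end-points of the arcs on the surface as weighted points on the boundary cut open at the
basepoints. -/
def points : WeightedPoints (Fin L.n × Bool) (Set ℂ) where
  comp e := X.cls (L.pt e.1 e.2)
  pos e := X.pos (L.pt e.1 e.2)
  wt e := L.weight e.1
  wt_pos e := L.weight_pos e.1
  inj e e' hc hp := by
    obtain ⟨A, hA, h⟩ := (L.marked e.1 e.2).exists_act_eq (L.marked e'.1 e'.2) hc hp
    obtain ⟨h1, h2, -⟩ := L.act_pt_injective hA (one_mem _) (h.trans (act_one _).symm)
    exact Prod.ext h1 h2

lemma total_points {x : ℂ} (hx : X.Marked x) {a b : ℂ} (h : X.IsEdge a b)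
    (hm : x ∈ openSegment ℝ a b) :
    L.points.total (X.cls x) = L.boundaryMeasure (openSegment ℝ a b) := by
  classical
  unfold WeightedPoints.total boundaryMeasure
  rw [Fintype.sum_prod_type]
  apply Finset.sum_congr rfl
  intro i _
  apply Finset.sum_congr rfl
  intro s _
  rw [Set.indicator_apply]
  congr 1
  exact propext (hx.cls_eq_iff_exists_mem (L.marked i s) h hm)

end SurfaceLamination

lemma total_eq_total {G : CrownLamination X} {L : SurfaceLamination X}
    (hGL : ∀ β ∈ boundaryLines X.grp, G.boundaryMeasure β = L.boundaryMeasure β) {x : ℂ}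
    (hx : X.Marked x) : G.points.total (X.cls x) = L.points.total (X.cls x) := by
  obtain ⟨⟨a, b, h, hm⟩, -⟩ := id hx
  rw [G.total_points hx h hm, L.total_points hx h hm, hGL _ h.mem_boundaryLines]

/-! ### Disjoint splittings -/

namespace SplitMatching

variable {G : CrownLamination X} {L : SurfaceLamination X} (M M' : SplitMatching G L)

lemma polar_pt (k : Fin M.n) (s : Bool) : 0 < polar (M.pt k s) (M.pt k s) :=
  (M.crown_arc k s).polar_pos

lemma marked (k : Fin M.n) (s : Bool) : X.Marked (M.pt k s) := by
  obtain ⟨A, hA, h⟩ := M.surface_copy k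
  exact (h s).marked.of_act hA (M.polar_pt k s).le

lemma not_sameLine (k : Fin M.n) (s : Bool) : ¬ X.SameLine (M.pt k s) (M.pt k (!s)) := by
  intro hs
  obtain ⟨A, hA, h⟩ := M.surface_copy k
  exact L.not_sameLine _ s (((h s).sameLine.symm.trans (hs.act hA)).trans (h (!s)).sameLine)

lemma cls_pt (k : Fin M.n) (s : Bool) : X.cls (M.pt k s) = X.cls (L.pt (M.arcOf k) s) := by
  obtain ⟨A, hA, h⟩ := M.surface_copy k
  rw [← (h s).cls_eq, (M.marked k s).cls_act hA]

lemma cls_pt' (k : Fin M.n) (s : Bool) :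
    X.cls (M.pt k s) = X.cls (G.foot (M.crownOf k s)) := by
  obtain ⟨A, hA, -, h⟩ := M.crown_copy k s
  rw [← h.cls_eq, (M.marked k s).cls_act hA]

variable {M M'}

/-- Strands with the same label are homotopic relative to their cusps. -/
lemma exists_act_of_label_eq {k : Fin M.n} {k' : Fin M'.n} (h1 : M.arcOf k = M'.arcOf k')
    (h2 : ∀ s, M.crownOf k s = M'.crownOf k' s) : ∃ A ∈ X.grp, ∀ s,
      act A (M.tip k s) = M'.tip k' s ∧ X.SameInterval (act A (M.pt k s)) (M'.pt k' s) := by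
  obtain ⟨A, hA, hAs⟩ := M.surface_copy k
  obtain ⟨B, hB, hBs⟩ := M'.surface_copy k'
  have key : ∀ {C D : GL (Fin 3) ℝ}, C ∈ X.grp → D ∈ X.grp → ∀ {x y z}, 0 ≤ polar x x →
      0 ≤ polar y y → X.SameInterval (act C x) z → X.SameInterval (act D y) z →
      X.SameInterval (act (D⁻¹ * C) x) y := by
    intro C D hC hD x y z hx hy h h'
    have := (h.trans h'.symm).act (inv_mem hD)
    rwa [← act_mul_of_mem hC hx, act_inv_act hD hy] at this
  refine ⟨B⁻¹ * A, mul_mem (inv_mem hB) hA, fun s => ?_⟩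
  have hp := (M.polar_pt k s).le
  have hp' := (M'.polar_pt k' s).le
  have hS : X.SameInterval (act (B⁻¹ * A) (M.pt k s)) (M'.pt k' s) := by
    apply key hA hB hp hp' (hAs s)
    rw [h1]
    exact hBs s
  refine ⟨?_, hS⟩
  obtain ⟨C, hC, hCt, hCs⟩ := M.crown_copy k s
  obtain ⟨D, hD, hDt, hDs⟩ := M'.crown_copy k' s
  have hT : X.SameInterval (act (D⁻¹ * C) (M.pt k s)) (M'.pt k' s) := by
    apply key hC hD hp hp' hCs
    rw [h2]
    exact hDs
  rw [hS.act_unique (mul_mem (inv_mem hB) hA) (mul_mem (inv_mem hD) hC) hp hT,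
    act_mul_of_mem hC (M.crown_arc k s).polar_tip.ge, hCt, h2, ← hDt,
    act_inv_act hD (M'.crown_arc k' s).polar_tip.ge]

lemma NoParallel.label_injective (h : M.NoParallel) {k k' : Fin M.n} (h1 : M.arcOf k = M.arcOf k')
    (h2 : ∀ s, M.crownOf k s = M.crownOf k' s) : k = k' := by
  by_contra hne
  apply h k k' hne
  obtain ⟨A, hA, hs⟩ := exists_act_of_label_eq h1 h2
  refine ⟨false, ⟨A, hA, fun s => ?_⟩, fun s => ⟨A, hA, ?_, ?_⟩⟩
  · rw [Bool.xor_false]; exact (hs s).2.sameLine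
  · rw [Bool.xor_false]; exact (hs s).1
  · rw [Bool.xor_false]; exact (hs s).2

namespace PairwiseDisjoint

lemma disjoint_segment (hM : M.PairwiseDisjoint) {A B : GL (Fin 3) ℝ} (hA : A ∈ X.grp) (hB : B ∈ X.grp) (j k : Fin M.n)
    (s r : Bool) : (j = k ∧ A = B) ∨
    Disjoint (segment ℝ (act A (M.pt j s)) (act A (M.pt j (!s))))
      (segment ℝ (act B (M.pt k r)) (act B (M.pt k (!r)))) := by
  have hi := fun s => (M.polar_pt j s).le
  have hj := fun s => (M.polar_pt k s).le
  rcases hM j k (A⁻¹ * B) (mul_mem (inv_mem hA) hB) with ⟨h1, h2⟩ | h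
  · exact Or.inl ⟨h1, inv_mul_eq_one.1 h2⟩
  · right
    have hBj := fun s => (X.isom B hB).polar_act_nonneg (hj s)
    have hAi := isom_inv hA
    replace h := (h.mono_left (subset_union_left.trans subset_union_left)).mono_right
      (subset_union_left.trans subset_union_left)
    beta_reduce at h
    rw [act_mul_of_mem hB (hj _), act_mul_of_mem hB (hj _)] at h
    have := disjoint_segment_act hA (hi _) (hi _) (hAi.polar_act_nonneg (hBj _))
      (hAi.polar_act_nonneg (hBj _)) h
    rw [act_act_inv hA (hBj _), act_act_inv hA (hBj _)] at this
    rwa [segment_bool (f := fun s => act A (M.pt j s)), segment_bool (f := fun s => act B (M.pt k s))]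

lemma disjoint_ray (hM : M.PairwiseDisjoint) {A B : GL (Fin 3) ℝ} (hA : A ∈ X.grp) (hB : B ∈ X.grp) (j k : Fin M.n)
    (s r : Bool) : (j = k ∧ A = B) ∨
    Disjoint (ray (act A (M.pt j s)) (act A (M.tip j s)))
      (ray (act B (M.pt k r)) (act B (M.tip k r))) := by
  have hi := fun s => (M.crown_arc j s)
  have hj := fun s => (M.crown_arc k s)
  rcases hM j k (A⁻¹ * B) (mul_mem (inv_mem hA) hB) with ⟨h1, h2⟩ | h
  · exact Or.inl ⟨h1, inv_mul_eq_one.1 h2⟩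
  · right
    have hBf := ((X.isom B hB).polar_act_pos (hj r).polar_pos).le
    have hBt := ((X.isom B hB).polar_act_eq_zero (hj r).polar_tip).ge
    have hAi := isom_inv hA
    have hsub : ∀ (x c : Bool → ℂ) (s : Bool), ray (x s) (c s) ⊆ strandTrace x c := by
      intro x c s
      cases s
      · exact subset_union_right.trans subset_union_left
      · exact subset_union_right
    replace h := (h.mono_left (hsub _ _ s)).mono_right (hsub _ _ r)
    beta_reduce at h
    rw [act_mul_of_mem hB (hj r).polar_pos.le, act_mul_of_mem hB (hj r).polar_tip.ge] at h
    have := disjoint_ray_act hA (hi s).polar_pos.le (hi s).polar_tip.ge (hAi.polar_act_nonneg hBf)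
      (hAi.polar_act_nonneg hBt) h
    rwa [act_act_inv hA hBf, act_act_inv hA hBt] at this

lemma act_pt_injective (hM : M.PairwiseDisjoint) {A B : GL (Fin 3) ℝ} (hA : A ∈ X.grp) (hB : B ∈ X.grp) {j k : Fin M.n}
    {s r : Bool} (h : act A (M.pt j s) = act B (M.pt k r)) : j = k ∧ s = r ∧ A = B := by
  rcases hM.disjoint_segment hA hB j k s r with ⟨rfl, rfl⟩ | hd
  · refine ⟨rfl, ?_, rfl⟩
    by_contra hne
    have hr : r = !s := by cases s <;> cases r <;> simp_all
    have := act_injective hA (M.polar_pt j s).le (M.polar_pt j r).le h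
    apply M.not_sameLine j s
    rw [← hr, ← this]
    exact (M.marked j s).refl.sameLine
  · exfalso
    refine Set.disjoint_left.1 hd (left_mem_segment ℝ _ _) ?_
    rw [h]
    exact left_mem_segment ℝ _ _

/-- The crossings of the strands with the boundary as weighted points on the boundary cut open at
the basepoints. -/
def points (hM : M.PairwiseDisjoint) : WeightedPoints (Fin M.n × Bool) (Set ℂ) where
  comp e := X.cls (M.pt e.1 e.2)
  pos e := X.pos (M.pt e.1 e.2)
  wt e := M.arcWeight e.1
  wt_pos e := M.arcWeight_pos e.1
  inj e e' hc hp := by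
    obtain ⟨A, hA, h⟩ := (M.marked e.1 e.2).exists_act_eq (M.marked e'.1 e'.2) hc hp
    obtain ⟨h1, h2, -⟩ := hM.act_pt_injective hA (one_mem _) (h.trans (act_one _).symm)
    exact Prod.ext h1 h2

/-- The crossings of the strands are in the order of the end-points of the arcs on the surface. -/
lemma pos_lt_of_arc (hM : M.PairwiseDisjoint) {k k' : Fin M.n} {s s' : Bool}
    (hc : X.cls (L.pt (M.arcOf k) s) = X.cls (L.pt (M.arcOf k') s'))
    (hlt : X.pos (L.pt (M.arcOf k) s) < X.pos (L.pt (M.arcOf k') s')) :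
    X.pos (M.pt k s) < X.pos (M.pt k' s') := by
  obtain ⟨A, hA, hAs⟩ := M.surface_copy k
  obtain ⟨B, hB, hBs⟩ := M.surface_copy k'
  set i := M.arcOf k
  set i' := M.arcOf k'
  obtain ⟨D, hD, hDs⟩ := ((L.marked i s).cls_eq_iff (L.marked i' s')).1 hc
  have hpL : ∀ i s, 0 ≤ polar (L.pt i s) (L.pt i s) := fun i s => (L.marked i s).polar_pos.le
  have hpM : ∀ k s, 0 ≤ polar (M.pt k s) (M.pt k s) := fun k s => (M.polar_pt k s).le
  have hDA := mul_mem hD hA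
  have hDAs : ∀ r, X.SameInterval (act (D * A) (M.pt k r)) (act D (L.pt i r)) := by
    intro r
    rw [act_mul_of_mem hA (hpM k r)]
    exact (hAs r).act hD
  -- the boundary geodesics involved
  obtain ⟨a, b, h, hx₀, hx₁⟩ := hDs.exists_edge
  have on : ∀ {a b x y : ℂ}, X.IsEdge a b → y ∈ openSegment ℝ a b → X.SameLine x y →
      x ∈ openSegment ℝ a b := by
    intro a b x y h hy hs
    obtain ⟨a', b', h', h1, h2⟩ := hs.exists_edge
    obtain ⟨rfl, rfl⟩ := h.eq_of_mem h' hy h2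
    exact h1
  have hy₀ := on h hx₀ (hDAs s).sameLine
  have hy₁ := on h hx₁ (hBs s').sameLine
  obtain ⟨a₁, b₁, h₁, hv₀, hz₀⟩ := (hDAs (!s)).exists_edge
  obtain ⟨a₂, b₂, h₂, hv₁, hz₁⟩ := (hBs (!s')).exists_edge
  have n01 : ¬ (a = a₁ ∧ b = b₁) := by
    rintro ⟨rfl, rfl⟩
    have := (h.sameLine hx₀ hz₀).act (inv_mem hD)
    rw [act_inv_act hD (hpL _ _), act_inv_act hD (hpL _ _)] at this
    exact L.not_sameLine i s this
  have n02 : ¬ (a = a₂ ∧ b = b₂) := by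
    rintro ⟨rfl, rfl⟩
    exact L.not_sameLine i' s' (h.sameLine hx₁ hz₁)
  have hne : ¬ (i = i' ∧ s = s') := by
    rintro ⟨e1, e2⟩
    rw [e1, e2] at hlt; exact lt_irrefl _ hlt
  have n12 : ¬ (a₁ = a₂ ∧ b₁ = b₂) := by
    rintro ⟨rfl, rfl⟩
    have hhom : X.SurfaceHomotopic (xor s s') (L.pt i) (L.pt i') := by
      refine ⟨D, hD, fun r => ?_⟩
      by_cases hr : r = s
      · subst hr
        rw [← Bool.xor_assoc, Bool.xor_self, Bool.false_xor]
        exact hDs.sameLine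
      · obtain rfl : r = !s := by cases r <;> cases s <;> simp_all
        have : xor (!s) (xor s s') = !s' := by cases s <;> cases s' <;> rfl
        rw [this]
        exact h₁.sameLine hz₀ hz₁
    by_cases hi : i = i'
    · rw [← hi] at hx₁ hz₁ hne
      obtain rfl : s' = !s := by cases s <;> cases s' <;> simp_all
      rw [Bool.not_not] at hz₁
      obtain ⟨e1, e2⟩ := h.act_eq h₁ hD hx₁ hz₀
      obtain ⟨e3, e4⟩ := h₁.act_eq h hD hz₁ hx₀
      exact h.not_swap h₁ n01 hD e1 e2 e3 e4
    · exact L.not_homotopic i i' hi _ hhom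
  have hdL : Disjoint (segment ℝ (act D (L.pt i s)) (act D (L.pt i (!s))))
      (segment ℝ (L.pt i' s') (L.pt i' (!s'))) := by
    rcases L.disjoint_segment hD (one_mem _) i i' s s' with ⟨e1, rfl⟩ | hd
    · exfalso
      have hs : s' = !s := by
        have : s ≠ s' := fun e => hne ⟨e1, e⟩
        cases s <;> cases s' <;> simp_all
      rw [act_one] at hx₀
      rw [hs, ← e1] at hx₁
      exact L.not_sameLine i s (h.sameLine hx₀ hx₁)
    · simpa only [act_one] using hd
  have hdM : Disjoint (segment ℝ (act (D * A) (M.pt k s)) (act (D * A) (M.pt k (!s))))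
      (segment ℝ (act B (M.pt k' s')) (act B (M.pt k' (!s')))) := by
    rcases hM.disjoint_segment hDA hB k k' s s' with ⟨e1, e2⟩ | hd
    · exfalso
      have hs : s' = !s := by
        have : s ≠ s' := fun e => hne ⟨congrArg M.arcOf e1, e⟩
        cases s <;> cases s' <;> simp_all
      rw [← e1, ← e2, hs] at hy₁
      have := (h.sameLine hy₀ hy₁).act (inv_mem hDA)
      rw [act_inv_act hDA (hpM _ _), act_inv_act hDA (hpM _ _)] at this
      exact M.not_sameLine k s this
    · exact hd
  have hXlt : coord a b (act D (L.pt i s)) < coord a b (L.pt i' s') := by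
    rw [← hDs.pos_lt_iff h hx₀ hx₁, (L.marked i s).pos_act hD]; exact hlt
  have := h.coord_lt_of_disjoint h₁ h₂ n01 n02 n12 hx₀ hx₁ hy₀ hy₁ hz₀ hv₀ hz₁ hv₁ hdL hdM hXlt
  have hSI : X.SameInterval (act (D * A) (M.pt k s)) (act B (M.pt k' s')) :=
    ((hDAs s).trans hDs).trans (hBs s').symm
  rwa [← hSI.pos_lt_iff h hy₀ hy₁, (M.marked k s).pos_act hDA, (M.marked k' s').pos_act hB] at this

/-- The copies of an arc have their end-points in opposite orders at the two ends. -/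
lemma pos_lt_reversed (hM : M.PairwiseDisjoint) {k k' : Fin M.n} (hk : M.arcOf k = M.arcOf k')
    (hlt : X.pos (M.pt k false) < X.pos (M.pt k' false)) :
    X.pos (M.pt k' true) < X.pos (M.pt k true) := by
  obtain ⟨A, hA, hAs⟩ := M.surface_copy k
  obtain ⟨B, hB, hBs⟩ := M.surface_copy k'
  rw [← hk] at hBs
  have hSI : ∀ s, X.SameInterval (act A (M.pt k s)) (act B (M.pt k' s)) :=
    fun s => (hAs s).trans (hBs s).symm
  obtain ⟨a, b, h, hy₀, hy₁⟩ := (hSI false).exists_edge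
  obtain ⟨a₁, b₁, h₁, hv₁, hv₀⟩ := (hSI true).exists_edge
  have n01 : ¬ (a = a₁ ∧ b = b₁) := by
    rintro ⟨rfl, rfl⟩
    have := (h.sameLine hy₀ hv₁).act (inv_mem hA)
    rw [act_inv_act hA (M.polar_pt _ _).le, act_inv_act hA (M.polar_pt _ _).le] at this
    exact M.not_sameLine k false this
  have hd := hM.disjoint_segment hA hB k k' false false
  rcases hd with ⟨rfl, -⟩ | hd
  · exact absurd hlt (lt_irrefl _)
  rw [← (M.marked k false).pos_act hA, ← (M.marked k' false).pos_act hB,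
    (hSI false).pos_lt_iff h hy₀ hy₁] at hlt
  rw [← (M.marked k true).pos_act hA, ← (M.marked k' true).pos_act hB,
    (hSI true).symm.pos_lt_iff h₁ hv₀ hv₁]
  exact (h.disjoint_iff_reversed h₁ n01 hy₀ hy₁ hv₁ hv₀ hlt).1 hd

/-- The crossings of the strands are in the order of the starting points of the crown arcs. -/
lemma pos_lt_of_crown (hM : M.PairwiseDisjoint) {k k' : Fin M.n} {s s' : Bool}
    (hc : X.cls (G.foot (M.crownOf k s)) = X.cls (G.foot (M.crownOf k' s')))
    (hlt : X.pos (G.foot (M.crownOf k s)) < X.pos (G.foot (M.crownOf k' s'))) :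
    X.pos (M.pt k s) < X.pos (M.pt k' s') := by
  obtain ⟨A, hA, hAt, hAs⟩ := M.crown_copy k s
  obtain ⟨B, hB, hBt, hBs⟩ := M.crown_copy k' s'
  set g := M.crownOf k s with hg
  set g' := M.crownOf k' s' with hg'
  have hne : g ≠ g' := by intro e; rw [e] at hlt; exact lt_irrefl _ hlt
  obtain ⟨D, hD, hDs⟩ := ((G.marked g).cls_eq_iff (G.marked g')).1 hc
  have hDA := mul_mem hD hA
  have hDAs : X.SameInterval (act (D * A) (M.pt k s)) (act D (G.foot g)) := by
    rw [act_mul_of_mem hA (M.polar_pt k s).le]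
    exact hAs.act hD
  have hDAt : act (D * A) (M.tip k s) = act D (G.tip g) := by
    rw [act_mul_of_mem hA (M.crown_arc k s).polar_tip.ge, hAt]
  have hSI : X.SameInterval (act (D * A) (M.pt k s)) (act B (M.pt k' s')) :=
    (hDAs.trans hDs).trans hBs.symm
  by_contra hcon
  rw [← (M.marked k s).pos_act hDA, ← (M.marked k' s').pos_act hB] at hcon
  have hnepos : X.pos (act (D * A) (M.pt k s)) ≠ X.pos (act B (M.pt k' s')) := by
    intro e
    obtain ⟨e1, e2, -⟩ := hM.act_pt_injective hDA hB (hSI.eq_of_pos_eq e)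
    subst e1 e2
    exact hne rfl
  have hlt' := lt_of_le_of_ne (not_lt.1 hcon) hnepos.symm
  obtain ⟨a, b, h, hx₀, hx₁⟩ := hDs.exists_edge
  have on : ∀ {a b x y : ℂ}, X.IsEdge a b → y ∈ openSegment ℝ a b → X.SameLine x y →
      x ∈ openSegment ℝ a b := by
    intro a b x y h hy hs
    obtain ⟨a', b', h', h1, h2⟩ := hs.exists_edge
    obtain ⟨rfl, rfl⟩ := h.eq_of_mem h' hy h2
    exact h1
  have hy₀ := on h hx₀ hDAs.sameLine
  have hy₁ := on h hx₁ hBs.sameLine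
  have a₀ := (G.isArc g).act hD
  have a₁ := G.isArc g'
  have t₀ := a₀.polar_tip
  have t₁ := a₁.polar_tip
  have n₀ := a₀.cross_neg h hx₀
  have n₁ := a₁.cross_neg h hx₁
  have hdG : Disjoint (ray (act D (G.foot g)) (act D (G.tip g))) (ray (G.foot g') (G.tip g')) := by
    rcases G.disjoint_ray hD (one_mem _) g g' with ⟨e, -⟩ | hd
    · exact absurd e hne
    · simpa only [act_one] using hd
  have hdM : Disjoint (ray (act B (M.pt k' s')) (G.tip g'))
      (ray (act (D * A) (M.pt k s)) (act D (G.tip g))) := by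
    rcases hM.disjoint_ray hB hDA k' k s' s with ⟨e1, e2⟩ | hd
    · exfalso
      subst e1
      rw [e2] at hy₁
      have hs : s' = !s := by
        have : s ≠ s' := fun e => hne (by rw [hg, hg', e])
        cases s <;> cases s' <;> simp_all
      have := (h.sameLine hy₀ hy₁).act (inv_mem hDA)
      rw [act_inv_act hDA (M.polar_pt _ _).le, act_inv_act hDA (M.polar_pt _ _).le, hs] at this
      exact M.not_sameLine _ s this
    · rwa [hBt, hDAt] at hd
  have hXlt : coord a b (act D (G.foot g)) < coord a b (G.foot g') := by
    rw [← hDs.pos_lt_iff h hx₀ hx₁, (G.marked g).pos_act hD]; exact hlt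
  rw [hSI.symm.pos_lt_iff h hy₁ hy₀] at hlt'
  have k1 := (h.disjoint_ray_iff hx₀ hx₁ t₀ t₁ n₀ n₁ hXlt).1 hdG
  have k2 := (h.disjoint_ray_iff hy₁ hy₀ t₁ t₀ n₁ n₀ hlt').1 hdM
  -- both orders of the tips hold, so the tips agree and the crown arcs are homotopic
  have htip : act D (G.tip g) = G.tip g' := by
    by_contra hne'
    have hxp := h.polar_pos hx₀
    have hyp := h.polar_pos hy₁
    have e1 := cross_tips_ne_zero t₀ t₁ hne' n₀ n₁ hxp.le (IsEdge.cross_eq_zero hx₀).ge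
    have e2 := cross_tips_pos_iff t₀ t₁ n₀ n₁ hxp.le (IsEdge.cross_eq_zero hx₀).ge hyp.le
      (IsEdge.cross_eq_zero hy₁).ge
    have e3 := e2.1 (lt_of_le_of_ne k1 e1.symm)
    rw [cross_swap_right] at k2
    linarith
  exact G.not_homotopic g g' hne ⟨D, hD, htip, hDs⟩

/-- The weights of a disjoint splitting without parallel strands are determined by its labels, and
the labels are the ones with a positive overlap. -/
lemma weights (hM : M.PairwiseDisjoint) (hP : M.NoParallel)
    (hGL : ∀ β ∈ boundaryLines X.grp, G.boundaryMeasure β = L.boundaryMeasure β) :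
    (∀ k, M.arcWeight k = volume.real (overlap L.points G.points L.weight (M.arcOf k)
      (M.crownOf k false) (M.crownOf k true))) ∧
      ∀ i g h, 0 < volume.real (overlap L.points G.points L.weight i g h) →
        ∃ k, M.arcOf k = i ∧ M.crownOf k false = g ∧ M.crownOf k true = h := by
  apply refinement_eq_overlap (fun _ => rfl) (fun e => total_eq_total hGL (L.marked e.1 e.2))
    hM.points M.arcWeight (fun _ => rfl) M.arcOf M.crownOf
  · exact fun k s => M.cls_pt k s
  · exact fun k s => M.cls_pt' k s
  · exact M.surface_sum
  · intro g
    refine Eq.trans ?_ (M.crown_sum g)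
    simp only [M.weight_eq]
  · exact fun k k' s s' => hM.pos_lt_of_arc
  · exact fun k k' s s' => hM.pos_lt_of_crown
  · exact fun k k' => hM.pos_lt_reversed
  · exact fun k k' => hP.label_injective

end PairwiseDisjoint

/-- Two disjoint splittings without parallel strands are the same up to homotopy. -/
lemma equivalent_of_disjoint (hM : M.PairwiseDisjoint) (hP : M.NoParallel)
    (hM' : M'.PairwiseDisjoint) (hP' : M'.NoParallel)
    (hGL : ∀ β ∈ boundaryLines X.grp, G.boundaryMeasure β = L.boundaryMeasure β) :
    M.Equivalent M' := by
  obtain ⟨w1, w2⟩ := hM.weights hP hGL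
  obtain ⟨w1', w2'⟩ := hM'.weights hP' hGL
  have ex : ∀ k, ∃ k', M'.arcOf k' = M.arcOf k ∧ ∀ s, M'.crownOf k' s = M.crownOf k s := by
    intro k
    obtain ⟨k', h1, h2, h3⟩ := w2' (M.arcOf k) (M.crownOf k false) (M.crownOf k true)
      (by rw [← w1]; exact M.arcWeight_pos k)
    exact ⟨k', h1, fun s => by cases s <;> assumption⟩
  choose f hf1 hf2 using ex
  have hinj : Function.Injective f := by
    intro k k' e
    apply hP.label_injective
    · rw [← hf1, ← hf1, e]
    · intro s; rw [← hf2, ← hf2, e]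
  have hsurj : Function.Surjective f := by
    intro k'
    obtain ⟨k, h1, h2, h3⟩ := w2 (M'.arcOf k') (M'.crownOf k' false) (M'.crownOf k' true)
      (by rw [← w1']; exact M'.arcWeight_pos k')
    refine ⟨k, hP'.label_injective ((hf1 k).trans h1) fun s => (hf2 k s).trans ?_⟩
    cases s <;> assumption
  have hbij : Function.Bijective f := ⟨hinj, hsurj⟩
  refine ⟨Equiv.ofBijective f hbij, fun k => ?_⟩
  simp only [Equiv.ofBijective_apply]
  have hw : M'.arcWeight (f k) = M.arcWeight k := by rw [w1, w1', hf1, hf2, hf2]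
  exact ⟨hf1 k, hw, fun s => ⟨hf2 k s, by rw [M.weight_eq, M'.weight_eq, hw]⟩,
    exists_act_of_label_eq (hf1 k).symm fun s => (hf2 k s).symm⟩

end SplitMatching
end

noncomputable section

namespace CrownedSurface

variable {X : CrownedSurface} {A B D : GL (Fin 3) ℝ}
  {a b a₁ b₁ a₂ b₂ x y z p q u v c c' f f' x₀ x₁ y₀ y₁ z₀ z₁ v₀ v₁ : ℂ}

/-! ### Sliding points along the boundary -/

open Classical in
/-- The point at signed distance `d` (in the coordinate) from `x` on the boundary geodesic through
`x`; it is `x` if there is no such geodesic. -/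
def push (X : CrownedSurface) (x : ℂ) (d : ℝ) : ℂ :=
  if h : ∃ p : ℂ × ℂ, X.IsEdge p.1 p.2 ∧ x ∈ openSegment ℝ p.1 p.2 then
    geo h.choose.1 h.choose.2 (coord h.choose.1 h.choose.2 x + d) else x

lemma IsEdge.push_eq (h : X.IsEdge a b) (hx : x ∈ openSegment ℝ a b) (d : ℝ) :
    X.push x d = geo a b (coord a b x + d) := by
  have hex : ∃ p : ℂ × ℂ, X.IsEdge p.1 p.2 ∧ x ∈ openSegment ℝ p.1 p.2 := ⟨(a, b), h, hx⟩
  obtain ⟨e1, e2⟩ := hex.choose_spec.1.eq_of_mem h hex.choose_spec.2 hx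
  rw [push, dif_pos hex, e1, e2]

lemma IsEdge.push_mem (h : X.IsEdge a b) (hx : x ∈ openSegment ℝ a b) (d : ℝ) :
    X.push x d ∈ openSegment ℝ a b := by
  rw [h.push_eq hx]; exact geo_mem _ _ _

lemma IsEdge.coord_push (h : X.IsEdge a b) (hx : x ∈ openSegment ℝ a b) (d : ℝ) :
    coord a b (X.push x d) = coord a b x + d := by
  rw [h.push_eq hx, h.coord_geo]

/-- Deck transformations preserve differences of coordinates. -/
lemma IsEdge.coord_act_sub (h : X.IsEdge a b) (h₁ : X.IsEdge a₁ b₁) (hA : A ∈ X.grp)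
    (hx : x ∈ openSegment ℝ a b) (hy : y ∈ openSegment ℝ a b)
    (hx' : act A x ∈ openSegment ℝ a₁ b₁) :
    coord a₁ b₁ (act A x) - coord a₁ b₁ (act A y) = coord a b x - coord a b y := by
  obtain ⟨rfl, rfl⟩ := h.act_eq h₁ hA hx hx'
  rw [h.coord_act hA hx, h.coord_act hA hy]
  ring

lemma act_push (hx : ∃ a b, X.IsEdge a b ∧ x ∈ openSegment ℝ a b) (hA : A ∈ X.grp) (d : ℝ) :
    act A (X.push x d) = X.push (act A x) d := by
  obtain ⟨a, b, h, hx⟩ := hx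
  have h' := h.map hA
  have hx' := h.act_mem hA hx
  have hp := h.act_mem hA (h.push_mem hx d)
  apply h'.coord_injective hp (h'.push_mem hx' d)
  have := h.coord_act_sub h' hA (h.push_mem hx d) hx hp
  rw [h.coord_push hx] at this
  rw [h'.coord_push hx']
  linarith

/-- The translates of a point keep a distance from each other along the boundary. -/
lemma exists_gap (hx : 0 < polar x x) (hy : ∃ a b, X.IsEdge a b ∧ y ∈ openSegment ℝ a b) :
    ∃ δ : ℝ, 0 < δ ∧ ∀ A ∈ X.grp, ∀ B ∈ X.grp, ∀ a b, X.IsEdge a b →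
      act A x ∈ openSegment ℝ a b → act B y ∈ openSegment ℝ a b →
      act A x = act B y ∨ δ ≤ |coord a b (act A x) - coord a b (act B y)| := by
  obtain ⟨a₀, b₀, h₀, hy⟩ := hy
  set T := (fun A => |coord a₀ b₀ (act A x) - coord a₀ b₀ y|) ''
    {A | A ∈ X.grp ∧ act A x ∈ openSegment ℝ a₀ b₀ ∧
      |coord a₀ b₀ (act A x)| ≤ |coord a₀ b₀ y| + 1}
  have hT : T.Finite := (h₀.finite_orbit hx _).image _
  have hop : IsOpen (T \ {0})ᶜ := (hT.subset sdiff_subset).isClosed.isOpen_compl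
  obtain ⟨δ, hδ, hball⟩ := Metric.isOpen_iff.1 hop 0 (fun h => h.2 rfl)
  refine ⟨min δ 1, lt_min hδ one_pos, fun A hA B hB a b h hAx hBy => ?_⟩
  obtain ⟨rfl, rfl⟩ := h₀.act_eq h hB hy hBy
  have hAx' : act (B⁻¹ * A) x ∈ openSegment ℝ a₀ b₀ := by
    have := h.act_mem (inv_mem hB) hAx
    rwa [act_inv_act hB h₀.polar_left.ge, act_inv_act hB h₀.polar_right.ge,
      ← act_mul_of_mem hA hx.le] at this
  have hBA : act B (act (B⁻¹ * A) x) = act A x := by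
    rw [act_mul_of_mem hA hx.le, act_act_inv hB ((X.isom A hA).polar_act_pos hx).le]
  have hsub := h₀.coord_act_sub h hB hAx' hy (by rwa [hBA])
  rw [hBA] at hsub
  rw [hsub]
  by_cases e : coord a₀ b₀ (act (B⁻¹ * A) x) = coord a₀ b₀ y
  · left
    rw [← hBA, h₀.coord_injective hAx' hy e]
  · right
    by_contra hlt
    push Not at hlt
    have h1 := hlt.trans_le (min_le_right _ _)
    have h2 := hlt.trans_le (min_le_left _ _)
    have hmem : |coord a₀ b₀ (act (B⁻¹ * A) x) - coord a₀ b₀ y| ∈ T := by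
      refine ⟨B⁻¹ * A, ⟨mul_mem (inv_mem hB) hA, hAx', ?_⟩, rfl⟩
      have := abs_sub_abs_le_abs_sub (coord a₀ b₀ (act (B⁻¹ * A) x)) (coord a₀ b₀ y)
      linarith
    refine hball (?_ : |coord a₀ b₀ (act (B⁻¹ * A) x) - coord a₀ b₀ y| ∈ _) ⟨hmem, ?_⟩
    · rwa [Metric.mem_ball, Real.dist_eq, sub_zero, abs_abs]
    · exact abs_ne_zero.2 (sub_ne_zero.2 e)

lemma exists_pos_le_of_finite {ι : Type*} [Finite ι] {f : ι → ℝ} (hf : ∀ i, 0 < f i) :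
    ∃ δ : ℝ, 0 < δ ∧ ∀ i, δ ≤ f i := by
  cases isEmpty_or_nonempty ι
  · exact ⟨1, one_pos, fun i => isEmptyElim i⟩
  · obtain ⟨i, hi⟩ := Finite.exists_min f
    exact ⟨f i, hf i, hi⟩

/-- Disjoint arcs on the surface stay disjoint when their end-points slide along the boundary
without meeting each other. -/
lemma disjoint_segment_of_slide {a b a' b' x y z v : Bool → ℂ}
    (h : ∀ s, X.IsEdge (a s) (b s)) (h' : ∀ s, X.IsEdge (a' s) (b' s))
    (n : ¬ (a false = a true ∧ b false = b true))
    (hx : ∀ s, x s ∈ openSegment ℝ (a s) (b s)) (hy : ∀ s, y s ∈ openSegment ℝ (a s) (b s))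
    (hz : ∀ s, z s ∈ openSegment ℝ (a' s) (b' s)) (hv : ∀ s, v s ∈ openSegment ℝ (a' s) (b' s))
    (hd : ∀ s r, Disjoint (segment ℝ (x s) (y s)) (segment ℝ (z r) (v r)))
    (hxz : Disjoint (segment ℝ (x false) (x true)) (segment ℝ (z false) (z true))) :
    Disjoint (segment ℝ (y false) (y true)) (segment ℝ (v false) (v true)) := by
  -- no end-point comes to lie on the moving chord, so that the sides do not change
  have hne : ∀ r, ∀ p ∈ segment ℝ (x false) (y false), ∀ q ∈ segment ℝ (x true) (y true),
      ∀ w ∈ segment ℝ (z r) (v r), cross p q w ≠ 0 := by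
    intro r p hp q hq w hw
    apply (h false).cross_chord_ne_zero (h true) (h' r) n (IsEdge.segment_subset (hx _) (hy _) hp)
      (IsEdge.segment_subset (hx _) (hy _) hq) (IsEdge.segment_subset (hz _) (hv _) hw)
    · rintro rfl; exact Set.disjoint_left.1 (hd _ _) hp hw
    · rintro rfl; exact Set.disjoint_left.1 (hd _ _) hq hw
  have hL := fun x y : ℂ => left_mem_segment ℝ x y
  have hR := fun x y : ℂ => right_mem_segment ℝ x y
  have hiff := fun r => cross_pos_iff_of_convex (convex_segment _ _) (convex_segment _ _)
    (convex_segment _ _) (hne r) (hL _ _) (hR _ _) (hL _ _) (hR _ _) (hL _ _) (hR _ _)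
  have k := (h false).mul_cross_pos_of_disjoint (h true) n (hx _) (hx _)
    ((h' false).openSegment_subset (hz _)) ((h' true).openSegment_subset (hz _))
    (hne false _ (hL _ _) _ (hL _ _) _ (hL _ _)) (hne true _ (hL _ _) _ (hL _ _) _ (hL _ _))
    (hxz.mono_right (openSegment_subset_segment ℝ _ _))
  apply disjoint_segment_of_same_side
  have n1 := hne false _ (hR _ _) _ (hR _ _) _ (hR _ _)
  have n2 := hne true _ (hR _ _) _ (hR _ _) _ (hR _ _)
  rcases lt_or_gt_of_ne n1 with g1 | g1 <;> rcases lt_or_gt_of_ne n2 with g2 | g2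
  · exact mul_pos_of_neg_of_neg g1 g2
  · exfalso
    have e1 := (hiff true).2 g2
    have e2 := fun hc => g1.not_gt ((hiff false).1 hc)
    nlinarith [mul_nonpos_of_nonpos_of_nonneg (not_lt.1 e2) e1.le]
  · exfalso
    have e1 := (hiff false).2 g1
    have e2 := fun hc => g2.not_gt ((hiff true).1 hc)
    nlinarith [mul_nonpos_of_nonneg_of_nonpos e1.le (not_lt.1 e2)]
  · exact mul_pos g1 g2

/-- The order of two tips does not depend on the point from which they are seen. -/
lemma cross_tips_nonneg (hc : polar c c = 0) (hc' : polar c' c' = 0) (hn : cross a b c < 0)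
    (hn' : cross a b c' < 0) (hp : 0 ≤ polar p p) (hp' : 0 ≤ cross a b p) (hq : 0 ≤ polar q q)
    (hq' : 0 ≤ cross a b q) (h : 0 ≤ cross p c c') : 0 ≤ cross q c c' := by
  by_cases e : c = c'
  · subst e; exact (by unfold cross; ring : cross q c c = 0).ge
  · exact ((cross_tips_pos_iff hc hc' hn hn' hp hp' hq hq').1
      (lt_of_le_of_ne h (cross_tips_ne_zero hc hc' e hn hn' hp hp').symm)).le

/-- Crown arcs that are parallel to disjoint arcs in the same order are disjoint. -/
lemma IsEdge.disjoint_ray_of_foot (h : X.IsEdge a b) (hy : y ∈ openSegment ℝ a b)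
    (hz : z ∈ openSegment ℝ a b) (hf : f ∈ openSegment ℝ a b) (hf' : f' ∈ openSegment ℝ a b)
    (hc : polar c c = 0) (hc' : polar c' c' = 0) (hn : cross a b c < 0) (hn' : cross a b c' < 0)
    (hlt : coord a b y < coord a b z) (hle : coord a b f ≤ coord a b f') 
    (hd : (f = f' ∧ c = c') ∨ Disjoint (ray f c) (ray f' c')) : Disjoint (ray y c) (ray z c') := by
  rw [h.disjoint_ray_iff hy hz hc hc' hn hn' hlt]
  rcases hd with ⟨-, rfl⟩ | hd
  · exact (by unfold cross; ring : cross y c c = 0).ge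
  · have hlt' : coord a b f < coord a b f' := by
      refine lt_of_le_of_ne hle fun e => ?_
      obtain rfl := h.coord_injective hf hf' e
      refine Set.disjoint_left.1 hd (left_mem_ray ?_) (left_mem_ray ?_)
      · rintro rfl; exact (h.polar_pos hf).ne' hc
      · rintro rfl; exact (h.polar_pos hf).ne' hc'
    exact cross_tips_nonneg hc hc' hn hn' (h.polar_pos hf).le (IsEdge.cross_eq_zero hf).ge
      (h.polar_pos hy).le (IsEdge.cross_eq_zero hy).ge
      ((h.disjoint_ray_iff hf hf' hc hc' hn hn' hlt').1 hd)

/-- Points in different intervals are separated by a basepoint, so they are in the order of their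
intervals. -/
lemma IsEdge.coord_lt_of_not_sameInterval (h : X.IsEdge a b) (hy : y ∈ openSegment ℝ a b)
    (hz : z ∈ openSegment ℝ a b) (hlt : coord a b y < coord a b z) (hyz : ¬ X.SameInterval y z)
    (hf : X.SameInterval y f) (hf' : X.SameInterval z f') : coord a b f < coord a b f' := by
  have on : ∀ {x y : ℂ}, x ∈ openSegment ℝ a b → X.SameInterval x y → y ∈ openSegment ℝ a b := by
    intro x y hx hs
    obtain ⟨a', b', h', h1, h2⟩ := hs.exists_edge
    obtain ⟨rfl, rfl⟩ := h.eq_of_mem h' hx h1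
    exact h2
  rw [h.sameInterval_iff hy hz] at hyz
  rw [h.sameInterval_iff hy (on hy hf)] at hf
  rw [h.sameInterval_iff hz (on hz hf')] at hf'
  push Not at hyz
  obtain ⟨w, hw, hwb, hm⟩ := hyz
  rw [uIcc_of_le hlt.le] at hm
  have h1 := hf w hw hwb
  have h2 := hf' w hw hwb
  rw [mem_uIcc] at h1 h2
  push Not at h1 h2
  exact (h1.1 hm.1).trans (lt_of_not_ge fun k => (h2.2 k).not_ge hm.2)

end CrownedSurface
end

noncomputable section

open CrownedSurface

variable {X : CrownedSurface} {A B : GL (Fin 3) ℝ} {a b z : ℂ}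

/-! ### The splitting given by the overlaps -/

namespace SurfaceLamination

/-- Along the boundary, the distance of two different end-points of arcs and the distance of an
end-point and a basepoint is at least `δ`. -/
structure IsGap (L : SurfaceLamination X) (δ : ℝ) : Prop where
  pos : 0 < δ
  ends : ∀ i s j r, ∀ A ∈ X.grp, ∀ B ∈ X.grp, ∀ a b, X.IsEdge a b →
    act A (L.pt i s) ∈ openSegment ℝ a b → act B (L.pt j r) ∈ openSegment ℝ a b →
    act A (L.pt i s) = act B (L.pt j r) ∨
      δ ≤ |coord a b (act A (L.pt i s)) - coord a b (act B (L.pt j r))|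
  base : ∀ i s, ∀ a b, X.IsEdge a b → L.pt i s ∈ openSegment ℝ a b → ∀ z ∈ openSegment ℝ a b,
    z ∈ X.base → δ ≤ |coord a b (L.pt i s) - coord a b z|

lemma exists_isGap (L : SurfaceLamination X) : ∃ δ, L.IsGap δ := by
  have h1 := fun e : (Fin L.n × Bool) × (Fin L.n × Bool) =>
    exists_gap (L.marked e.1.1 e.1.2).polar_pos (L.marked e.2.1 e.2.2).1
  choose f hf hf' using h1
  obtain ⟨δ₁, hδ₁, hle₁⟩ := exists_pos_le_of_finite hf
  have h2 : ∀ e : Fin L.n × Bool, ∃ δ : ℝ, 0 < δ ∧ ∀ a b, X.IsEdge a b →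
      L.pt e.1 e.2 ∈ openSegment ℝ a b → ∀ z ∈ openSegment ℝ a b, z ∈ X.base →
      δ ≤ |coord a b (L.pt e.1 e.2) - coord a b z| := by
    intro e
    obtain ⟨a, b, h, hm⟩ := (L.marked e.1 e.2).1
    obtain ⟨w, hw, hwb⟩ := X.base_nonempty _ h.mem_boundaryLines
    obtain ⟨δ, hδ, hgap⟩ := exists_gap (L.marked e.1 e.2).polar_pos ⟨a, b, h, hw⟩
    refine ⟨δ, hδ, fun a' b' h' hm' z hz hzb => ?_⟩
    obtain ⟨rfl, rfl⟩ := h.eq_of_mem h' hm hm'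
    obtain ⟨A, hA, rfl⟩ := X.base_unique _ h.mem_boundaryLines w ⟨hw, hwb⟩ z ⟨hz, hzb⟩
    rcases hgap 1 (one_mem _) A hA a b h (by rwa [act_one]) hz with e1 | e1
    · rw [act_one] at e1
      exact absurd (e1 ▸ hzb) (L.pt_not_base _ _)
    · rwa [act_one] at e1
  choose g hg hg' using h2
  obtain ⟨δ₂, hδ₂, hle₂⟩ := exists_pos_le_of_finite hg
  refine ⟨min δ₁ δ₂, lt_min hδ₁ hδ₂, fun i s j r A hA B hB a b h h1 h2 => ?_,
    fun i s a b h hm z hz hzb => ?_⟩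
  · exact (hf' ((i, s), (j, r)) A hA B hB a b h h1 h2).imp_right
      ((min_le_left _ _).trans (hle₁ _)).trans
  · exact ((min_le_right _ _).trans (hle₂ _)).trans (hg' (i, s) a b h hm z hz hzb)

lemma IsGap.sameInterval_push {L : SurfaceLamination X} {δ d : ℝ} (hδ : L.IsGap δ) (i : Fin L.n)
    (s : Bool) (hd : 0 < d) (hd' : d < δ / 2) : X.SameInterval (X.push (L.pt i s) d) (L.pt i s) := by
  obtain ⟨⟨a, b, h, hm⟩, -⟩ := L.marked i s
  have hp := h.push_mem hm d
  have hc := h.coord_push hm d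
  rw [h.sameInterval_iff hp hm]
  intro z hz hzb hu
  have h1 := hδ.base _ s a b h hm z hz hzb
  rw [hc, uIcc_of_ge (by linarith)] at hu
  rw [abs_of_nonpos (by linarith [hu.1])] at h1
  linarith [hu.2, hδ.pos]

end SurfaceLamination

namespace SplitMatching

variable {G : CrownLamination X} {L : SurfaceLamination X} {M : SplitMatching G L} {δ ε : ℝ}
  {w : Fin M.n → Bool → ℝ}

/-- The boundary geodesics crossed by a lift of a strand. -/
lemma exists_edges (M : SplitMatching G L) (hA : A ∈ X.grp) (k : Fin M.n) :
    ∃ a b : Bool → ℂ, (∀ s, X.IsEdge (a s) (b s)) ∧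
      (∀ s, act A (M.pt k s) ∈ openSegment ℝ (a s) (b s)) ∧
      ¬ (a false = a true ∧ b false = b true) ∧ ∀ s, cross (a s) (b s) (act A (M.tip k s)) < 0 := by
  choose a b h hm using fun s => ((M.marked k s).act hA).1
  refine ⟨a, b, h, hm, fun hab => M.not_sameLine k false ?_,
    fun s => ((M.crown_arc k s).act hA).cross_neg (h s) (hm s)⟩
  have h1 := hm true
  rw [← hab.1, ← hab.2] at h1
  have := ((h false).sameLine (hm false) h1).act (inv_mem hA)
  rwa [act_inv_act hA (M.polar_pt _ _).le, act_inv_act hA (M.polar_pt _ _).le] at this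

/-- The splitting is the one read off from the overlaps: the copies of an end-point of an arc are
obtained by replacing it by a short interval of length proportional to the weight of the arc, the
end `s` of the `k`-th copy being at the position `w k s` in this interval, and a copy is matched with
the crown arc in whose strip it lies. -/
structure IsOverlapSplitting (M : SplitMatching G L) (δ ε : ℝ) (w : Fin M.n → Bool → ℝ) : Prop where
  gap : L.IsGap δ
  scale_pos : 0 < ε
  pt_eq : ∀ k s, M.pt k s = X.push (L.pt (M.arcOf k) s) (ε * w k s)
  pos : ∀ k s, 0 < w k s
  small : ∀ k s, ε * w k s < δ / 2
  add_eq : ∀ k, w k false + w k true = L.weight (M.arcOf k)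
  mem_strip : ∀ k s, L.points.lower (M.arcOf k, s) + w k s ∈ G.points.strip (M.crownOf k s)
  label_injective : ∀ k k', M.arcOf k = M.arcOf k' → (∀ s, M.crownOf k s = M.crownOf k' s) → k = k'

namespace IsOverlapSplitting

lemma mem_openSegment (hM : M.IsOverlapSplitting δ ε w) (hA : A ∈ X.grp) (h : X.IsEdge a b)
    {k : Fin M.n} {s : Bool} (hm : act A (M.pt k s) ∈ openSegment ℝ a b) :
    act A (L.pt (M.arcOf k) s) ∈ openSegment ℝ a b ∧
      coord a b (act A (M.pt k s)) = coord a b (act A (L.pt (M.arcOf k) s)) + ε * w k s := by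
  obtain ⟨⟨a', b', h', hm'⟩, -⟩ := (L.marked (M.arcOf k) s).act hA
  rw [hM.pt_eq, act_push (L.marked _ _).1 hA] at hm ⊢
  obtain ⟨rfl, rfl⟩ := h'.eq_of_mem h (h'.push_mem hm' _) hm
  exact ⟨hm', h.coord_push hm' _⟩

lemma sameInterval (hM : M.IsOverlapSplitting δ ε w) (k : Fin M.n) (s : Bool) :
    X.SameInterval (M.pt k s) (L.pt (M.arcOf k) s) := by
  rw [hM.pt_eq]
  exact hM.gap.sameInterval_push _ s (mul_pos hM.scale_pos (hM.pos k s)) (hM.small k s)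

/-- The order of the copies determines the order of the end-points of the original arcs. -/
lemma order (hM : M.IsOverlapSplitting δ ε w) (hA : A ∈ X.grp) (hB : B ∈ X.grp) (h : X.IsEdge a b)
    {k k' : Fin M.n} {s s' : Bool} (hm : act A (M.pt k s) ∈ openSegment ℝ a b)
    (hm' : act B (M.pt k' s') ∈ openSegment ℝ a b)
    (hle : coord a b (act A (M.pt k s)) ≤ coord a b (act B (M.pt k' s'))) :
    (M.arcOf k = M.arcOf k' ∧ s = s' ∧ A = B ∧ w k s ≤ w k' s') ∨
      coord a b (act A (L.pt (M.arcOf k) s)) < coord a b (act B (L.pt (M.arcOf k') s')) := by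
  obtain ⟨g1, e1⟩ := hM.mem_openSegment hA h hm
  obtain ⟨g2, e2⟩ := hM.mem_openSegment hB h hm'
  rw [e1, e2] at hle
  rcases hM.gap.ends _ s _ s' A hA B hB a b h g1 g2 with e | hg
  · left
    obtain ⟨f1, f2, f3⟩ := L.act_pt_injective hA hB e
    rw [e] at hle
    exact ⟨f1, f2, f3, le_of_mul_le_mul_left (by linarith) hM.scale_pos⟩
  · right
    by_contra hc
    push Not at hc
    rw [abs_of_nonneg (by linarith)] at hg
    have h1 := hM.small k' s'
    have h3 := mul_pos hM.scale_pos (hM.pos k s)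
    linarith [hM.gap.pos]

lemma eq_of_label (hM : M.IsOverlapSplitting δ ε w) {k k' : Fin M.n} {s : Bool}
    (h : M.arcOf k = M.arcOf k') (hw : w k s = w k' s) : k = k' := by
  have hw' : ∀ r, w k r = w k' r := by
    have h1 := hM.add_eq k
    rw [h, ← hM.add_eq k'] at h1
    cases s <;> rintro (_ | _) <;> linarith
  refine hM.label_injective k k' h fun r => ?_
  have h1 := hM.mem_strip k r
  have h2 := hM.mem_strip k' r
  rw [← h, ← hw'] at h2
  exact G.points.eq_of_mem_strip
    (((M.cls_pt' k r).symm.trans ((M.cls_pt k r).trans (h ▸ (M.cls_pt k' r).symm))).trans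
      (M.cls_pt' k' r)) h1 h2

/-- Different crossings of strands (up to deck transformations) are different points. -/
lemma act_pt_injective (hM : M.IsOverlapSplitting δ ε w) (hA : A ∈ X.grp) (hB : B ∈ X.grp)
    {k k' : Fin M.n} {s s' : Bool} (e : act A (M.pt k s) = act B (M.pt k' s')) :
    k = k' ∧ s = s' ∧ A = B := by
  obtain ⟨⟨a, b, h, hm⟩, -⟩ := (M.marked k s).act hA
  have hm' := hm
  rw [e] at hm'
  rcases hM.order hA hB h hm hm' (by rw [e]) with ⟨h1, h2, h3, h4⟩ | h1
  · rcases hM.order hB hA h hm' hm (by rw [e]) with ⟨-, -, -, h5⟩ | h5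
    · subst h2
      exact ⟨hM.eq_of_label h1 (le_antisymm h4 h5), rfl, h3⟩
    · subst h2 h3
      rw [h1] at h5
      exact absurd h5 (lt_irrefl _)
  · rcases hM.order hB hA h hm' hm (by rw [e]) with ⟨h2, h3, h4, -⟩ | h5
    · subst h3 h4
      rw [h2] at h1
      exact absurd h1 (lt_irrefl _)
    · exact absurd h1 h5.not_gt

/-- The crown arcs matched with the copies are in the order of the copies. -/
lemma pos_crown_le (hM : M.IsOverlapSplitting δ ε w) (hA : A ∈ X.grp) (hB : B ∈ X.grp)
    (h : X.IsEdge a b) {k k' : Fin M.n} {s s' : Bool} (hm : act A (M.pt k s) ∈ openSegment ℝ a b)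
    (hm' : act B (M.pt k' s') ∈ openSegment ℝ a b)
    (hle : coord a b (act A (M.pt k s)) ≤ coord a b (act B (M.pt k' s')))
    (hS : X.SameInterval (act A (M.pt k s)) (act B (M.pt k' s'))) :
    X.pos (G.foot (M.crownOf k s)) ≤ X.pos (G.foot (M.crownOf k' s')) := by
  have hcls : X.cls (M.pt k s) = X.cls (M.pt k' s') := by
    rw [← (M.marked k s).cls_act hA, hS.cls_eq, (M.marked k' s').cls_act hB]
  refine G.points.pos_le_of_mem_strip (s := M.crownOf k s) (t := M.crownOf k' s') ?_
    (hM.mem_strip k s) (hM.mem_strip k' s') ?_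
  · exact (M.cls_pt' k s).symm.trans (hcls.trans (M.cls_pt' k' s'))
  rcases hM.order hA hB h hm hm' hle with ⟨h1, rfl, -, h2⟩ | h1
  · rw [h1]; linarith
  · have hSL : X.SameInterval (act A (L.pt (M.arcOf k) s)) (act B (L.pt (M.arcOf k') s')) :=
      (((hM.sameInterval k s).act hA).symm.trans hS).trans ((hM.sameInterval k' s').act hB)
    rw [← hSL.pos_lt_iff h (hM.mem_openSegment hA h hm).1 (hM.mem_openSegment hB h hm').1,
      (L.marked _ _).pos_act hA, (L.marked _ _).pos_act hB] at h1
    have h2 := L.points.lower_add_le_lower (s := (M.arcOf k, s)) (t := (M.arcOf k', s'))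
      ((M.cls_pt k s).symm.trans (hcls.trans (M.cls_pt k' s'))) h1
    have h3 : w k s ≤ L.weight (M.arcOf k) := by
      have := hM.add_eq k
      have h4 := hM.pos k (!s)
      cases s <;> simp only [Bool.not_true, Bool.not_false] at h4 <;> linarith
    have h5 : L.points.wt (M.arcOf k, s) = L.weight (M.arcOf k) := rfl
    have := hM.pos k' s'
    linarith

/-- The crown arcs of the splitting are disjoint: on one boundary geodesic their end-points are
ordered as the feet of the original crown arcs, which are disjoint. -/
lemma disjoint_ray (hM : M.IsOverlapSplitting δ ε w) (hA : A ∈ X.grp) (hB : B ∈ X.grp)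
    {k k' : Fin M.n} {s s' : Bool} (hne : ¬ (k = k' ∧ s = s' ∧ A = B)) :
    Disjoint (ray (act A (M.pt k s)) (act A (M.tip k s)))
      (ray (act B (M.pt k' s')) (act B (M.tip k' s'))) := by
  -- the lift of the original crown arc next to a lift of its copy
  have hlift : ∀ {A k s}, A ∈ X.grp → ∃ C ∈ X.grp,
      X.SameInterval (act A (M.pt k s)) (act C (G.foot (M.crownOf k s))) ∧
      act A (M.tip k s) = act C (G.tip (M.crownOf k s)) := by
    intro A k s hA
    obtain ⟨C, hC, h1, h2⟩ := M.crown_copy k s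
    have hp := (M.marked k s).polar_pos.le
    have ht := (M.crown_arc k s).polar_tip.ge
    refine ⟨A * C⁻¹, mul_mem hA (inv_mem hC), ?_, ?_⟩
    · have := (h2.act (inv_mem hC)).act hA
      rwa [act_inv_act hC hp, ← act_mul_of_mem (inv_mem hC) h2.symm.polar_pos.le] at this
    · rw [act_mul_of_mem (inv_mem hC) (G.isArc _).polar_tip.ge, ← h1, act_inv_act hC ht]
  have c1 := (M.crown_arc k s).act hA
  have c2 := (M.crown_arc k' s').act hB
  obtain ⟨⟨a, b, h, hm⟩, -⟩ := (M.marked k s).act hA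
  obtain ⟨⟨a', b', h', hm'⟩, -⟩ := (M.marked k' s').act hB
  have n1 := c1.cross_neg h hm
  have n2 := c2.cross_neg h' hm'
  by_cases hab : a = a' ∧ b = b'
  swap
  · exact h.disjoint_ray_of_ne h' hab hm hm' c1.polar_tip c2.polar_tip n1 n2
  obtain ⟨rfl, rfl⟩ := hab
  obtain ⟨C, hC, hCs, hCt⟩ := hlift (k := k) (s := s) hA
  obtain ⟨C', hC', hCs', hCt'⟩ := hlift (k := k') (s := s') hB
  have on : ∀ {x y : ℂ}, x ∈ openSegment ℝ a b → X.SameInterval x y → y ∈ openSegment ℝ a b := by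
    intro x y hx hs
    obtain ⟨a', b', h', h1, h2⟩ := hs.exists_edge
    obtain ⟨rfl, rfl⟩ := h.eq_of_mem h' hx h1
    exact h2
  have hf := on hm hCs
  have hf' := on hm' hCs'
  have key : ∀ {A B k k' s s' C C'}, A ∈ X.grp → B ∈ X.grp → C ∈ X.grp → C' ∈ X.grp →
      act A (M.pt k s) ∈ openSegment ℝ a b → act B (M.pt k' s') ∈ openSegment ℝ a b →
      X.SameInterval (act A (M.pt k s)) (act C (G.foot (M.crownOf k s))) →
      X.SameInterval (act B (M.pt k' s')) (act C' (G.foot (M.crownOf k' s'))) →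
      coord a b (act A (M.pt k s)) < coord a b (act B (M.pt k' s')) →
      coord a b (act C (G.foot (M.crownOf k s))) ≤
        coord a b (act C' (G.foot (M.crownOf k' s'))) := by
    intro A B k k' s s' C C' hA hB hC hC' hm hm' hCs hCs' hlt
    by_cases hS : X.SameInterval (act A (M.pt k s)) (act B (M.pt k' s'))
    · have hSf := (hCs.symm.trans hS).trans hCs'
      have h1 := hM.pos_crown_le hA hB h hm hm' hlt.le hS
      rw [← (G.marked _).pos_act hC, ← (G.marked (M.crownOf k' s')).pos_act hC'] at h1
      have h2 := hSf.pos_sub h (on hm hCs) (on hm' hCs')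
      linarith
    · exact (h.coord_lt_of_not_sameInterval hm hm' hlt hS hCs hCs').le
  have hdG : ∀ {g g' C C'}, C ∈ X.grp → C' ∈ X.grp →
      (act C (G.foot g) = act C' (G.foot g') ∧ act C (G.tip g) = act C' (G.tip g')) ∨
      Disjoint (ray (act C (G.foot g)) (act C (G.tip g)))
        (ray (act C' (G.foot g')) (act C' (G.tip g'))) := by
    intro g g' C C' hC hC'
    rcases G.disjoint_ray hC hC' g g' with ⟨rfl, rfl⟩ | hd
    · exact Or.inl ⟨rfl, rfl⟩
    · exact Or.inr hd
  rcases lt_trichotomy (coord a b (act A (M.pt k s))) (coord a b (act B (M.pt k' s'))) with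
    hlt | heq | hlt
  · exact h.disjoint_ray_of_foot hm hm' hf hf' c1.polar_tip c2.polar_tip n1 n2 hlt
      (key hA hB hC hC' hm hm' hCs hCs' hlt) (by rw [hCt, hCt']; exact hdG hC hC')
  · exact absurd (hM.act_pt_injective hA hB (h.coord_injective hm hm' heq)) hne
  · exact (h.disjoint_ray_of_foot hm' hm hf' hf c2.polar_tip c1.polar_tip n2 n1 hlt
      (key hB hA hC' hC hm' hm hCs' hCs hlt) (by rw [hCt, hCt']; exact hdG hC' hC)).symm

lemma disjoint_segment (hM : M.IsOverlapSplitting δ ε w) (hA : A ∈ X.grp) (hB : B ∈ X.grp)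
    {k k' : Fin M.n} (hne : ¬ (k = k' ∧ A = B)) :
    Disjoint (segment ℝ (act A (M.pt k false)) (act A (M.pt k true)))
      (segment ℝ (act B (M.pt k' false)) (act B (M.pt k' true))) := by
  obtain ⟨a, b, h, hm, n, -⟩ := M.exists_edges hA k
  obtain ⟨a', b', h', hm', n', -⟩ := M.exists_edges hB k'
  by_cases hsame : M.arcOf k = M.arcOf k' ∧ A = B
  · -- copies of one arc are in opposite orders at the two ends
    obtain ⟨hk, rfl⟩ := hsame
    have hkk : k ≠ k' := fun e => hne ⟨e, rfl⟩
    have hab : ∀ s, a' s = a s ∧ b' s = b s := by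
      intro s
      have h1 := (hM.mem_openSegment hA (h s) (hm s)).1
      rw [hk] at h1
      exact (h' s).eq_of_mem (h s) (hM.mem_openSegment hA (h' s) (hm' s)).1 h1
    have hm'' : ∀ s, act A (M.pt k' s) ∈ openSegment ℝ (a s) (b s) := by
      intro s; rw [← (hab s).1, ← (hab s).2]; exact hm' s
    have hlt_iff : ∀ s, coord (a s) (b s) (act A (M.pt k s)) < coord (a s) (b s) (act A (M.pt k' s)) ↔
        w k s < w k' s := by
      intro s
      rw [(hM.mem_openSegment hA (h s) (hm s)).2, (hM.mem_openSegment hA (h s) (hm'' s)).2, hk,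
        add_lt_add_iff_left, mul_lt_mul_iff_right₀ hM.scale_pos]
    have hlt_iff' : ∀ s, coord (a s) (b s) (act A (M.pt k' s)) < coord (a s) (b s) (act A (M.pt k s)) ↔
        w k' s < w k s := by
      intro s
      rw [(hM.mem_openSegment hA (h s) (hm s)).2, (hM.mem_openSegment hA (h s) (hm'' s)).2, hk,
        add_lt_add_iff_left, mul_lt_mul_iff_right₀ hM.scale_pos]
    have hsum := hM.add_eq k
    rw [hk, ← hM.add_eq k'] at hsum
    rcases lt_trichotomy (w k false) (w k' false) with hw | hw | hw
    · exact ((h false).disjoint_iff_reversed (h true) n (hm _) (hm'' _) (hm _) (hm'' _)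
        ((hlt_iff false).2 hw)).2 ((hlt_iff' true).2 (by linarith))
    · exact absurd (hM.eq_of_label hk hw) hkk
    · exact (((h false).disjoint_iff_reversed (h true) n (hm'' _) (hm _) (hm'' _) (hm _)
        ((hlt_iff' false).2 hw)).2 ((hlt_iff true).2 (by linarith))).symm
  · -- copies of different arcs are obtained by slides smaller than the gap
    have hL : Disjoint (segment ℝ (act A (L.pt (M.arcOf k) false)) (act A (L.pt (M.arcOf k) true)))
        (segment ℝ (act B (L.pt (M.arcOf k') false)) (act B (L.pt (M.arcOf k') true))) :=
      (L.disjoint_segment hA hB (M.arcOf k) (M.arcOf k') false false).resolve_left hsame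
    have hx := fun s => hM.mem_openSegment hA (h s) (hm s)
    have hz := fun s => hM.mem_openSegment hB (h' s) (hm' s)
    refine disjoint_segment_of_slide (x := fun s => act A (L.pt (M.arcOf k) s))
      (y := fun s => act A (M.pt k s)) (z := fun s => act B (L.pt (M.arcOf k') s))
      (v := fun s => act B (M.pt k' s)) h h' n (fun s => (hx s).1) hm (fun s => (hz s).1) hm' ?_ hL
    intro s r
    rw [Set.disjoint_left]
    intro p hp hp'
    have hpm := IsEdge.segment_subset (hx s).1 (hm s) hp
    obtain ⟨e1, e2⟩ := (h s).eq_of_mem (h' r) hpm (IsEdge.segment_subset (hz r).1 (hm' r) hp')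
    have hxs := hx s
    have hms := hm s
    rw [e1, e2] at hxs hms
    have p1 := mul_pos hM.scale_pos (hM.pos k s)
    have p2 := mul_pos hM.scale_pos (hM.pos k' r)
    have g1 := (h' r).coord_of_mem_segment hxs.1 hms hp (by rw [hxs.2]; linarith)
    have g2 := (h' r).coord_of_mem_segment (hz r).1 (hm' r) hp' (by rw [(hz r).2]; linarith)
    rw [hxs.2] at g1
    rw [(hz r).2] at g2
    rcases hM.gap.ends _ s _ r A hA B hB _ _ (h' r) hxs.1 (hz r).1 with e | hg
    · obtain ⟨f1, -, f3⟩ := L.act_pt_injective hA hB e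
      exact hsame ⟨f1, f3⟩
    · have s1 := hM.small k s
      have s2 := hM.small k' r
      rcases abs_cases (coord (a' r) (b' r) (act A (L.pt (M.arcOf k) s)) -
        coord (a' r) (b' r) (act B (L.pt (M.arcOf k') r))) with ⟨e, -⟩ | ⟨e, -⟩ <;>
        rw [e] at hg <;> linarith [g1.1, g1.2, g2.1, g2.2, hM.gap.pos]

lemma disjoint_segment_ray (hM : M.IsOverlapSplitting δ ε w) (hA : A ∈ X.grp) (hB : B ∈ X.grp)
    {k k' : Fin M.n} {s : Bool} (hne : ¬ (k = k' ∧ A = B)) :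
    Disjoint (segment ℝ (act A (M.pt k false)) (act A (M.pt k true)))
      (ray (act B (M.pt k' s)) (act B (M.tip k' s))) := by
  obtain ⟨a₁, b₁, h₁, hm₁, n, -⟩ := M.exists_edges hA k
  obtain ⟨⟨a, b, h, hm⟩, -⟩ := (M.marked k' s).act hB
  refine (h₁ false).disjoint_segment_ray (h₁ true) h n (hm₁ _) (hm₁ _) hm ?_ ?_
    (((M.crown_arc k' s).act hB).cross_neg h hm)
  · intro e
    obtain ⟨rfl, -, rfl⟩ := hM.act_pt_injective hB hA e
    exact hne ⟨rfl, rfl⟩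
  · intro e
    obtain ⟨rfl, -, rfl⟩ := hM.act_pt_injective hB hA e
    exact hne ⟨rfl, rfl⟩

lemma pairwiseDisjoint (hM : M.IsOverlapSplitting δ ε w) : M.PairwiseDisjoint := by
  intro j k A hA
  by_cases hjk : j = k ∧ A = 1
  · exact Or.inl hjk
  right
  have hne : ¬ (j = k ∧ 1 = A) := fun e => hjk ⟨e.1, e.2.symm⟩
  have hne' : ¬ (k = j ∧ A = 1) := fun e => hjk ⟨e.1.symm, e.2⟩
  have hss := hM.disjoint_segment (one_mem _) hA hne
  have hsr := fun s => hM.disjoint_segment_ray (s := s) (one_mem _) hA hne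
  have hrs := fun s => (hM.disjoint_segment_ray (s := s) hA (one_mem _) hne').symm
  have hrr := fun s s' => hM.disjoint_ray (k := j) (k' := k) (s := s) (s' := s') (one_mem _) hA
    fun e => hne ⟨e.1, e.2.2⟩
  simp only [act_one] at hss hsr hrs hrr
  simp only [strandTrace, disjoint_union_left, disjoint_union_right]
  exact ⟨⟨⟨⟨hss, hrs _⟩, hrs _⟩, ⟨hsr _, hrr _ _⟩, hrr _ _⟩, ⟨hsr _, hrr _ _⟩, hrr _ _⟩

end IsOverlapSplitting

/-- Strands with different labels are not properly homotopic. -/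
lemma noParallel_of_label_injective
    (h : ∀ k k', M.arcOf k = M.arcOf k' → (∀ s, M.crownOf k s = M.crownOf k' s) → k = k') :
    M.NoParallel := by
  rintro k k' hne ⟨f, ⟨A, hA, hAs⟩, hcrown⟩
  -- the arcs on the surface are copies of homotopic arcs
  obtain ⟨C, hC, hCs⟩ := M.surface_copy k
  obtain ⟨C', hC', hCs'⟩ := M.surface_copy k'
  set D := C' * (A * C⁻¹) with hDdef
  have hACg := mul_mem hA (inv_mem hC)
  have hD : D ∈ X.grp := mul_mem hC' hACg
  have hDs : ∀ s, X.SameLine (act D (L.pt (M.arcOf k) s)) (L.pt (M.arcOf k') (xor s f)) := by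
    intro s
    have hpL := (L.marked (M.arcOf k) s).polar_pos.le
    have h1 := ((((hCs s).sameLine.symm.act (inv_mem hC)).act hA).act hC')
    rw [act_inv_act hC (M.polar_pt k s).le, ← act_mul_of_mem (inv_mem hC) hpL,
      ← act_mul_of_mem hACg hpL] at h1
    exact (h1.trans ((hAs s).act hC')).trans (hCs' _).sameLine
  have harc : M.arcOf k = M.arcOf k' := by
    by_contra hc
    exact L.not_homotopic _ _ hc f ⟨D, hD, hDs⟩
  have hf : f = false := by
    by_contra hft
    rw [Bool.not_eq_false] at hft
    subst hft
    rw [← harc] at hDs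
    obtain ⟨a, b, h, h1, h2⟩ := (hDs false).exists_edge
    obtain ⟨a', b', h', h3, h4⟩ := (hDs true).exists_edge
    simp only [Bool.xor_true, Bool.not_false, Bool.not_true] at h2 h4
    obtain ⟨e1, e2⟩ := h.act_eq h' hD h2 h3
    obtain ⟨e3, e4⟩ := h'.act_eq h hD h4 h1
    refine h.not_swap h' ?_ hD e1 e2 e3 e4
    rintro ⟨rfl, rfl⟩
    exact L.not_sameLine _ false (h.sameLine h4 h2)
  subst hf
  refine hne (h k k' harc fun s => ?_)
  by_contra hc
  obtain ⟨B, hB, hBt, hBs⟩ := hcrown s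
  rw [Bool.xor_false] at hBt hBs
  obtain ⟨E, hE, hEt, hEs⟩ := M.crown_copy k s
  obtain ⟨E', hE', hEt', hEs'⟩ := M.crown_copy k' s
  have hBE := mul_mem hB (inv_mem hE)
  refine G.not_homotopic _ _ hc ⟨E' * (B * E⁻¹), mul_mem hE' hBE, ?_, ?_⟩
  · have hp := (G.isArc (M.crownOf k s)).polar_tip.ge
    rw [act_mul_of_mem hBE hp, act_mul_of_mem (inv_mem hE) hp, ← hEt,
      act_inv_act hE (M.crown_arc k s).polar_tip.ge, hBt, hEt']
  · have hp := (G.marked (M.crownOf k s)).polar_pos.le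
    have h1 := ((hEs.symm.act (inv_mem hE)).act hB).act hE'
    rw [act_inv_act hE (M.polar_pt k s).le, ← act_mul_of_mem (inv_mem hE) hp,
      ← act_mul_of_mem hBE hp] at h1
    exact (h1.trans (hBs.act hE')).trans hEs'

end SplitMatching

/-- There is a splitting with disjoint strands, no two of them parallel. -/
lemma exists_splitMatching (G : CrownLamination X) (L : SurfaceLamination X)
    (hGL : ∀ β ∈ boundaryLines X.grp, G.boundaryMeasure β = L.boundaryMeasure β) :
    ∃ M : SplitMatching G L, M.PairwiseDisjoint ∧ M.NoParallel := by
  classical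
  obtain ⟨δ, hδ⟩ := L.exists_isGap
  set W : Fin L.n → Fin G.n → Fin G.n → ℝ := fun i g h =>
    volume.real (overlap L.points G.points L.weight i g h) with hW
  -- the labels with positive weight
  let K := {l : Fin L.n × Fin G.n × Fin G.n // 0 < W l.1 l.2.1 l.2.2}
  let eK : Fin (Fintype.card K) ≃ K := (Fintype.equivFin K).symm
  have hne : ∀ l : K, ∃ t, t ∈ overlap L.points G.points L.weight l.1.1 l.1.2.1 l.1.2.2 := by
    intro l
    by_contra hc
    push Not at hc
    have h0 : 0 < volume.real (overlap L.points G.points L.weight l.1.1 l.1.2.1 l.1.2.2) := l.2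
    simp only [Set.eq_empty_of_forall_notMem hc, measureReal_empty, lt_self_iff_false] at h0
  choose t ht using hne
  obtain ⟨C, hC⟩ : ∃ C : ℝ, ∀ i, L.weight i ≤ C :=
    ⟨∑ i, L.weight i, fun i => Finset.single_le_sum (f := L.weight)
      (fun j _ => (L.weight_pos j).le) (Finset.mem_univ i)⟩
  set ε := δ / (2 * (|C| + 1)) with hε
  have hC1 : 0 < |C| + 1 := by positivity
  have hεpos : 0 < ε := div_pos hδ.pos (by positivity)
  let arc : Fin (Fintype.card K) → Fin L.n := fun k => (eK k).1.1
  let crown : Fin (Fintype.card K) → Bool → Fin G.n := fun k s =>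
    bif s then (eK k).1.2.2 else (eK k).1.2.1
  let w : Fin (Fintype.card K) → Bool → ℝ := fun k s =>
    bif s then L.weight (arc k) - t (eK k) else t (eK k)
  have hadd : ∀ k, w k false + w k true = L.weight (arc k) := by
    intro k; simp only [w, cond_false, cond_true]; ring
  have hwpos : ∀ k s, 0 < w k s := by
    intro k s
    have := (ht (eK k)).1
    cases s
    · exact this.1
    · exact sub_pos.2 this.2
  have hsmall : ∀ k s, ε * w k s < δ / 2 := by
    intro k s
    have h1 : w k s < |C| + 1 := by
      have h2 := hadd k
      have h3 := hwpos k (!s)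
      have h4 := (hC (arc k)).trans (le_abs_self C)
      cases s <;> simp only [Bool.not_true, Bool.not_false] at h3 <;> linarith
    calc ε * w k s < ε * (|C| + 1) := by gcongr
      _ = δ / 2 := by rw [hε]; field_simp
  have hstrip : ∀ k s, G.points.comp (crown k s) = L.points.comp (arc k, s) ∧
      L.points.lower (arc k, s) + w k s ∈ G.points.strip (crown k s) := by
    intro k s
    cases s
    · exact (ht (eK k)).2.1
    · have := (ht (eK k)).2.2
      rw [add_sub_assoc] at this
      exact this
  let pt : Fin (Fintype.card K) → Bool → ℂ := fun k s => X.push (L.pt (arc k) s) (ε * w k s)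
  have hpt : ∀ k s, X.SameInterval (pt k s) (L.pt (arc k) s) := fun k s =>
    hδ.sameInterval_push _ s (mul_pos hεpos (hwpos k s)) (hsmall k s)
  have hlift : ∀ k s, ∃ A ∈ X.grp, X.SameInterval (act A (pt k s)) (G.foot (crown k s)) := by
    intro k s
    refine ((hpt k s).marked.cls_eq_iff (G.marked _)).1 ?_
    rw [(hpt k s).cls_eq]
    exact (hstrip k s).1.symm
  choose A hA hAs using hlift
  have hwt : ∀ e, L.points.wt e = L.weight e.1 := fun _ => rfl
  have hT : ∀ e, G.points.total (L.points.comp e) = L.points.total (L.points.comp e) :=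
    fun e => total_eq_total hGL (L.marked e.1 e.2)
  have hT' : ∀ g, G.points.total (G.points.comp g) = L.points.total (G.points.comp g) :=
    fun g => total_eq_total hGL (G.marked g)
  -- sums over the strands are sums over all labels
  have hsumK : ∀ F : Fin L.n → Fin G.n → Fin G.n → ℝ, (∀ i g h, W i g h = 0 → F i g h = 0) →
      ∑ k, F (arc k) (crown k false) (crown k true) = ∑ i, ∑ g, ∑ h, F i g h := by
    intro F hF
    have h1 : ∑ k, F (arc k) (crown k false) (crown k true) = 
        ∑ l : K, F l.1.1 l.1.2.1 l.1.2.2 :=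
      Equiv.sum_comp eK (fun l : K => F l.1.1 l.1.2.1 l.1.2.2)
    rw [h1]
    have h2 : ∑ i, ∑ g, ∑ h, F i g h = ∑ l : Fin L.n × Fin G.n × Fin G.n, F l.1 l.2.1 l.2.2 := by
      rw [Fintype.sum_prod_type]
      exact Finset.sum_congr rfl fun i _ =>
        (Fintype.sum_prod_type fun q : Fin G.n × Fin G.n => F i q.1 q.2).symm
    rw [h2]
    have h3 := Finset.sum_subtype_eq_sum_filter (s := Finset.univ)
      (f := fun l : Fin L.n × Fin G.n × Fin G.n => F l.1 l.2.1 l.2.2)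
      (p := fun l => 0 < W l.1 l.2.1 l.2.2)
    have h4 : ∑ l : K, F l.1.1 l.1.2.1 l.1.2.2 =
        ∑ l ∈ Finset.univ.filter (fun l : Fin L.n × Fin G.n × Fin G.n => 0 < W l.1 l.2.1 l.2.2),
          F l.1 l.2.1 l.2.2 := by
      rw [← h3]
      apply Finset.sum_congr _ fun _ _ => rfl
      ext; simp
    rw [h4]
    apply Finset.sum_subset (Finset.subset_univ _)
    intro l _ hl
    rw [Finset.mem_filter_univ] at hl
    exact hF _ _ _ (le_antisymm (not_lt.1 hl) measureReal_nonneg)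
  let M : SplitMatching G L :=
    { n := Fintype.card K
      pt := pt
      tip := fun k s => act (A k s)⁻¹ (G.tip (crown k s))
      arcWeight := fun k => W (arc k) (crown k false) (crown k true)
      crownWeight := fun k _ => W (arc k) (crown k false) (crown k true)
      arcOf := arc
      crownOf := crown
      arcWeight_pos := fun k => (eK k).2
      crownWeight_pos := fun k _ => (eK k).2
      weight_eq := fun _ _ => rfl
      surface_copy := fun k => ⟨1, one_mem _, fun s => by rw [act_one]; exact hpt k s⟩
      crown_arc := by
        intro k s
        refine ((G.isArc (crown k s)).act (inv_mem (hA k s))).of_sameLine ?_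
        have := (hAs k s).sameLine.symm.act (inv_mem (hA k s))
        rwa [act_inv_act (hA k s) (hpt k s).polar_pos.le] at this
      crown_copy := by
        intro k s
        exact ⟨A k s, hA k s, act_act_inv (hA k s) (G.isArc _).polar_tip.ge, hAs k s⟩
      surface_sum := by
        intro i
        rw [hsumK (fun i' g h => if i' = i then W i' g h else 0)
          (fun i' g h h0 => by rw [h0, ite_self])]
        rw [Finset.sum_eq_single i]
        · simp only [if_true]
          exact sum_overlap hwt hT i
        · intro j _ hj
          simp [hj]
        · intro hi; exact absurd (Finset.mem_univ i) hi
      crown_sum := by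
        intro g₀
        simp only [Fintype.sum_bool]
        rw [hsumK (fun i g h => (if h = g₀ then W i g h else 0) + (if g = g₀ then W i g h else 0))
          (fun i' g h h0 => by rw [h0, ite_self, ite_self, add_zero])]
        refine Eq.trans ?_ (sum_overlap_crown hwt hT hT' g₀)
        apply Finset.sum_congr rfl
        intro i _
        simp only [Finset.sum_add_distrib, Finset.sum_ite_eq', Finset.mem_univ, if_true]
        rw [add_comm]
        congr 1
        rw [Finset.sum_comm]
        simp only [Finset.sum_ite_eq', Finset.mem_univ, if_true, hW] }
  have hlabel : ∀ k k', M.arcOf k = M.arcOf k' → (∀ s, M.crownOf k s = M.crownOf k' s) → k = k' := by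
    intro k k' h1 h2
    apply eK.injective
    apply Subtype.ext
    exact Prod.ext h1 (Prod.ext (h2 false) (h2 true))
  have hM : M.IsOverlapSplitting δ ε w :=
    ⟨hδ, hεpos, fun _ _ => rfl, hwpos, hsmall, hadd, fun k s => (hstrip k s).2, hlabel⟩
  exact ⟨M, hM.pairwiseDisjoint, SplitMatching.noParallel_of_label_injective hlabel⟩
end

noncomputable section

namespace CrownedSurface

variable {X : CrownedSurface} {A B : GL (Fin 3) ℝ} {a b c d z : ℂ} {p q r : ℂ × ℂ}

/-! ### Orbits of cusp pairs and the geodesic sides -/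

/-- Pairs of different cusps: the oriented geodesics from cusp to cusp. -/
def cuspPairs (X : CrownedSurface) : Set (ℂ × ℂ) :=
  {p | p.1 ∈ X.cusps ∧ p.2 ∈ X.cusps ∧ p.1 ≠ p.2}

lemma swap_mem_cuspPairs (hq : q ∈ X.cuspPairs) : q.swap ∈ X.cuspPairs :=
  ⟨hq.2.1, hq.1, hq.2.2.symm⟩

lemma actPair_mem_cuspPairs (hA : A ∈ X.grp) (hq : q ∈ X.cuspPairs) :
    actPair A q ∈ X.cuspPairs :=
  ⟨X.cusps_invariant A hA _ hq.1, X.cusps_invariant A hA _ hq.2.1, fun e => hq.2.2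
    (act_injective hA (polar_of_mem_cusps hq.1).ge (polar_of_mem_cusps hq.2.1).ge e)⟩

lemma actPair_mul (hB : B ∈ X.grp) (h1 : 0 ≤ polar q.1 q.1) (h2 : 0 ≤ polar q.2 q.2) :
    actPair (A * B) q = actPair A (actPair B q) :=
  Prod.ext (act_mul_of_mem hB h1) (act_mul_of_mem hB h2)

lemma actPair_inv_actPair (hA : A ∈ X.grp) (h1 : 0 ≤ polar q.1 q.1) (h2 : 0 ≤ polar q.2 q.2) :
    actPair A⁻¹ (actPair A q) = q :=
  Prod.ext (act_inv_act hA h1) (act_inv_act hA h2)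

lemma actPair_actPair_inv (hA : A ∈ X.grp) (h1 : 0 ≤ polar q.1 q.1) (h2 : 0 ≤ polar q.2 q.2) :
    actPair A (actPair A⁻¹ q) = q :=
  Prod.ext (act_act_inv hA h1) (act_act_inv hA h2)

/-- A cusp is not an accumulation point of orbits, so the denominators of the deck transformations
at a cusp are comparable with their heights. -/
lemma exists_height_le_den (hc : c ∈ X.cusps) :
    ∃ r : ℝ, 0 < r ∧ ∀ A ∈ X.grp, height A * r ≤ den A c := by
  have hcl : c ∉ closure {z | ∃ A ∈ X.grp, z = act A 0} := fun h =>
    (X.cusps_subset hc).2 ⟨h, (X.cusps_subset hc).1⟩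
  obtain ⟨ε, hε, hball⟩ := Metric.isOpen_iff.1 isClosed_closure.isOpen_compl c hcl
  refine ⟨ε ^ 2 / 2, by positivity, fun A hA => ?_⟩
  have hp0 : (0 : ℝ) ≤ polar 0 0 := by simp [polar]
  rw [(X.isom A hA).den_eq_height_mul (isom_inv hA) (polar_of_mem_cusps hc).ge]
  apply mul_le_mul_of_nonneg_left _ (X.isom A hA).height_pos.le
  have h1 := two_mul_polar c (act A⁻¹ 0)
  have h2 := (isom_inv hA).polar_act_nonneg hp0
  have h3 : ε ≤ ‖c - act A⁻¹ 0‖ := by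
    by_contra hlt
    push Not at hlt
    exact hball (mem_ball_iff_norm'.2 hlt) (subset_closure ⟨A⁻¹, inv_mem hA, rfl⟩)
  rw [polar_of_mem_cusps hc] at h1
  nlinarith [mul_self_le_mul_self hε.le h3]

/-- The orbit of a geodesic from cusp to cusp is locally finite: if the images of its end-points stay
apart, the invariance of the Lorentz form bounds the product of their denominators, and these grow
with the height of the isometry because cusps are away from the limit set. -/
lemma exists_nhds_finite_orbit (hq : q ∈ X.cuspPairs) (hp : p.1 ≠ p.2) :
    ∃ U ∈ 𝓝 p, {A | A ∈ X.grp ∧ actPair A q ∈ U}.Finite := by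
  obtain ⟨r₁, hr₁, h₁⟩ := exists_height_le_den hq.1
  obtain ⟨r₂, hr₂, h₂⟩ := exists_height_le_den hq.2.1
  have hη : 0 < ‖p.1 - p.2‖ / 4 := by
    have := norm_pos_iff.2 (sub_ne_zero.2 hp); positivity
  set η := ‖p.1 - p.2‖ / 4 with hηd
  refine ⟨Metric.ball p.1 η ×ˢ Metric.ball p.2 η,
    prod_mem_nhds (Metric.ball_mem_nhds _ hη) (Metric.ball_mem_nhds _ hη), ?_⟩
  apply (finite_height_le (X := X) (1 / (η ^ 2 * (r₁ * r₂)) + 1)).subset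
  rintro A ⟨hA, hU⟩
  refine ⟨hA, ?_⟩
  have c1 := polar_of_mem_cusps hq.1
  have c2 := polar_of_mem_cusps hq.2.1
  have hpol := (X.isom A hA).polar_act c1.ge c2.ge
  have h2 := two_mul_polar (act A q.1) (act A q.2)
  rw [(X.isom A hA).polar_act_eq_zero c1, (X.isom A hA).polar_act_eq_zero c2] at h2
  have hd : 2 * η ≤ ‖act A q.1 - act A q.2‖ := by
    have e1 := mem_ball_iff_norm.1 hU.1
    have e2 := mem_ball_iff_norm.1 hU.2
    have e3 : ‖p.1 - p.2‖ ≤ ‖act A q.1 - p.1‖ + ‖act A q.1 - act A q.2‖ + ‖act A q.2 - p.2‖ := by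
      have : p.1 - p.2 = -(act A q.1 - p.1) + (act A q.1 - act A q.2) + (act A q.2 - p.2) := by ring
      rw [this]
      refine (norm_add_le _ _).trans (add_le_add_left ((norm_add_le _ _).trans ?_) _)
      rw [norm_neg]
    simp only [actPair] at e1 e2
    linarith
  have hP : 2 * η ^ 2 ≤ polar (act A q.1) (act A q.2) := by
    nlinarith [mul_self_le_mul_self (by positivity : 0 ≤ 2 * η) hd]
  have hh := (X.isom A hA).one_le_height
  have hh0 := (X.isom A hA).height_pos
  have hle := polar_le_two c1.ge c2.ge
  have hden : (height A * r₁) * (height A * r₂) ≤ den A q.1 * den A q.2 :=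
    mul_le_mul (h₁ A hA) (h₂ A hA) (by positivity) ((mul_pos hh0 hr₁).le.trans (h₁ A hA))
  have hfin : η ^ 2 * (r₁ * r₂) * height A ^ 2 ≤ 1 := by
    have : 2 * η ^ 2 * ((height A * r₁) * (height A * r₂)) ≤ 2 := by
      rw [← hpol] at hle
      refine (mul_le_mul hP hden (by positivity) ?_).trans hle
      exact (by positivity : (0 : ℝ) ≤ 2 * η ^ 2).trans hP
    nlinarith
  have hk : 0 < η ^ 2 * (r₁ * r₂) := by positivity
  have : height A ≤ 1 / (η ^ 2 * (r₁ * r₂)) := by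
    rw [le_div_iff₀ hk]
    nlinarith
  linarith

/-- The geodesic sides are the supporting lines of the limit set and the cusps that join cusps. -/
lemma mem_sides_iff : p ∈ X.sides ↔ p ∈ X.cuspPairs ∧
    ((∀ e ∈ limitSet X.grp ∪ X.cusps, 0 ≤ cross p.1 p.2 e) ∨
      ∀ e ∈ limitSet X.grp ∪ X.cusps, 0 ≤ cross p.2 p.1 e) := by
  have hsub := subset_convexHull ℝ (limitSet X.grp ∪ X.cusps)
  have hmin : ∀ {a b : ℂ}, (∀ e ∈ limitSet X.grp ∪ X.cusps, 0 ≤ cross a b e) →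
      ∀ e ∈ convexHull ℝ (limitSet X.grp ∪ X.cusps), 0 ≤ cross a b e := by
    intro a b h
    refine convexHull_min (t := {e | 0 ≤ cross a b e}) h ?_
    intro x hx y hy s t hs ht hst
    rw [Set.mem_ofPred_eq, cross_combo _ _ _ _ hst]
    exact add_nonneg (mul_nonneg hs hx) (mul_nonneg ht hy)
  constructor
  · rintro ⟨h1, h2, h3, h4⟩
    refine ⟨⟨h1, h2, h3⟩, ?_⟩
    have hi : (interior (convexHull ℝ (limitSet X.grp ∪ X.cusps))).Nonempty :=
      X.nonelementary.mono (interior_mono (convexHull_mono subset_union_left))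
    rcases exists_cross_sign_of_subset_frontier (convex_convexHull ℝ _) hi h3
      (hsub (Or.inr h1)) (hsub (Or.inr h2)) h4 with h | h
    · exact Or.inl fun e he => h e (hsub he)
    · exact Or.inr fun e he => h e (hsub he)
  · rintro ⟨⟨h1, h2, h3⟩, h⟩
    refine ⟨h1, h2, h3, ?_⟩
    have hseg : openSegment ℝ p.1 p.2 ⊆ convexHull ℝ (limitSet X.grp ∪ X.cusps) :=
      (convex_convexHull ℝ _).openSegment_subset (hsub (Or.inr h1)) (hsub (Or.inr h2))
    rcases h with h | h
    · exact openSegment_subset_frontier h3 hseg (hmin h)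
    · rw [openSegment_symm] at hseg ⊢
      exact openSegment_subset_frontier h3.symm hseg (hmin h)

lemma polar_of_mem_ends {e : ℂ} (he : e ∈ limitSet X.grp ∪ X.cusps) : polar e e = 0 :=
  he.elim polar_of_mem_limitSet polar_of_mem_cusps

lemma act_mem_ends {e : ℂ} (hA : A ∈ X.grp) (he : e ∈ limitSet X.grp ∪ X.cusps) :
    act A e ∈ limitSet X.grp ∪ X.cusps :=
  he.imp (act_mem_limitSet hA) (X.cusps_invariant A hA e)

lemma actPair_mem_sides (hA : A ∈ X.grp) (hp : p ∈ X.sides) : actPair A p ∈ X.sides := by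
  rw [mem_sides_iff] at hp ⊢
  have key : ∀ {a b : ℂ}, polar a a = 0 → polar b b = 0 →
      (∀ e ∈ limitSet X.grp ∪ X.cusps, 0 ≤ cross a b e) →
      ∀ e ∈ limitSet X.grp ∪ X.cusps, 0 ≤ cross (act A a) (act A b) e := by
    intro a b ha hb h e he
    have h1 := h _ (act_mem_ends (inv_mem hA) he)
    rw [← (X.isom A hA).cross_act_nonneg ha.ge hb.ge
      (polar_of_mem_ends (act_mem_ends (inv_mem hA) he)).ge,
      act_act_inv hA (polar_of_mem_ends he).ge] at h1
    exact h1
  have c1 := polar_of_mem_cusps hp.1.1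
  have c2 := polar_of_mem_cusps hp.1.2.1
  exact ⟨actPair_mem_cuspPairs hA hp.1, hp.2.imp (key c1 c2) (key c2 c1)⟩

lemma swap_mem_sides (hp : p ∈ X.sides) : p.swap ∈ X.sides := by
  rw [mem_sides_iff] at hp ⊢
  exact ⟨swap_mem_cuspPairs hp.1, hp.2.symm⟩

/-- There are finitely many geodesic sides up to deck transformations: every cusp is on at most two
of them. -/
lemma sides_finite : ∃ F : Set (ℂ × ℂ), F.Finite ∧ F ⊆ X.sides ∧
    ∀ p ∈ X.sides, ∃ A ∈ X.grp, ∃ f ∈ F, p = actPair A f := by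
  obtain ⟨C, hC, hCc, hCo⟩ := X.cusps_finite
  refine ⟨{p | p ∈ X.sides ∧ p.1 ∈ C}, ?_, fun p hp => hp.1, ?_⟩
  · have hsub : {p | p ∈ X.sides ∧ p.1 ∈ C} ⊆ ⋃ c ∈ C,
        ({p | p ∈ X.cuspPairs ∧ p.1 = c ∧ ∀ e ∈ limitSet X.grp ∪ X.cusps, 0 ≤ cross p.1 p.2 e} ∪
        {p | p ∈ X.cuspPairs ∧ p.1 = c ∧ ∀ e ∈ limitSet X.grp ∪ X.cusps, 0 ≤ cross p.2 p.1 e}) := by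
      rintro p ⟨hp, hc⟩
      rw [mem_sides_iff] at hp
      refine mem_biUnion hc ?_
      rcases hp.2 with h | h
      · exact Or.inl ⟨hp.1, rfl, h⟩
      · exact Or.inr ⟨hp.1, rfl, h⟩
    refine (hC.biUnion fun c _ => Set.Finite.union ?_ ?_).subset hsub
    all_goals
      apply Set.Subsingleton.finite
      rintro ⟨p1, p2⟩ ⟨hp, rfl, hp'⟩ ⟨q1, q2⟩ ⟨hq, hqe, hq'⟩
      simp only at hqe hp' hq'
      subst hqe
      have h1 := hp' q2 (Or.inr hq.2.1)
      have h2 := hq' p2 (Or.inr hp.2.1)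
      by_contra hne
      have hpq : p2 ≠ q2 := fun e => hne (by rw [e])
      refine cross_ne_zero_of_sphere (polar_of_mem_cusps hp.1) (polar_of_mem_cusps hp.2.1)
        (polar_of_mem_cusps hq.2.1) hp.2.2 hq.2.2 hpq ?_
      unfold cross at h1 h2 ⊢
      simp only at h1 h2 ⊢
      linarith
  · intro p hp
    obtain ⟨A, hA, f, hf, hpf⟩ := hCo p.1 hp.1
    have c1 := (polar_of_mem_cusps hp.1).ge
    have c2 := (polar_of_mem_cusps hp.2.1).ge
    refine ⟨A, hA, actPair A⁻¹ p, ⟨actPair_mem_sides (inv_mem hA) hp, ?_⟩,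
      (actPair_actPair_inv hA c1 c2).symm⟩
    change act A⁻¹ p.1 ∈ C
    rw [hpf, act_inv_act hA (polar_of_mem_cusps (hCc hf)).ge]
    exact hf

lemma sides_subset_cuspPairs : X.sides ⊆ X.cuspPairs := fun _ hp => ⟨hp.1, hp.2.1, hp.2.2.1⟩

lemma exists_nhds_finite_sides (hp : p.1 ≠ p.2) : ∃ U ∈ 𝓝 p, (X.sides ∩ U).Finite := by
  obtain ⟨F, hF, hFs, hFo⟩ := X.sides_finite
  have : ∀ f : ℂ × ℂ, ∃ U ∈ 𝓝 p, f ∈ F → {A | A ∈ X.grp ∧ actPair A f ∈ U}.Finite := by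
    intro f
    by_cases hf : f ∈ F
    · obtain ⟨U, hU, h⟩ := exists_nhds_finite_orbit (sides_subset_cuspPairs (hFs hf)) hp
      exact ⟨U, hU, fun _ => h⟩
    · exact ⟨univ, Filter.univ_mem, fun h => absurd h hf⟩
  choose U hU hfin using this
  refine ⟨⋂ f ∈ F, U f, (Filter.biInter_mem hF).2 fun f _ => hU f, ?_⟩
  refine (hF.biUnion fun f hf => (hfin f hf).image fun A => actPair A f).subset ?_
  rintro q ⟨hq, hqU⟩
  obtain ⟨A, hA, f, hf, rfl⟩ := hFo q hq
  exact mem_biUnion hf ⟨A, ⟨hA, mem_iInter₂.1 hqU f hf⟩, rfl⟩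

instance : Countable X.sides := by
  obtain ⟨F, hF, -, hFo⟩ := X.sides_finite
  refine Set.Countable.to_subtype (((hF.countable.biUnion fun f _ =>
    (countable_range fun A : X.grp => actPair (A : GL (Fin 3) ℝ) f))).mono fun p hp => ?_)
  obtain ⟨A, hA, f, hf, rfl⟩ := hFo p hp
  exact mem_biUnion hf ⟨⟨A, hA⟩, rfl⟩

/-! ### The measures carried by orbits and by the sides -/

lemma measurable_actPair (A : GL (Fin 3) ℝ) : Measurable (actPair A) := by
  have hact : Measurable (act A) := by
    have e : act A = fun z => Complex.equivRealProdCLM.symm ((act A z).re, (act A z).im) := by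
      ext z; apply Complex.ext <;> simp
    have hd : Measurable (den A) := by unfold den; fun_prop
    rw [e]
    apply Complex.equivRealProdCLM.symm.continuous.measurable.comp
    simp only [act_re, act_im]
    apply Measurable.prodMk
    · apply Measurable.div _ hd; fun_prop
    · apply Measurable.div _ hd; fun_prop
  exact (hact.comp measurable_fst).prodMk (hact.comp measurable_snd)

lemma orbitMeasure_eq_zero {S : Set (ℂ × ℂ)}
    (h : ∀ A ∈ X.grp, actPair A q ∉ S ∧ (actPair A q).swap ∉ S) : orbitMeasure X.grp q S = 0 := by
  rw [orbitMeasure, Measure.sum_apply_eq_zero]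
  rintro ⟨A, hA⟩
  rw [Measure.add_apply, Measure.dirac_apply, Measure.dirac_apply,
    indicator_of_notMem (h A hA).1, indicator_of_notMem (h A hA).2, add_zero]

/-- The measure carried by the sides. -/
def sideMeasure (X : CrownedSurface) : Measure (ℂ × ℂ) :=
  Measure.sum fun p : X.sides => (∞ : ℝ≥0∞) • Measure.dirac (p : ℂ × ℂ)

lemma sideMeasure_eq_zero {S : Set (ℂ × ℂ)} (h : ∀ p ∈ X.sides, p ∉ S) : X.sideMeasure S = 0 := by
  rw [sideMeasure, Measure.sum_apply_eq_zero]
  rintro ⟨p, hp⟩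
  rw [Measure.smul_apply, Measure.dirac_apply, indicator_of_notMem (h p hp), smul_zero]

lemma exists_nhds_orbitMeasure_lt_top (hq : q ∈ X.cuspPairs) (hp : p.1 ≠ p.2) :
    ∃ U ∈ 𝓝 p, orbitMeasure X.grp q U < ∞ := by
  obtain ⟨U, hU, hf⟩ := exists_nhds_finite_orbit hq hp
  obtain ⟨V, hV, hg⟩ := exists_nhds_finite_orbit (swap_mem_cuspPairs hq) hp
  refine ⟨U ∩ V, Filter.inter_mem hU hV, ?_⟩
  rw [orbitMeasure, Measure.sum_apply_of_countable]
  have hfin : {A : X.grp | actPair (A : GL (Fin 3) ℝ) q ∈ U ∨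
      actPair (A : GL (Fin 3) ℝ) q.swap ∈ V}.Finite := by
    apply Set.Finite.of_finite_image (f := Subtype.val) _ Subtype.val_injective.injOn
    apply (hf.union hg).subset
    rintro _ ⟨A, hA, rfl⟩
    exact hA.imp (fun h => ⟨A.2, h⟩) fun h => ⟨A.2, h⟩
  rw [tsum_eq_sum (s := hfin.toFinset)]
  · refine ENNReal.sum_lt_top.2 fun A _ => ?_
    rw [Measure.add_apply]
    exact ENNReal.add_lt_top.2 ⟨measure_lt_top _ _, measure_lt_top _ _⟩
  · intro A hA
    rw [Set.Finite.mem_toFinset] at hA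
    rw [Measure.add_apply, Measure.dirac_apply, Measure.dirac_apply,
      indicator_of_notMem fun h => hA (Or.inl h.1),
      indicator_of_notMem fun h => hA (Or.inr h.2), add_zero]

/-- The leaves of the orbit of a geodesic from cusp to cusp are its translates. -/
lemma exists_of_mem_support_orbitMeasure (hq : q ∈ X.cuspPairs) (hp : p.1 ≠ p.2)
    (h : p ∈ (orbitMeasure X.grp q).support) :
    ∃ A ∈ X.grp, p = actPair A q ∨ p = (actPair A q).swap := by
  by_contra hc
  push Not at hc
  obtain ⟨U, hU, hf⟩ := exists_nhds_finite_orbit hq hp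
  obtain ⟨V, hV, hg⟩ := exists_nhds_finite_orbit (swap_mem_cuspPairs hq) hp
  set S := (fun A => actPair A q) '' {A | A ∈ X.grp ∧ actPair A q ∈ U} ∪
    (fun A => actPair A q.swap) '' {A | A ∈ X.grp ∧ actPair A q.swap ∈ V}
  have hS : S.Finite := (hf.image _).union (hg.image _)
  have hpS : p ∉ S := by
    rintro (⟨A, ⟨hA, -⟩, e⟩ | ⟨A, ⟨hA, -⟩, e⟩)
    · exact (hc A hA).1 e.symm
    · exact (hc A hA).2 e.symm
  refine Measure.notMem_support_iff_exists.2 ⟨U ∩ V ∩ Sᶜ,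
    Filter.inter_mem (Filter.inter_mem hU hV) (hS.isClosed.isOpen_compl.mem_nhds hpS), ?_⟩ h
  apply orbitMeasure_eq_zero
  exact fun A hA => ⟨fun h => h.2 (Or.inl ⟨A, ⟨hA, h.1.1⟩, rfl⟩),
    fun h => h.2 (Or.inr ⟨A, ⟨hA, h.1.2⟩, rfl⟩)⟩

lemma exists_nhds_sideMeasure_eq_zero (hp : p.1 ≠ p.2) (h : p ∉ X.sides) :
    ∃ U ∈ 𝓝 p, X.sideMeasure U = 0 := by
  obtain ⟨U, hU, hf⟩ := exists_nhds_finite_sides (X := X) hp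
  refine ⟨U ∩ (X.sides ∩ U)ᶜ, Filter.inter_mem hU
    (hf.isClosed.isOpen_compl.mem_nhds fun h' => h h'.1), sideMeasure_eq_zero ?_⟩
  exact fun q hq h' => h'.2 ⟨hq, h'.1⟩

lemma mem_sides_of_mem_support (hp : p.1 ≠ p.2) (h : p ∈ X.sideMeasure.support) : p ∈ X.sides := by
  by_contra hc
  exact Measure.notMem_support_iff_exists.2 (exists_nhds_sideMeasure_eq_zero hp hc) h

lemma map_sum_equiv {ι α β : Type*} [Countable ι] [MeasurableSpace α] [MeasurableSpace β]
    {f : α → β} (hf : Measurable f) {μ : ι → Measure α} {ν : ι → Measure β} (e : ι ≃ ι)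
    (h : ∀ i, (μ i).map f = ν (e i)) : (Measure.sum μ).map f = Measure.sum ν := by
  ext s hs
  rw [Measure.map_apply hf hs, Measure.sum_apply _ (hf hs), Measure.sum_apply _ hs,
    ← e.tsum_eq fun i => ν i s]
  exact tsum_congr fun i => by rw [← h, Measure.map_apply hf hs]

lemma map_actPair_orbitMeasure (hq : q ∈ X.cuspPairs) (hA : A ∈ X.grp) :
    (orbitMeasure X.grp q).map (actPair A) = orbitMeasure X.grp q := by
  refine map_sum_equiv (measurable_actPair A) (Equiv.mulLeft (⟨A, hA⟩ : X.grp)) fun B => ?_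
  have c1 := (polar_of_mem_cusps hq.1).ge
  have c2 := (polar_of_mem_cusps hq.2.1).ge
  rw [Measure.map_add _ _ (measurable_actPair A), Measure.map_dirac' (measurable_actPair A),
    Measure.map_dirac' (measurable_actPair A), Equiv.coe_mulLeft, Subgroup.coe_mul,
    actPair_mul B.2 c1 c2]
  rfl

lemma map_swap_orbitMeasure :
    (orbitMeasure X.grp q).map Prod.swap = orbitMeasure X.grp q := by
  refine map_sum_equiv measurable_swap (Equiv.refl _) fun B => ?_
  rw [Measure.map_add _ _ measurable_swap, Measure.map_dirac' measurable_swap,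
    Measure.map_dirac' measurable_swap, Prod.swap_swap, add_comm]
  rfl

lemma map_actPair_sideMeasure (hA : A ∈ X.grp) : X.sideMeasure.map (actPair A) = X.sideMeasure := by
  have inv : ∀ p ∈ X.sides, actPair A⁻¹ (actPair A p) = p ∧ actPair A (actPair A⁻¹ p) = p :=
    fun p hp => ⟨actPair_inv_actPair hA (polar_of_mem_cusps hp.1).ge (polar_of_mem_cusps hp.2.1).ge,
      actPair_actPair_inv hA (polar_of_mem_cusps hp.1).ge (polar_of_mem_cusps hp.2.1).ge⟩
  refine map_sum_equiv (measurable_actPair A)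
    ⟨fun p => ⟨actPair A p, actPair_mem_sides hA p.2⟩,
      fun p => ⟨actPair A⁻¹ p, actPair_mem_sides (inv_mem hA) p.2⟩,
      fun p => Subtype.ext (inv p p.2).1, fun p => Subtype.ext (inv p p.2).2⟩ fun p => ?_
  rw [Measure.map_smul, Measure.map_dirac' (measurable_actPair A)]
  rfl

lemma map_swap_sideMeasure : X.sideMeasure.map Prod.swap = X.sideMeasure := by
  refine map_sum_equiv measurable_swap
    ⟨fun p => ⟨p.1.swap, swap_mem_sides p.2⟩, fun p => ⟨p.1.swap, swap_mem_sides p.2⟩,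
      fun p => Subtype.ext (Prod.swap_swap _), fun p => Subtype.ext (Prod.swap_swap _)⟩ fun p => ?_
  rw [Measure.map_smul, Measure.map_dirac' measurable_swap]
  rfl

end CrownedSurface
end

noncomputable section

open CrownedSurface

variable {X : CrownedSurface} {A B : GL (Fin 3) ℝ} {a b c d y z t v w : ℂ} {p q : ℂ × ℂ}

/-! ### Geodesics that do not cross -/

/-- The geodesics joining two pairs of ideal points coincide or are disjoint. -/
def NonCrossing (p q : ℂ × ℂ) : Prop :=
  p = q ∨ p = q.swap ∨ Disjoint (openSegment ℝ p.1 p.2) (openSegment ℝ q.1 q.2)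

namespace NonCrossing

lemma symm (h : NonCrossing p q) : NonCrossing q p := by
  rcases h with h | h | h
  · exact Or.inl h.symm
  · exact Or.inr (Or.inl (by rw [h, Prod.swap_swap]))
  · exact Or.inr (Or.inr h.symm)

lemma swap_left (h : NonCrossing p.swap q) : NonCrossing p q := by
  rcases h with h | h | h
  · exact Or.inr (Or.inl (by rw [← h, Prod.swap_swap]))
  · exact Or.inl (Prod.swap_injective h)
  · refine Or.inr (Or.inr ?_)
    rwa [openSegment_symm]

lemma swap_right (h : NonCrossing p q.swap) : NonCrossing p q := h.symm.swap_left.symm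

lemma act (hA : A ∈ X.grp) (h1 : 0 ≤ polar p.1 p.1) (h2 : 0 ≤ polar p.2 p.2)
    (h3 : 0 ≤ polar q.1 q.1) (h4 : 0 ≤ polar q.2 q.2) (h : NonCrossing p q) :
    NonCrossing (actPair A p) (actPair A q) := by
  rcases h with rfl | rfl | h
  · exact Or.inl rfl
  · exact Or.inr (Or.inl rfl)
  · refine Or.inr (Or.inr (Set.disjoint_left.2 fun x hx hx' => ?_))
    have key : ∀ {r : ℂ × ℂ}, 0 ≤ polar r.1 r.1 → 0 ≤ polar r.2 r.2 →
        x ∈ openSegment ℝ (actPair A r).1 (actPair A r).2 →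
        _root_.act A⁻¹ x ∈ openSegment ℝ r.1 r.2 := by
      intro r hr1 hr2 hx
      have := (isom_inv hA).act_mem_openSegment ((X.isom A hA).polar_act_nonneg hr1)
        ((X.isom A hA).polar_act_nonneg hr2) hx
      rwa [act_inv_act hA hr1, act_inv_act hA hr2] at this
    exact Set.disjoint_left.1 h (key h1 h2 hx) (key h3 h4 hx')

/-- A geodesic with both end-points on one side of another one does not cross it. -/
lemma of_same_side (ha : polar a a = 0) (hb : polar b b = 0) (hc : polar c c = 0)
    (hd : polar d d = 0) (hab : a ≠ b) (hcd : c ≠ d)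
    (h : (0 ≤ cross a b c ∧ 0 ≤ cross a b d) ∨ (cross a b c ≤ 0 ∧ cross a b d ≤ 0)) :
    NonCrossing (a, b) (c, d) := by
  by_cases h0 : cross a b c = 0 ∧ cross a b d = 0
  · have key : ∀ {e}, polar e e = 0 → cross a b e = 0 → a = e ∨ b = e := by
      intro e he h
      by_contra hne
      push Not at hne
      exact cross_ne_zero_of_sphere ha hb he hab hne.1 hne.2 h
    rcases key hc h0.1 with rfl | rfl <;> rcases key hd h0.2 with rfl | rfl
    · exact absurd rfl hcd
    · exact Or.inl rfl
    · exact Or.inr (Or.inl rfl)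
    · exact absurd rfl hcd
  · refine Or.inr (Or.inr (Set.disjoint_left.2 fun x hx hx' => h0 ?_))
    obtain ⟨s, t, hs, ht, hst, rfl⟩ := hx'
    have h1 : cross a b (s • c + t • d) = 0 := IsEdge.cross_eq_zero hx
    rw [cross_combo _ _ _ _ hst] at h1
    rcases h with ⟨e1, e2⟩ | ⟨e1, e2⟩
    · have f1 := mul_nonneg hs.le e1
      have f2 := mul_nonneg ht.le e2
      exact ⟨(mul_eq_zero.1 (by linarith : s * cross a b c = 0)).resolve_left hs.ne',
        (mul_eq_zero.1 (by linarith : t * cross a b d = 0)).resolve_left ht.ne'⟩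
    · have f1 := mul_nonpos_of_nonneg_of_nonpos hs.le e1
      have f2 := mul_nonpos_of_nonneg_of_nonpos ht.le e2
      exact ⟨(mul_eq_zero.1 (by linarith : s * cross a b c = 0)).resolve_left hs.ne',
        (mul_eq_zero.1 (by linarith : t * cross a b d = 0)).resolve_left ht.ne'⟩

end NonCrossing

/-- The tips of two disjoint crown arcs with starting points `y` and `v` on one boundary geodesic
are in the order of the starting points, also when seen from a point `t` on the other side. -/
lemma CrownedSurface.IsEdge.cross_tip_of_ray (h : X.IsEdge a b) (hy : y ∈ openSegment ℝ a b)
    (hv : v ∈ openSegment ℝ a b) (hc : polar c c = 0) (hd : polar d d = 0)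
    (hn : cross a b c < 0) (hn' : cross a b d < 0) (hdis : Disjoint (ray y c) (ray v d))
    (hz : 0 < cross a b z) (ht : 0 ≤ polar t t) (ht' : 0 < cross a b t) :
    (0 < cross y z v → 0 ≤ cross c t d) ∧ (cross y z v < 0 → cross c t d ≤ 0) := by
  have hyp := (h.polar_pos hy).le
  have hvp := (h.polar_pos hv).le
  constructor
  · intro hlt
    rw [h.cross_chord_pos_iff hy hv hz] at hlt
    have := cross_tips_nonneg hd hc hn' hn hvp (IsEdge.cross_eq_zero hv).ge ht ht'.le
      ((h.disjoint_ray_iff hv hy hd hc hn' hn hlt).1 hdis.symm)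
    rwa [← cross_rotate, ← cross_rotate] at this
  · intro hlt
    rw [h.cross_chord_neg_iff hy hv hz] at hlt
    have := cross_tips_nonneg hc hd hn hn' hyp (IsEdge.cross_eq_zero hy).ge ht ht'.le
      ((h.disjoint_ray_iff hy hv hc hd hn hn' hlt).1 hdis)
    rw [cross_swap] at this
    linarith

/-- The leaves of an invariant lamination are permuted by the deck transformations. -/
lemma actPair_mem_leaves {μ : Measure (ℂ × ℂ)} (hμ : ∀ A ∈ X.grp, μ.map (actPair A) = μ)
    (hA : A ∈ X.grp) (h1 : 0 ≤ polar p.1 p.1) (h2 : 0 ≤ polar p.2 p.2) (hp : p ∈ leaves μ) :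
    actPair A p ∈ leaves μ := by
  refine ⟨fun e => hp.1 (act_injective hA h1 h2 e), ?_⟩
  rw [Measure.mem_support_iff_forall]
  intro U hU
  have hc : ContinuousAt (actPair A) p :=
    (((X.isom A hA).continuousAt_act h1).comp continuousAt_fst).prodMk
      (((X.isom A hA).continuousAt_act h2).comp continuousAt_snd)
  refine ((Measure.mem_support_iff_forall p).1 hp.2 _ (hc hU)).trans_le ?_
  have := Measure.le_map_apply (μ := μ) (measurable_actPair A).aemeasurable U
  rwa [hμ A hA] at this

lemma mem_of_mem_leaves {Γ : Subgroup (GL (Fin 3) ℝ)} {E : Set ℂ} {T : Set (ℂ × ℂ)}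
    {μ : Measure (ℂ × ℂ)} (hμ : IsMeasuredLamination Γ E T μ) (hE : IsClosed E)
    (hp : p ∈ leaves μ) : p.1 ∈ E ∧ p.2 ∈ E := by
  have key : ∀ U : Set (ℂ × ℂ), IsOpen U → U ⊆ {p | p.1 = p.2 ∨ p.1 ∉ E ∨ p.2 ∉ E} → p ∉ U := by
    intro U hU hs hm
    exact ((Measure.mem_support_iff_forall p).1 hp.2 U (hU.mem_nhds hm)).ne'
      (measure_mono_null hs hμ.concentrated)
  constructor
  · by_contra h
    exact key _ (hE.isOpen_compl.preimage continuous_fst) (fun q hq => Or.inr (Or.inl hq)) h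
  · by_contra h
    exact key _ (hE.isOpen_compl.preimage continuous_snd) (fun q hq => Or.inr (Or.inr hq)) h

lemma exists_mem_support_of_sum {ι : Type*} {s : Finset ι} {c : ι → ℝ≥0∞}
    {μ : ι → Measure (ℂ × ℂ)} (h : p ∈ (∑ i ∈ s, c i • μ i).support) :
    ∃ i, p ∈ (μ i).support := by
  classical
  induction s using Finset.induction_on with
  | empty => simp at h
  | insert i s hi ih =>
    rw [Finset.sum_insert hi, Measure.support_add] at h
    rcases h with h | h
    · exact ⟨i, Measure.AbsolutelyContinuous.support_mono Measure.smul_absolutelyContinuous h⟩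
    · exact ih h

lemma isClosed_limitSet : IsClosed (limitSet X.grp) := isClosed_closure.inter Metric.isClosed_sphere

namespace SurfaceLamination

variable (L : SurfaceLamination X)

lemma mem_limitSet_of_mem_leaves (hp : p ∈ leaves L.lam) :
    p.1 ∈ limitSet X.grp ∧ p.2 ∈ limitSet X.grp :=
  mem_of_mem_leaves L.isLamination isClosed_limitSet hp

lemma actPair_mem_leaves (hA : A ∈ X.grp) (hp : p ∈ leaves L.lam) :
    actPair A p ∈ leaves L.lam := by
  obtain ⟨h1, h2⟩ := L.mem_limitSet_of_mem_leaves hp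
  exact _root_.actPair_mem_leaves L.isLamination.invariant hA (polar_of_mem_limitSet h1).ge
    (polar_of_mem_limitSet h2).ge hp

end SurfaceLamination

namespace CrownLamination

variable (G : CrownLamination X)

lemma nonCrossing_diag (i j : Fin G.m) (hA : A ∈ X.grp) :
    NonCrossing (G.diag i) (actPair A (G.diag j)) := by
  rcases G.diag_disjoint i j A hA with ⟨rfl, rfl⟩ | h
  · exact Or.inl (Prod.ext (act_one _).symm (act_one _).symm)
  · exact Or.inr (Or.inr h)

lemma nonCrossing_diag_limitSet (i : Fin G.m) (h1 : p.1 ∈ limitSet X.grp)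
    (h2 : p.2 ∈ limitSet X.grp) : NonCrossing (G.diag i) p :=
  Or.inr (Or.inr ((G.diag_crown i).mono_right (convex_limitHull.openSegment_subset
    (limitSet_subset_limitHull h1) (limitSet_subset_limitHull h2))))

/-- Both end-points of the crown arcs are on one side of an arc between cusps. -/
lemma cross_diag (i : Fin G.m) : ∃ σ : ℝ, (σ = 1 ∨ σ = -1) ∧ ∀ j, ∀ A ∈ X.grp,
    0 ≤ σ * cross (G.diag i).1 (G.diag i).2 (act A (G.tip j)) := by
  obtain ⟨d1, d2, hne⟩ := G.diag_cusps i
  have c1 := polar_of_mem_cusps d1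
  have c2 := polar_of_mem_cusps d2
  set f := cross (G.diag i).1 (G.diag i).2 with hf
  have hmem : ∀ {x}, 0 < polar x x → f x = 0 → x ∈ openSegment ℝ (G.diag i).1 (G.diag i).2 := by
    intro x hx h0
    refine mem_openSegment_of_cross_eq_zero c1 c2 hne hx.le ?_ ?_ h0
    · rintro rfl; exact hx.ne' c1
    · rintro rfl; exact hx.ne' c2
  obtain ⟨o, ho, hop, -⟩ := X.exists_center
  -- the points of the hull in the open disc are on the same side as its center
  have hside : ∀ x ∈ limitHull X.grp, 0 < polar x x → 0 < f o * f x := by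
    intro x hx hxp
    by_contra hc
    have hn : ∀ {x}, x ∈ limitHull X.grp → 0 < polar x x → f x ≠ 0 := fun hx hxp h0 =>
      Set.disjoint_left.1 (G.diag_crown i) (hmem hxp h0) hx
    have hlt : f o * f x < 0 := lt_of_le_of_ne (not_lt.1 hc) (mul_ne_zero (hn ho hop) (hn hx hxp))
    obtain ⟨s, t, hs, ht, hst, h0⟩ := exists_combo_cross_eq_zero hlt
    refine hn (convex_limitHull ho hx hs.le ht.le hst) ?_ h0
    rw [polar_combo_self _ _ hst]
    have := polar_nonneg hop.le hxp.le
    positivity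
  have hray : ∀ j, ∀ A ∈ X.grp, 0 ≤ f o * f (act A (G.tip j)) := by
    intro j A hA
    have harc := (G.isArc j).act hA
    obtain ⟨a, b, h, hm, -⟩ := isCrownArc_iff.1 harc
    have hp := h.polar_pos hm
    have h1 := hside _ (h.openSegment_subset hm) hp
    by_contra hc
    push Not at hc
    have hlt : f (act A (G.foot j)) * f (act A (G.tip j)) < 0 := by
      by_contra hge
      push Not at hge
      nlinarith [mul_nonneg h1.le hge, mul_neg_of_pos_of_neg h1 hc, sq_nonneg (f o),
        mul_self_nonneg (f (act A (G.foot j)))]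
    obtain ⟨s, t, hs, ht, hst, h0⟩ := exists_combo_cross_eq_zero hlt
    have hne' := harc.ne
    refine Set.disjoint_left.1 (G.diag_disjoint_arc i j A hA) (hmem ?_ h0)
      ⟨⟨s, t, hs.le, ht.le, hst, rfl⟩, fun e => ?_⟩
    · exact polar_openSegment_pos hp.le harc.polar_tip.ge hne' ⟨s, t, hs, ht, hst, rfl⟩
    · have hpos := polar_openSegment_pos hp.le harc.polar_tip.ge hne' ⟨s, t, hs, ht, hst, rfl⟩
      rw [mem_singleton_iff] at e
      rw [e] at hpos
      exact hpos.ne' harc.polar_tip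
  rcases lt_or_ge (f o) 0 with h0 | h0
  · refine ⟨-1, Or.inr rfl, fun j A hA => ?_⟩
    have := hray j A hA
    by_contra hc
    push Not at hc
    nlinarith
  · refine ⟨1, Or.inl rfl, fun j A hA => ?_⟩
    have := hray j A hA
    have hpos : 0 < f o := lt_of_le_of_ne h0 fun e => by
      have := hside o ho hop
      rw [← e] at this
      simp at this
    by_contra hc
    push Not at hc
    nlinarith

end CrownLamination

namespace SplitMatching

variable {G : CrownLamination X} {L : SurfaceLamination X} {M : SplitMatching G L}

/-- The ideal end-points of a strand. -/
def tips (M : SplitMatching G L) (k : Fin M.n) : ℂ × ℂ := (M.tip k false, M.tip k true)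

lemma tips_mem_cuspPairs (k : Fin M.n) : M.tips k ∈ X.cuspPairs := by
  refine ⟨(M.crown_arc k false).2.1, (M.crown_arc k true).2.1, fun e => ?_⟩
  obtain ⟨a, b, h, -, n, hneg⟩ := M.exists_edges (one_mem _) k
  have e' : M.tip k false = M.tip k true := e
  simp only [act_one] at hneg
  have h1 := (h false).mem_cap_of_neg (M.crown_arc k false).polar_tip (hneg false)
  have h2 := (h false).cross_pos_of_mem_cap (h true) n h1
  rw [e'] at h2
  exact h2.not_gt (hneg true)

/-- The geodesic representatives of disjoint strands do not cross. -/
lemma PairwiseDisjoint.nonCrossing (hM : M.PairwiseDisjoint) (hA : A ∈ X.grp) (hB : B ∈ X.grp)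
    (k k' : Fin M.n) : NonCrossing (actPair A (M.tips k)) (actPair B (M.tips k')) := by
  by_cases hne : k = k' ∧ A = B
  · obtain ⟨rfl, rfl⟩ := hne
    exact Or.inl rfl
  have hss := (hM.disjoint_segment hA hB k k' false false).resolve_left hne
  have hrr := fun s r => (hM.disjoint_ray hA hB k k' s r).resolve_left hne
  obtain ⟨a, b, h, hy, n, hc⟩ := M.exists_edges hA k
  obtain ⟨a', b', h', hv, n', hd⟩ := M.exists_edges hB k'
  have pc := fun s => ((M.crown_arc k s).act hA).polar_tip
  have pd := fun s => ((M.crown_arc k' s).act hB).polar_tip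
  have hvy : ∀ r s, act B (M.pt k' r) ≠ act A (M.pt k s) := by
    intro r s e
    refine Set.disjoint_left.1 (hrr s r) (left_mem_ray ((M.crown_arc k s).act hA).ne) ?_
    rw [← e]
    exact left_mem_ray ((M.crown_arc k' r).act hB).ne
  have capc := fun s => (h s).mem_cap_of_neg (pc s) (hc s)
  have capd := fun r => (h' r).mem_cap_of_neg (pd r) (hd r)
  -- an end of the second strand is weakly on the side of the first on which it crosses the
  -- boundary; equality is possible, as strands may end at the same cusp
  have hside : ∀ r,
      (0 < cross (act A (M.pt k false)) (act A (M.pt k true)) (act B (M.pt k' r)) →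
        0 ≤ cross (act A (M.tip k false)) (act A (M.tip k true)) (act B (M.tip k' r))) ∧
      (cross (act A (M.pt k false)) (act A (M.pt k true)) (act B (M.pt k' r)) < 0 →
        cross (act A (M.tip k false)) (act A (M.tip k true)) (act B (M.tip k' r)) ≤ 0) := by
    intro r
    by_cases e0 : a false = a' r ∧ b false = b' r
    · have hv' := hv r
      have hd' := hd r
      rw [← e0.1, ← e0.2] at hv' hd'
      exact (h false).cross_tip_of_ray (hy false) hv' (pc false) (pd r) (hc false) hd'
        (hrr false r) ((h true).cross_pos_of_mem (h false) (ne_symm n) (hy true)) (pc true).ge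
        ((h true).cross_pos_of_mem_cap (h false) (ne_symm n) (capc true))
    by_cases e1 : a true = a' r ∧ b true = b' r
    · have hv' := hv r
      have hd' := hd r
      rw [← e1.1, ← e1.2] at hv' hd'
      have key := (h true).cross_tip_of_ray (hy true) hv' (pc true) (pd r) (hc true) hd'
        (hrr true r) ((h false).cross_pos_of_mem (h true) n (hy false)) (pc false).ge
        ((h false).cross_pos_of_mem_cap (h true) n (capc false))
      rw [cross_swap (act A (M.pt k false)), cross_swap (act A (M.tip k false))] at key
      exact ⟨fun hh => by linarith [key.2 (by linarith)], fun hh => by linarith [key.1 (by linarith)]⟩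
    have hiff := cross_pos_iff_of_convex (h false).convex_cap (h true).convex_cap
      (h' r).convex_cap (fun _ hu _ hv _ hw =>
        (h false).cross_ne_zero_of_caps (h true) (h' r) n e0 e1 hu hv hw)
      ((h false).subset_cap (hy false)) (capc false) ((h true).subset_cap (hy true)) (capc true)
      ((h' r).subset_cap (hv r)) (capd r)
    exact ⟨fun hh => (hiff.1 hh).le, fun hh => not_lt.1 fun hh' => hh.not_gt (hiff.2 hh')⟩
  have hpos := (h false).mul_cross_pos_of_disjoint (h true) n (hy false) (hy true)
    ((h' false).openSegment_subset (hv false)) ((h' true).openSegment_subset (hv true))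
    ((h false).cross_chord_ne_zero (h true) (h' false) n (hy _) (hy _) (hv _) (hvy _ _) (hvy _ _))
    ((h false).cross_chord_ne_zero (h true) (h' true) n (hy _) (hy _) (hv _) (hvy _ _) (hvy _ _))
    (hss.mono_right (openSegment_subset_segment ℝ _ _))
  refine NonCrossing.of_same_side (pc false) (pc true) (pd false) (pd true)
    (actPair_mem_cuspPairs hA (M.tips_mem_cuspPairs k)).2.2
    (actPair_mem_cuspPairs hB (M.tips_mem_cuspPairs k')).2.2 ?_
  rcases mul_pos_iff.1 hpos with ⟨h1, h2⟩ | ⟨h1, h2⟩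
  · exact Or.inl ⟨(hside false).1 h1, (hside true).1 h2⟩
  · exact Or.inr ⟨(hside false).2 h1, (hside true).2 h2⟩

/-- The strands do not cross the leaves of the lamination on the surface: moving the end-points of
an arc behind the boundary geodesics on which they lie does not change the side on which a limit
point is. -/
lemma nonCrossing_leaf (hA : A ∈ X.grp) (k : Fin M.n) (hp : p ∈ leaves L.lam) :
    NonCrossing (actPair A (M.tips k)) p := by
  obtain ⟨C, hC, hCs⟩ := M.surface_copy k
  have key : ∀ {p}, p ∈ leaves L.lam → NonCrossing (actPair C (M.tips k)) p := by
    intro p hp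
    obtain ⟨l1, l2⟩ := L.mem_limitSet_of_mem_leaves hp
    obtain ⟨a, b, h, hy, n, hc⟩ := M.exists_edges hC k
    have pc := fun s => ((M.crown_arc k s).act hC).polar_tip
    have hx : ∀ s, L.pt (M.arcOf k) s ∈ openSegment ℝ (a s) (b s) := by
      intro s
      obtain ⟨a', b', h', h1, h2⟩ := (hCs s).exists_edge
      obtain ⟨e1, e2⟩ := (h s).eq_of_mem h' (hy s) h1
      rwa [e1, e2]
    have hne : ∀ l ∈ limitSet X.grp, ∀ u ∈ cap (a false) (b false), ∀ v ∈ cap (a true) (b true),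
        ∀ w ∈ ({l} : Set ℂ), cross u v w ≠ 0 := by
      rintro l hl u hu v hv w rfl
      exact (h false).cross_ne_zero_of_caps_limit (h true) n hu hv hl
    have c0 := fun s => (h s).subset_cap (hx s)
    have c1 := fun s => (h s).mem_cap_of_neg (pc s) (hc s)
    have hiff := fun l hl => cross_pos_iff_of_convex (h false).convex_cap (h true).convex_cap
      (convex_singleton l) (hne l hl) (c0 false) (c1 false) (c0 true) (c1 true)
      (mem_singleton l) (mem_singleton l)
    have hpos := (h false).mul_cross_pos_of_disjoint (h true) n (hx false) (hx true)
      (limitSet_subset_limitHull l1) (limitSet_subset_limitHull l2)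
      (hne _ l1 _ (c0 _) _ (c0 _) _ rfl) (hne _ l2 _ (c0 _) _ (c0 _) _ rfl)
      (L.lam_disjoint p hp (M.arcOf k)).symm
    refine NonCrossing.of_same_side (pc false) (pc true) (polar_of_mem_limitSet l1)
      (polar_of_mem_limitSet l2) (actPair_mem_cuspPairs hC (M.tips_mem_cuspPairs k)).2.2 hp.1 ?_
    rcases mul_pos_iff.1 hpos with ⟨h1, h2⟩ | ⟨h1, h2⟩
    · exact Or.inl ⟨((hiff _ l1).1 h1).le, ((hiff _ l2).1 h2).le⟩
    · exact Or.inr ⟨not_lt.1 fun e => h1.not_gt ((hiff _ l1).2 e),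
        not_lt.1 fun e => h2.not_gt ((hiff _ l2).2 e)⟩
  obtain ⟨l1, l2⟩ := L.mem_limitSet_of_mem_leaves hp
  have t := M.tips_mem_cuspPairs k
  have t' := actPair_mem_cuspPairs hC t
  have hD := mul_mem hA (inv_mem hC)
  have q1 := (polar_of_mem_cusps t.1).ge
  have q2 := (polar_of_mem_cusps t.2.1).ge
  have hl := L.actPair_mem_leaves (inv_mem hD) hp
  obtain ⟨l1', l2'⟩ := L.mem_limitSet_of_mem_leaves hl
  have := (key hl).act hD (polar_of_mem_cusps t'.1).ge (polar_of_mem_cusps t'.2.1).ge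
    (polar_of_mem_limitSet l1').ge (polar_of_mem_limitSet l2').ge
  rwa [actPair_actPair_inv hD (polar_of_mem_limitSet l1).ge (polar_of_mem_limitSet l2).ge,
    actPair_mul (inv_mem hC) (polar_of_mem_cusps t'.1).ge (polar_of_mem_cusps t'.2.1).ge,
    actPair_inv_actPair hC q1 q2] at this

/-- The strands do not cross the arcs between cusps. -/
lemma nonCrossing_diag (hA : A ∈ X.grp) (k : Fin M.n) (i : Fin G.m) :
    NonCrossing (G.diag i) (actPair A (M.tips k)) := by
  obtain ⟨σ, hσ, hs⟩ := G.cross_diag i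
  have htip : ∀ s, 0 ≤ σ * cross (G.diag i).1 (G.diag i).2 (act A (M.tip k s)) := by
    intro s
    obtain ⟨B, hB, hBt, -⟩ := M.crown_copy k s
    have := hs (M.crownOf k s) (A * B⁻¹) (mul_mem hA (inv_mem hB))
    rwa [act_mul_of_mem (inv_mem hB) (G.isArc _).polar_tip.ge, ← hBt,
      act_inv_act hB (M.crown_arc k s).polar_tip.ge] at this
  obtain ⟨d1, d2, hne⟩ := G.diag_cusps i
  have t := actPair_mem_cuspPairs hA (M.tips_mem_cuspPairs k)
  refine NonCrossing.of_same_side (polar_of_mem_cusps d1) (polar_of_mem_cusps d2)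
    (polar_of_mem_cusps t.1) (polar_of_mem_cusps t.2.1) hne t.2.2 ?_
  have h1 := htip false
  have h2 := htip true
  rcases hσ with rfl | rfl
  · rw [one_mul] at h1 h2
    exact Or.inl ⟨h1, h2⟩
  · exact Or.inr ⟨by change cross _ _ (act A (M.tip k false)) ≤ 0; linarith,
      by change cross _ _ (act A (M.tip k true)) ≤ 0; linarith⟩

end SplitMatching

/-- The sides do not cross any geodesic with end-points in the limit set and the cusps. -/
lemma nonCrossing_side (hp : p ∈ X.sides) (h1 : q.1 ∈ limitSet X.grp ∪ X.cusps)
    (h2 : q.2 ∈ limitSet X.grp ∪ X.cusps) (hq : q.1 ≠ q.2) : NonCrossing p q := by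
  obtain ⟨⟨c1, c2, hne⟩, h⟩ := mem_sides_iff.1 hp
  refine NonCrossing.of_same_side (polar_of_mem_cusps c1) (polar_of_mem_cusps c2)
    (polar_of_mem_ends h1) (polar_of_mem_ends h2) hne hq ?_
  rcases h with h | h
  · exact Or.inl ⟨h _ h1, h _ h2⟩
  · have e1 := h _ h1
    have e2 := h _ h2
    rw [cross_swap] at e1 e2
    exact Or.inr ⟨by linarith, by linarith⟩

namespace SplitMatching

variable {G : CrownLamination X} {L : SurfaceLamination X} (M : SplitMatching G L)

/-! ### The glued lamination -/

/-- The geodesics that make up the glued lamination, with one orientation for each. -/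
inductive IsPiece : ℂ × ℂ → Prop
  | strand (A : GL (Fin 3) ℝ) (hA : A ∈ X.grp) (k : Fin M.n) : IsPiece (actPair A (M.tips k))
  | leaf (p : ℂ × ℂ) (hp : p ∈ leaves L.lam) : IsPiece p
  | diag (A : GL (Fin 3) ℝ) (hA : A ∈ X.grp) (i : Fin G.m) : IsPiece (actPair A (G.diag i))
  | side (p : ℂ × ℂ) (hp : p ∈ X.sides) : IsPiece p

variable {M}

lemma IsPiece.ends (h : M.IsPiece p) :
    p.1 ∈ limitSet X.grp ∪ X.cusps ∧ p.2 ∈ limitSet X.grp ∪ X.cusps ∧ p.1 ≠ p.2 := by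
  have key : ∀ {q}, q ∈ X.cuspPairs →
    q.1 ∈ limitSet X.grp ∪ X.cusps ∧ q.2 ∈ limitSet X.grp ∪ X.cusps ∧ q.1 ≠ q.2 :=
    fun hq => ⟨Or.inr hq.1, Or.inr hq.2.1, hq.2.2⟩
  cases h with
  | strand A hA k => exact key (actPair_mem_cuspPairs hA (M.tips_mem_cuspPairs k))
  | leaf _ hp =>
    exact ⟨Or.inl (L.mem_limitSet_of_mem_leaves hp).1, Or.inl (L.mem_limitSet_of_mem_leaves hp).2,
      hp.1⟩
  | diag A hA i => exact key (actPair_mem_cuspPairs hA (G.diag_cusps i))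
  | side _ hp => exact key (sides_subset_cuspPairs hp)

lemma IsPiece.act (h : M.IsPiece p) (hA : A ∈ X.grp) : M.IsPiece (actPair A p) := by
  have key : ∀ {B q}, B ∈ X.grp → q ∈ X.cuspPairs →
      actPair A (actPair B q) = actPair (A * B) q := fun hB hq =>
    (actPair_mul hB (polar_of_mem_cusps hq.1).ge (polar_of_mem_cusps hq.2.1).ge).symm
  cases h with
  | strand B hB k =>
    rw [key hB (M.tips_mem_cuspPairs k)]
    exact .strand _ (mul_mem hA hB) k
  | leaf _ hp => exact .leaf _ (L.actPair_mem_leaves hA hp)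
  | diag B hB i =>
    rw [key hB (G.diag_cusps i)]
    exact .diag _ (mul_mem hA hB) i
  | side _ hp => exact .side _ (actPair_mem_sides hA hp)

/-- The geodesics that make up the glued lamination do not cross each other. -/
lemma IsPiece.nonCrossing (hM : M.PairwiseDisjoint) (hp : M.IsPiece p) (hq : M.IsPiece q) :
    NonCrossing p q := by
  have hdiag : ∀ i {q}, M.IsPiece q → NonCrossing (G.diag i) q := by
    intro i q hq
    cases hq with
    | strand B hB k => exact nonCrossing_diag hB k i
    | leaf _ hq =>
      exact G.nonCrossing_diag_limitSet i (L.mem_limitSet_of_mem_leaves hq).1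
        (L.mem_limitSet_of_mem_leaves hq).2
    | diag B hB j => exact G.nonCrossing_diag i j hB
    | side _ hq =>
      obtain ⟨h1, h2, h3⟩ := G.diag_cusps i
      exact (nonCrossing_side hq (Or.inr h1) (Or.inr h2) h3).symm
  have hdiag' : ∀ A ∈ X.grp, ∀ i {q}, M.IsPiece q → NonCrossing (actPair A (G.diag i)) q := by
    intro A hA i q hq
    obtain ⟨h1, h2, -⟩ := hq.ends
    obtain ⟨h1', h2', -⟩ := (hq.act (inv_mem hA)).ends
    have := (hdiag i (hq.act (inv_mem hA))).act hA (polar_of_mem_cusps (G.diag_cusps i).1).ge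
      (polar_of_mem_cusps (G.diag_cusps i).2.1).ge (polar_of_mem_ends h1').ge
      (polar_of_mem_ends h2').ge
    rwa [actPair_actPair_inv hA (polar_of_mem_ends h1).ge (polar_of_mem_ends h2).ge] at this
  have hside : ∀ {p q}, p ∈ X.sides → M.IsPiece q → NonCrossing p q :=
    fun hp hq => nonCrossing_side hp hq.ends.1 hq.ends.2.1 hq.ends.2.2
  cases hp with
  | diag A hA i => exact hdiag' A hA i hq
  | side _ hp => exact hside hp hq
  | strand A hA k =>
    cases hq with
    | strand B hB k' => exact hM.nonCrossing hA hB k k'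
    | leaf _ hq => exact nonCrossing_leaf hA k hq
    | diag B hB i => exact (hdiag' B hB i (.strand A hA k)).symm
    | side _ hq => exact (hside hq (.strand A hA k)).symm
  | leaf _ hp =>
    cases hq with
    | strand B hB k' => exact (nonCrossing_leaf hB k' hp).symm
    | leaf _ hq => exact L.isLamination.not_cross _ hp _ hq
    | diag B hB i => exact (hdiag' B hB i (.leaf _ hp)).symm
    | side _ hq => exact (hside hq (.leaf _ hp)).symm

lemma isPiece_of_mem_leaves (hp : p ∈ leaves M.glued) : M.IsPiece p ∨ M.IsPiece p.swap := by
  obtain ⟨hne, h⟩ := hp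
  rw [glued, Measure.support_add, Measure.support_add, Measure.support_add] at h
  have orbit : ∀ {q}, q ∈ X.cuspPairs → p ∈ (orbitMeasure X.grp q).support →
      ∃ A ∈ X.grp, p = actPair A q ∨ p.swap = actPair A q := by
    intro q hq h
    obtain ⟨A, hA, h⟩ := exists_of_mem_support_orbitMeasure hq hne h
    exact ⟨A, hA, h.imp_right fun e => by rw [e, Prod.swap_swap]⟩
  rcases h with ((h | h) | h) | h
  · obtain ⟨k, h⟩ := exists_mem_support_of_sum h
    obtain ⟨A, hA, h | h⟩ := orbit (M.tips_mem_cuspPairs k) h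
    · exact Or.inl (h ▸ .strand A hA k)
    · exact Or.inr (h ▸ .strand A hA k)
  · exact Or.inl (.leaf _ ⟨hne, h⟩)
  · obtain ⟨i, h⟩ := exists_mem_support_of_sum h
    obtain ⟨A, hA, h | h⟩ := orbit (G.diag_cusps i) h
    · exact Or.inl (h ▸ .diag A hA i)
    · exact Or.inr (h ▸ .diag A hA i)
  · exact Or.inl (.side _ (mem_sides_of_mem_support hne h))

lemma glued_apply (S : Set (ℂ × ℂ)) : M.glued S =
    (∑ k, ENNReal.ofReal (M.arcWeight k) * orbitMeasure X.grp (M.tips k) S) + L.lam S +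
    (∑ i, ENNReal.ofReal (G.diagWeight i) * orbitMeasure X.grp (G.diag i) S) +
    X.sideMeasure S := by
  simp only [glued, Measure.add_apply, Measure.finsetSum_apply, Measure.smul_apply, smul_eq_mul]
  rfl

lemma map_glued {f : ℂ × ℂ → ℂ × ℂ} (hf : Measurable f)
    (ho : ∀ q ∈ X.cuspPairs, (orbitMeasure X.grp q).map f = orbitMeasure X.grp q)
    (hl : L.lam.map f = L.lam) (hs : X.sideMeasure.map f = X.sideMeasure) :
    M.glued.map f = M.glued := by
  have key : ∀ {μ : Measure (ℂ × ℂ)} {S}, MeasurableSet S → μ.map f = μ → μ (f ⁻¹' S) = μ S :=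
    fun hS h => by rw [← Measure.map_apply hf hS, h]
  ext S hS
  rw [Measure.map_apply hf hS, glued_apply, glued_apply, key hS hl, key hS hs]
  simp only [key hS (ho _ (M.tips_mem_cuspPairs _)), key hS (ho _ (G.diag_cusps _))]

/-- The geodesic representatives of disjoint strands, together with the given laminations and the
sides, form a measured lamination. -/
lemma PairwiseDisjoint.isMeasuredLamination (hM : M.PairwiseDisjoint) :
    IsMeasuredLamination X.grp (limitSet X.grp ∪ X.cusps) X.sides M.glued where
  concentrated := by
    have ho : ∀ {q}, q ∈ X.cuspPairs → orbitMeasure X.grp q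
        {p | p.1 = p.2 ∨ p.1 ∉ limitSet X.grp ∪ X.cusps ∨ p.2 ∉ limitSet X.grp ∪ X.cusps} = 0 := by
      intro q hq
      refine orbitMeasure_eq_zero fun A hA => ?_
      have key : ∀ {p}, p ∈ X.cuspPairs → p ∉
          {p | p.1 = p.2 ∨ p.1 ∉ limitSet X.grp ∪ X.cusps ∨ p.2 ∉ limitSet X.grp ∪ X.cusps} := by
        rintro p ⟨h1, h2, h3⟩ (e | e | e)
        · exact h3 e
        · exact e (Or.inr h1)
        · exact e (Or.inr h2)
      exact ⟨key (actPair_mem_cuspPairs hA hq),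
        key (swap_mem_cuspPairs (actPair_mem_cuspPairs hA hq))⟩
    have hl : L.lam
        {p | p.1 = p.2 ∨ p.1 ∉ limitSet X.grp ∪ X.cusps ∨ p.2 ∉ limitSet X.grp ∪ X.cusps} = 0 := by
      refine measure_mono_null ?_ L.isLamination.concentrated
      exact fun p hp => hp.imp_right (Or.imp (fun h h' => h (Or.inl h')) fun h h' => h (Or.inl h'))
    have hs : X.sideMeasure
        {p | p.1 = p.2 ∨ p.1 ∉ limitSet X.grp ∪ X.cusps ∨ p.2 ∉ limitSet X.grp ∪ X.cusps} = 0 := by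
      refine sideMeasure_eq_zero ?_
      rintro p ⟨h1, h2, h3, -⟩ (e | e | e)
      · exact h3 e
      · exact e (Or.inr h1)
      · exact e (Or.inr h2)
    rw [glued_apply, hl, hs]
    simp only [ho (M.tips_mem_cuspPairs _), ho (G.diag_cusps _), mul_zero, Finset.sum_const_zero,
      add_zero]
  invariant A hA := map_glued (measurable_actPair A) (fun _ hq => map_actPair_orbitMeasure hq hA)
    (L.isLamination.invariant A hA) (map_actPair_sideMeasure hA)
  symmetric := map_glued measurable_swap (fun _ _ => map_swap_orbitMeasure)
    L.isLamination.symmetric map_swap_sideMeasure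
  not_cross p hp q hq := by
    change NonCrossing p q
    rcases isPiece_of_mem_leaves hp with hp | hp <;> rcases isPiece_of_mem_leaves hq with hq | hq
    · exact hp.nonCrossing hM hq
    · exact (hp.nonCrossing hM hq).swap_right
    · exact (hp.nonCrossing hM hq).swap_left
    · exact (hp.nonCrossing hM hq).swap_right.swap_left
  infinite_weight p hp := by
    rw [glued_apply]
    apply top_unique
    refine le_trans ?_ le_add_self
    refine le_trans ?_ (Measure.le_sum (fun p : X.sides => (∞ : ℝ≥0∞) • Measure.dirac (p : ℂ × ℂ))
      ⟨p, hp⟩ {p})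
    simp
  locally_finite p hne hp := by
    have h1 : ∀ k, ∃ U ∈ 𝓝 p, orbitMeasure X.grp (M.tips k) U < ∞ := fun k =>
      exists_nhds_orbitMeasure_lt_top (M.tips_mem_cuspPairs k) hne
    have h2 : ∀ i, ∃ U ∈ 𝓝 p, orbitMeasure X.grp (G.diag i) U < ∞ := fun i =>
      exists_nhds_orbitMeasure_lt_top (G.diag_cusps i) hne
    choose U hU hU' using h1
    choose V hV hV' using h2
    obtain ⟨W, hW, hW'⟩ := L.isLamination.locally_finite p hne (notMem_empty _)
    obtain ⟨Y, hY, hY'⟩ := exists_nhds_sideMeasure_eq_zero hne hp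
    refine ⟨(⋂ k, U k) ∩ (⋂ i, V i) ∩ W ∩ Y, Filter.inter_mem (Filter.inter_mem (Filter.inter_mem
      (Filter.iInter_mem.2 hU) (Filter.iInter_mem.2 hV)) hW) hY, ?_⟩
    rw [glued_apply, measure_mono_null inter_subset_right hY', add_zero]
    refine ENNReal.add_lt_top.2 ⟨ENNReal.add_lt_top.2 ⟨?_, ?_⟩, ?_⟩
    · refine ENNReal.sum_lt_top.2 fun k _ => ENNReal.mul_lt_top ENNReal.ofReal_lt_top
        ((measure_mono fun x hx => ?_).trans_lt (hU' k))
      exact mem_iInter.1 hx.1.1.1 k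
    · exact (measure_mono (inter_subset_left.trans inter_subset_right)).trans_lt hW'
    · refine ENNReal.sum_lt_top.2 fun i _ => ENNReal.mul_lt_top ENNReal.ofReal_lt_top
        ((measure_mono fun x hx => ?_).trans_lt (hV' i))
      exact mem_iInter.1 hx.1.1.2 i
  finite_exits := by
    obtain ⟨F, hF, -, hFo⟩ := X.sides_finite
    set F' := (range M.tips ∪ range G.diag) ∪ F with hF'
    have hfin : F'.Finite := ((finite_range _).union (finite_range _)).union hF
    refine ⟨F' ∪ Prod.swap '' F', hfin.union (hfin.image _), fun p hp hl => ?_⟩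
    have key : ∀ {p}, M.IsPiece p → (p.1 ∉ limitSet X.grp ∨ p.2 ∉ limitSet X.grp) →
        ∃ A ∈ X.grp, ∃ q ∈ F', p = actPair A q := by
      intro p hp hl
      cases hp with
      | strand A hA k => exact ⟨A, hA, _, Or.inl (Or.inl ⟨k, rfl⟩), rfl⟩
      | leaf _ hp =>
        obtain ⟨h1, h2⟩ := L.mem_limitSet_of_mem_leaves hp
        exact absurd hl (not_or.2 ⟨not_not.2 h1, not_not.2 h2⟩)
      | diag A hA i => exact ⟨A, hA, _, Or.inl (Or.inr ⟨i, rfl⟩), rfl⟩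
      | side _ hp =>
        obtain ⟨A, hA, f, hf, e⟩ := hFo _ hp
        exact ⟨A, hA, f, Or.inr hf, e⟩
    rcases isPiece_of_mem_leaves hp with hp | hp
    · obtain ⟨A, hA, q, hq, e⟩ := key hp hl
      exact ⟨A, hA, q, Or.inl hq, e⟩
    · obtain ⟨A, hA, q, hq, e⟩ := key hp hl.symm
      exact ⟨A, hA, q.swap, Or.inr ⟨q, hq, rfl⟩, Prod.swap_injective e⟩

end SplitMatching

end

theorem propositionA (X : CrownedSurface) (G : CrownLamination X) (L : SurfaceLamination X)
    (hGL : ∀ β ∈ boundaryLines X.grp, G.boundaryMeasure β = L.boundaryMeasure β) :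
    ∃ M : SplitMatching G L,
      M.PairwiseDisjoint ∧ M.NoParallel ∧
      IsMeasuredLamination X.grp (limitSet X.grp ∪ X.cusps) X.sides M.glued ∧
      ∀ M' : SplitMatching G L, M'.PairwiseDisjoint → M'.NoParallel → M.Equivalent M' := by
  obtain ⟨M, hM, hP⟩ := exists_splitMatching G L hGL
  exact ⟨M, hM, hP, hM.isMeasuredLamination, fun M' hM' hP' =>
    SplitMatching.equivalent_of_disjoint hM hP hM' hP' hGL⟩
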